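/- **Setting.** A finite-horizon linear constrained MDP has horizon $H\ge 1$, finite state and action spaces $\mathcal S,\mathcal A$, initial state $s_1$, budget $b\in[0,H]$, a known feature map $\phi:\mathcal S\times\mathcal A\to\mathbb R^d$ with $\|\phi(s,a)\|_2\le 1$, transition kernels $\mathbb P_h(s'\mid s,a)=\phi(s,a)^\top\psi_h(s')$ and mean costs $g_h(s,a)=\phi(s,a)^\top\theta_{g,h}$, where $\psi_h(s'),\theta_{g,h}\in\mathbb R^d$ are unknown, $\|\sum_{s'}|\psi_h|(s')\|_2\le\sqrt d$ (entrywise absolute values) and $\|\theta_{g,h}\|_2\le\sqrt d$. There are $K$ episodes, where $K^{1/4}$ is an integer. At the start of episode $k$ an adversary, knowing the past and possibly randomizing, chooses a loss $f_h^k(s,a)=\phi(s,a)^\top\theta_{f,h}^k\in[0,1]$ with $\|\theta_{f,h}^k\|_2\le\sqrt d$; independently of this choice and of the past, a cost function $g^k=(g_h^k)_{h}$, with values in $[0,1]$, is drawn from a fixed distribution with $\mathbb E[g_h^k(s,a)]=g_h(s,a)$. Then $s_1^k=s_1$ and for $h=1,\dots,H$ the learner draws $a_h^k\sim\widehat\pi_h^k(\cdot\mid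 s_h^k)$, observes $\theta_{f,h}^k$ and $g_h^k(s_h^k,a_h^k)$, and $s_{h+1}^k\sim\mathbb P_h(\cdot\mid s_h^k,a_h^k)$. Write $\psi_hV=\sum_{s'}\psi_h(s')V(s')$ and $\|x\|_\Lambda=\sqrt{x^\top\Lambda x}$. **Parameters.** Let $\delta\in(0,1)$, step sizes $\alpha,\eta>0$, $\theta=K^{-1}$, and $$\beta_r=2\sqrt{2d\log(6KH/\delta)},\quad \beta_p=50(K^{1/4}+1)dH\sqrt{\log(5H^2K^2|\mathcal A|/\delta)},\quad \beta_Q=2H,\quad \beta_b=\beta_r+\beta_p,\quad \beta_w=4\beta_b\log K.$$ **Algorithm.** Put $\Lambda_h^k=I+\sum_{\tau<k}\phi(s_h^\tau,a_h^\tau)\phi(s_h^\tau,a_h^\tau)^\top$. A new epoch starts at episode $k$ (and $k_e:=k$) if $k=1$ or $\det\Lambda_{h'}^k\ge 2\det\Lambda_{h'}^{k_e}$ for some $h'$; then $\widehat\pi_h^k$ is reset to the uniform policy $\pi_{\rm unif}$ and $Y_k$ to $0$. In episode $k$, with $\sigma$ the sigmoid, $\bar\phi_h^{k_e}(s,a)=\phi(s,a)\,\sigma(-\beta_w\|\phi(s,a)\|_{(\Lambda_h^{k_e})^{-1}}+\log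 K)$, $\widehat\theta_{f,h}^k=\theta_{f,h}^k$, $\widehat\theta_{g,h}^k=(\Lambda_h^k)^{-1}\sum_{\tau<k}\phi(s_h^\tau,a_h^\tau)g_h^\tau(s_h^\tau,a_h^\tau)$, $\widehat\psi_h^kV=(\Lambda_h^k)^{-1}\sum_{\tau<k}\phi(s_h^\tau,a_h^\tau)V(s_{h+1}^\tau)$, and, backwards from $\widehat V_{\ell,H+1}^k=0$ for $\ell\in\{f,g\}$, $$\widehat Q_{\ell,h}^k=(\bar\phi_h^{k_e})^\top\big[\widehat\theta_{\ell,h}^k+\widehat\psi_h^k\widehat V_{\ell,h+1}^k\big]-\beta_b\|\bar\phi_h^{k_e}\|_{(\Lambda_h^{k_e})^{-1}},\qquad \widehat V_{\ell,h}^k(s)=\sum_a\widehat\pi_h^k(a\mid s)\widehat Q_{\ell,h}^k(s,a).$$ Let $\widetilde\pi_h^k=(1-\theta)\widehat\pi_h^k+\theta\pi_{\rm unif}$ if $K^{3/4}$ divides $k-k_e$, and $\widetilde\pi_h^k=\widehat\pi_h^k$ otherwise. Then $\widehat\pi_h^{k+1}(\cdot\mid s)\propto\widetilde\pi_h^k(\cdot\mid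 s)\exp\big(-\alpha(\widehat Q_{f,h}^k(s,\cdot)+Y_k\widehat Q_{g,h}^k(s,\cdot))\big)$ and $Y_{k+1}=\big[(1-4\alpha\eta H^3)Y_k+\eta(\widehat V_{g,1}^k(s_1)-b-4\alpha H^3-4\theta H^2)\big]_+$, unless episode $k+1$ starts a new epoch. **Good event.** Let $E_g=E_1\cap E_2\cap E_3$, where * $E_1$: for all $k\in[K]$, $h\in[H]$: $\|\theta_{f,h}^k-\widehat\theta_{f,h}^k\|_{\Lambda_h^k}\le\beta_r$ and $\|\theta_{g,h}-\widehat\theta_{g,h}^k\|_{\Lambda_h^k}\le\beta_r$; * $E_2$: for all $k\in[K]$, $h\in[H]$, $\ell\in\{f,g\}$: $\|(\psi_h-\widehat\psi_h^k)\widehat V_{\ell,h+1}^k\|_{\Lambda_h^k}\le\beta_p$, $\|\widehat Q_{\ell,h}^k\|_\infty\le\beta_Q$ and $Y_k\le 11\eta H^3K$; * $E_3$: $\sum_{k=1}^K\mathbb E_{\mathbb P,\widehat\pi^k}[W_k]\le 2\sum_{k=1}^KW_k+4H(3\beta_b+8\beta_Q\beta_w^2)\log\frac{6K}{\delta}$,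 where $W_k=\sum_{h=1}^H\big(3\beta_b\|\phi(s_h^k,a_h^k)\|_{(\Lambda_h^k)^{-1}}+8\beta_Q\beta_w^2\|\phi(s_h^k,a_h^k)\|_{(\Lambda_h^k)^{-1}}^2\big)$ and $\mathbb E_{\mathbb P,\widehat\pi^k}$ averages over the trajectory of episode $k$ with $\Lambda_h^k$ and $\widehat\pi^k$ fixed. **Lemma.** If $1\le\beta_w\le K$, $\alpha\le 1$, $\eta\le 1$ and $4\alpha\eta H^3\le 1$, then $\Pr[E_g]\ge 1-\delta$. -/

import Mathlib

open MeasureTheory ProbabilityTheory Matrix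

noncomputable section

namespace LinCMDP

/-! ### Linear constrained Markov decision processes

Steps are `h : Fin H` (so step `h` of the code is step `h + 1` in one-based notation), states of an
episode are indexed by `Fin (H + 1)`, and episodes are `0, 1, …, K - 1`. -/

/-- Weighted norm `‖x‖_Λ = √(xᵀ Λ x)`. -/
def wnorm {d : ℕ} (Λ : Matrix (Fin d) (Fin d) ℝ) (x : Fin d → ℝ) : ℝ :=
  √(x ⬝ᵥ (Λ *ᵥ x))

/-- Euclidean norm of a coordinate vector. -/
def l2norm {d : ℕ} (x : Fin d → ℝ) : ℝ := ‖WithLp.toLp 2 x‖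

/-- The part of a linear CMDP that is known to the learner: features, initial state, budget. -/
structure KnownPart (S A : Type*) (d : ℕ) where
  φ : S → A → Fin d → ℝ
  s₁ : S
  b : ℝ

/-- A linear CMDP with horizon `H` and feature dimension `d`. The cost functions are drawn from the
distribution `G` on functions `g = (g_h)_h`; the adversarial losses belong to the interaction. -/
structure LinearCMDP (S A : Type*) [Fintype S] (H d : ℕ) extends KnownPart S A d where
  P : Fin H → S → A → S → ℝ
  P_nonneg : ∀ h s a s', 0 ≤ P h s a s'
  P_sum : ∀ h s a, ∑ s', P h s a s' = 1
  ψ : Fin H → S → Fin d → ℝ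
  P_linear : ∀ h s a s', P h s a s' = φ s a ⬝ᵥ ψ h s'
  G : Measure (Fin H → S → A → ℝ)
  G_prob : IsProbabilityMeasure G
  G_mem : ∀ᵐ g ∂G, ∀ h s a, g h s a ∈ Set.Icc (0 : ℝ) 1
  θg : Fin H → Fin d → ℝ
  G_mean : ∀ h s a, ∫ g, g h s a ∂G = φ s a ⬝ᵥ θg h
  b_mem : b ∈ Set.Icc (0 : ℝ) H
  φ_norm : ∀ s a, l2norm (φ s a) ≤ 1
  ψ_norm : ∀ h, l2norm (fun i => ∑ s', |ψ h s' i|) ≤ √d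
  θg_norm : ∀ h, l2norm (θg h) ≤ √d

/-- `ψ_h V = ∑ s', ψ_h(s') V(s')`. -/
def LinearCMDP.psiOp {S A : Type*} [Fintype S] {H d : ℕ} (M : LinearCMDP S A H d)
    (h : Fin H) (V : S → ℝ) : Fin d → ℝ :=
  ∑ s', V s' • M.ψ h s'

/-- `E_{P,π}[∑_{j ≥ h} w_j(s_j, a_j) ∣ s_h = s]`, by backward recursion over the steps. -/
def LinearCMDP.value {S A : Type*} [Fintype S] [Fintype A] {H d : ℕ} (M : LinearCMDP S A H d)
    (π w : Fin H → S → A → ℝ) (h : Fin (H + 1)) : S → ℝ :=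
  Fin.reverseInduction (motive := fun _ => S → ℝ) (fun _ => 0)
    (fun j Vnext s => ∑ a, π j s a * (w j s a + ∑ s', M.P j s a s' * Vnext s')) h

/-! ### Parameters -/

/-- Number of episodes, confidence level, and the step sizes of the policy and dual updates. -/
structure Params where
  K : ℕ
  δ : ℝ
  α : ℝ
  η : ℝ

namespace Params

/-- The mixing parameter `θ = 1 / K`. -/
def θ (p : Params) : ℝ := (p.K : ℝ)⁻¹

/-- The mixing period `K^{3/4}` (an integer when `K` is a fourth power). -/
def period (p : Params) : ℕ := ⌊(p.K : ℝ) ^ (3 / 4 : ℝ)⌋₊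

def βr (p : Params) (H d : ℕ) : ℝ :=
  2 * √(2 * d * Real.log (6 * p.K * H / p.δ))

/-- Here `nA` stands for the number of actions. -/
def βp (p : Params) (H d nA : ℕ) : ℝ :=
  50 * ((p.K : ℝ) ^ (1 / 4 : ℝ) + 1) * d * H * √(Real.log (5 * H ^ 2 * p.K ^ 2 * nA / p.δ))

def βb (p : Params) (H d nA : ℕ) : ℝ := p.βr H d + p.βp H d nA

def βw (p : Params) (H d nA : ℕ) : ℝ := 4 * p.βb H d nA * Real.log p.K

end Params

/-- `β_Q = 2H`. -/
def βQ (H : ℕ) : ℝ := 2 * H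

/-! ### The learning algorithm, as a function of the observed data -/

/-- What the learner observes: in episode `k`, the states `s k h`, the actions `a k h`, the incurred
costs `c k h` (bandit feedback) and the loss parameters `θf k h` (full information). -/
structure Observations (S A : Type*) (H d : ℕ) where
  s : ℕ → Fin (H + 1) → S
  a : ℕ → Fin H → A
  c : ℕ → Fin H → ℝ
  θf : ℕ → Fin H → Fin d → ℝ

/-- The index `ℓ ∈ {f, g}`. -/
inductive Kind
  | f
  | g

/-- Quantities in force during an episode: first episode `k_e` of the current epoch, policy `π̂^k`
and dual variable `Y_k`. -/
structure LearnerState (S A : Type*) (H : ℕ) where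
  start : ℕ
  policy : Fin H → S → A → ℝ
  Y : ℝ

/-- Uniform policy. -/
def unif (S A : Type*) [Fintype A] (H : ℕ) : Fin H → S → A → ℝ :=
  fun _ _ _ => (Fintype.card A : ℝ)⁻¹

section Algorithm

variable {S A : Type*} [Fintype A] {H d : ℕ}
  (E : KnownPart S A d) (p : Params) (o : Observations S A H d)

/-- Feature `φ(s_h^k, a_h^k)` of the pair visited at step `h` of episode `k`. -/
def visited (k : ℕ) (h : Fin H) : Fin d → ℝ := E.φ (o.s k h.castSucc) (o.a k h)

/-- Design matrix `Λ_h^k = I + ∑_{τ<k} φ(s_h^τ,a_h^τ) φ(s_h^τ,a_h^τ)ᵀ`. -/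
def design (k : ℕ) (h : Fin H) : Matrix (Fin d) (Fin d) ℝ :=
  1 + ∑ τ ∈ Finset.range k, vecMulVec (visited E o τ h) (visited E o τ h)

/-- `θ̂_{f,h}^k = θ_{f,h}^k`, and the ridge regression estimate `θ̂_{g,h}^k`. -/
def thetaHat (k : ℕ) (h : Fin H) : Kind → Fin d → ℝ
  | .f => o.θf k h
  | .g => (design E o k h)⁻¹ *ᵥ ∑ τ ∈ Finset.range k, o.c τ h • visited E o τ h

/-- `ψ̂_h^k V = (Λ_h^k)⁻¹ ∑_{τ<k} φ(s_h^τ,a_h^τ) V(s_{h+1}^τ)`. -/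
def psiHat (k : ℕ) (h : Fin H) (V : S → ℝ) : Fin d → ℝ :=
  (design E o k h)⁻¹ *ᵥ ∑ τ ∈ Finset.range k, V (o.s τ h.succ) • visited E o τ h

/-- Contracted feature `φ̄_h^{k_e}` for the epoch that starts at episode `ke`. -/
def contracted (ke : ℕ) (h : Fin H) (s : S) (a : A) : Fin d → ℝ :=
  Real.sigmoid (-p.βw H d (Fintype.card A) * wnorm (design E o ke h)⁻¹ (E.φ s a) + Real.log p.K)
    • E.φ s a

/-- `Q̂_{ℓ,h}^k`, given the next-step value estimate `V = V̂_{ℓ,h+1}^k`. -/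
def qStep (ke k : ℕ) (l : Kind) (h : Fin H) (V : S → ℝ) (s : S) (a : A) : ℝ :=
  contracted E p o ke h s a ⬝ᵥ (thetaHat E o k h l + psiHat E o k h V)
    - p.βb H d (Fintype.card A) * wnorm (design E o ke h)⁻¹ (contracted E p o ke h s a)

/-- `V̂_{ℓ,h}^k` by backward recursion, for the epoch start and policy stored in `st`. -/
def vEst (st : LearnerState S A H) (k : ℕ) (l : Kind) (h : Fin (H + 1)) : S → ℝ :=
  Fin.reverseInduction (motive := fun _ => S → ℝ) (fun _ => 0)
    (fun j Vnext s => ∑ a, st.policy j s a * qStep E p o st.start k l j Vnext s a) h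

/-- `Q̂_{ℓ,h}^k`, for the epoch start and policy stored in `st`. -/
def qEst (st : LearnerState S A H) (k : ℕ) (l : Kind) (h : Fin H) : S → A → ℝ :=
  qStep E p o st.start k l h (vEst E p o st k l h.succ)

/-- Periodic policy mixing `π̃_h^k`. -/
def mixedPolicy (st : LearnerState S A H) (k : ℕ) : Fin H → S → A → ℝ :=
  fun h s a =>
    if p.period ∣ (k - st.start) then
      (1 - p.θ) * st.policy h s a + p.θ * unif S A H h s a
    else st.policy h s a

/-- Unnormalised weights of `π̂_h^{k+1}`. -/
def policyWeight (st : LearnerState S A H) (k : ℕ) (h : Fin H) (s : S) (a : A) : ℝ :=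
  mixedPolicy p st k h s a *
    Real.exp (-p.α * (qEst E p o st k .f h s a + st.Y * qEst E p o st k .g h s a))

/-- Policy optimisation and regularised dual update at the end of episode `k`. -/
def endEpisode (st : LearnerState S A H) (k : ℕ) : LearnerState S A H where
  start := st.start
  policy := fun h s a => policyWeight E p o st k h s a / ∑ a', policyWeight E p o st k h s a'
  Y := max 0 ((1 - 4 * p.α * p.η * H ^ 3) * st.Y +
    p.η * (vEst E p o st k .g 0 E.s₁ - E.b - 4 * p.α * H ^ 3 - 4 * p.θ * H ^ 2))

/-- Start of a new epoch at episode `k`. -/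
def newEpoch (S A : Type*) [Fintype A] (H : ℕ) (k : ℕ) : LearnerState S A H where
  start := k
  policy := unif S A H
  Y := 0

open Classical in
/-- `(k_e, π̂^k, Y_k)` as used in episode `k`, after the possible start of a new epoch. -/
def learner : ℕ → LearnerState S A H
  | 0 => newEpoch S A H 0
  | k + 1 =>
    if ∃ h : Fin H, 2 * (design E o (learner k).start h).det ≤ (design E o (k + 1) h).det then
      newEpoch S A H (k + 1)
    else endEpisode E p o (learner k) k

/-- The value estimate `V̂_{ℓ,h}^k` produced by the algorithm. -/
def Vhat (k : ℕ) (l : Kind) (h : Fin (H + 1)) : S → ℝ := vEst E p o (learner E p o k) k l h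

/-- The `Q`-function estimate `Q̂_{ℓ,h}^k` produced by the algorithm. -/
def Qhat (k : ℕ) (l : Kind) (h : Fin H) : S → A → ℝ := qEst E p o (learner E p o k) k l h

/-- `3 β_b ‖φ(s,a)‖ + 8 β_Q β_w² ‖φ(s,a)‖²`, norms weighted by `(Λ_h^k)⁻¹`. -/
def bonusW (k : ℕ) (h : Fin H) (s : S) (a : A) : ℝ :=
  3 * p.βb H d (Fintype.card A) * wnorm (design E o k h)⁻¹ (E.φ s a)
    + 8 * βQ H * p.βw H d (Fintype.card A) ^ 2 * wnorm (design E o k h)⁻¹ (E.φ s a) ^ 2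

/-- `W_k`, the sum of the previous quantity along the trajectory of episode `k`. -/
def Wsum (k : ℕ) : ℝ := ∑ h : Fin H, bonusW E p o k h (o.s k h.castSucc) (o.a k h)

end Algorithm

/-! ### The good event -/

section GoodEvent

variable {S A : Type*} [Fintype S] [Fintype A] {H d : ℕ} (M : LinearCMDP S A H d) (p : Params)

/-- `E₁`: confidence bounds for the loss and cost parameters. -/
def event1 : Set (Observations S A H d) :=
  {o | ∀ k < p.K, ∀ h : Fin H,
    wnorm (design M.toKnownPart o k h) (o.θf k h - thetaHat M.toKnownPart o k h .f) ≤ p.βr H d ∧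
    wnorm (design M.toKnownPart o k h) (M.θg h - thetaHat M.toKnownPart o k h .g) ≤ p.βr H d}

/-- `E₂`: confidence bounds for the transition operators on the value estimates, and boundedness of
the `Q`-function estimates and of the dual variable. -/
def event2 : Set (Observations S A H d) :=
  {o | ∀ k < p.K, ∀ (h : Fin H) (l : Kind),
    wnorm (design M.toKnownPart o k h)
      (M.psiOp h (Vhat M.toKnownPart p o k l h.succ)
        - psiHat M.toKnownPart o k h (Vhat M.toKnownPart p o k l h.succ))
        ≤ p.βp H d (Fintype.card A) ∧
    (∀ s a, |Qhat M.toKnownPart p o k l h s a| ≤ βQ H) ∧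
    (learner M.toKnownPart p o k).Y ≤ 11 * p.η * H ^ 3 * p.K}

/-- `E₃`: `∑_k E_{P,π̂^k}[W_k] ≤ 2 ∑_k W_k + 4H(3β_b + 8β_Q β_w²) log(6K/δ)`. The expectation is over
a fresh trajectory of `π̂^k`, with the design matrices of episode `k` held fixed. -/
def event3 : Set (Observations S A H d) :=
  {o | ∑ k ∈ Finset.range p.K,
      M.value (learner M.toKnownPart p o k).policy (bonusW M.toKnownPart p o k) 0 M.s₁
    ≤ 2 * ∑ k ∈ Finset.range p.K, Wsum M.toKnownPart p o k
      + 4 * H * (3 * p.βb H d (Fintype.card A) + 8 * βQ H * p.βw H d (Fintype.card A) ^ 2)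
        * Real.log (6 * p.K / p.δ)}

/-- `E_g = E₁ ∩ E₂ ∩ E₃`. -/
def goodEvent : Set (Observations S A H d) :=
  event1 M p ∩ event2 M p ∩ event3 M p

end GoodEvent

/-! ### The random interaction of learner and environment -/

section Interaction

variable {S A : Type*} {H d : ℕ} {Ω : Type*}

/-- Data observed by the learner; of the cost function `g k ω` only the values at visited pairs. -/
def observe (s : ℕ → Fin (H + 1) → Ω → S) (a : ℕ → Fin H → Ω → A)
    (g : ℕ → Ω → Fin H → S → A → ℝ) (θf : ℕ → Fin H → Ω → Fin d → ℝ) (ω : Ω) :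
    Observations S A H d where
  s := fun k h => s k h ω
  a := fun k h => a k h ω
  c := fun k h => g k ω h (s k h.castSucc ω) (a k h ω)
  θf := fun k h => θf k h ω

/-- Information just before the action of step `h` in episode `k` is drawn: the information `𝓕k`
available when the episode starts, the cost function of the episode, the states up to step `h` and
the actions before step `h`. -/
abbrev beforeAction [MeasurableSpace S] [MeasurableSpace A] (𝓕k : MeasurableSpace Ω)
    (s : ℕ → Fin (H + 1) → Ω → S) (a : ℕ → Fin H → Ω → A)
    (g : ℕ → Ω → Fin H → S → A → ℝ) (k : ℕ) (h : Fin H) : MeasurableSpace Ω :=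
  𝓕k ⊔ MeasurableSpace.comap (g k) inferInstance
    ⊔ (⨆ (j : Fin (H + 1)) (_ : j ≤ h.castSucc), MeasurableSpace.comap (s k j) inferInstance)
    ⊔ (⨆ (j : Fin H) (_ : j < h), MeasurableSpace.comap (a k j) inferInstance)

/-- The random variables `s, a, g, θf` on the probability space `(Ω, μ)` describe `K` episodes of the
algorithm in the linear CMDP `M`. The σ-algebra `𝓕 k` is the information at the start of episode `k`:
it contains everything that happened in earlier episodes, and possibly more, so that the adversary,
whose choice in episode `k` is `𝓕 k`-measurable, may be adaptive and randomised. -/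
structure IsInteraction [Fintype S] [Fintype A] [MeasurableSpace S] [MeasurableSpace A]
    [mΩ : MeasurableSpace Ω] (M : LinearCMDP S A H d) (p : Params) (μ : Measure Ω)
    (𝓕 : Filtration ℕ mΩ) (s : ℕ → Fin (H + 1) → Ω → S) (a : ℕ → Fin H → Ω → A)
    (g : ℕ → Ω → Fin H → S → A → ℝ) (θf : ℕ → Fin H → Ω → Fin d → ℝ) : Prop where
  /-- The states, actions and costs of an episode are part of the later history. -/
  s_past : ∀ k < p.K, ∀ h, Measurable[𝓕 (k + 1)] (s k h)
  a_past : ∀ k < p.K, ∀ h, Measurable[𝓕 (k + 1)] (a k h)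
  g_past : ∀ k < p.K, Measurable[𝓕 (k + 1)] (g k)
  /-- The adversary picks `f_h^k = φᵀ θ_{f,h}^k` with values in `[0,1]` when the episode starts. -/
  θf_start : ∀ k < p.K, ∀ h, Measurable[𝓕 k] (θf k h)
  θf_norm : ∀ k < p.K, ∀ h ω, l2norm (θf k h ω) ≤ √d
  loss_mem : ∀ k < p.K, ∀ h ω x u, M.φ x u ⬝ᵥ θf k h ω ∈ Set.Icc (0 : ℝ) 1
  /-- The cost function of the episode is a fresh draw from `G`. -/
  g_law : ∀ k < p.K, μ.map (g k) = M.G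
  g_indep : ∀ k < p.K, Indep (MeasurableSpace.comap (g k) inferInstance) (𝓕 k) μ
  /-- Every episode starts in `s₁`. -/
  s_init : ∀ k < p.K, ∀ ω, s k 0 ω = M.s₁
  /-- Actions are drawn from the current policy of the algorithm. -/
  a_law : ∀ k < p.K, ∀ (h : Fin H) (u : A),
    μ[({ω | a k h ω = u}).indicator (fun _ => (1 : ℝ)) | beforeAction (𝓕 k) s a g k h]
      =ᵐ[μ] fun ω =>
        (learner M.toKnownPart p (observe s a g θf ω) k).policy h (s k h.castSucc ω) u
  /-- The next state is drawn from the transition kernel. -/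
  s_law : ∀ k < p.K, ∀ (h : Fin H) (x : S),
    μ[({ω | s k h.succ ω = x}).indicator (fun _ => (1 : ℝ)) |
        beforeAction (𝓕 k) s a g k h ⊔ MeasurableSpace.comap (a k h) inferInstance]
      =ᵐ[μ] fun ω => M.P h (s k h.castSucc ω) (a k h ω) x

end Interaction

end LinCMDP

end

noncomputable section

namespace LinCMDP

/-! ### Weighted norms -/

section WeightedNorm

variable {d : ℕ}

/-! Three families of bad events are excluded, each of probability at most δ/3, together with the
null set on which some cost leaves [0,1]; off them the three events hold deterministically.

Concentration of regressions. For noise bounded by b and centred given the past and the current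
feature, det(Λ_k)^(-1/2) exp(‖S_k‖² / (2b²)), with S_k the noise sum and the norm taken in Λ_k⁻¹,
has expectation at most 1. The rank-one formulas for determinant and inverse reduce one step to a
scalar inequality whose upper bound is affine in the new noise term (`selfNormExp_succ_le`), so the
mean-zero condition removes it. Markov's inequality gives `measureReal_selfNormalized_le`. A ridge
estimate errs by a bias of at most the norm of the parameter plus this noise (`wnorm_sub_ridge_le`).
For the costs this is `event1`; the loss parameters are observed exactly.

Transitions. The value estimates depend on the same data as the transition estimates, so the noise
must be controlled uniformly over a finite net of value functions. The class is small for two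
reasons. Inside an epoch the contracted features are frozen, so every Q-estimate is linear in d+1
fixed functions; and exponential updates without mixing in between merge into one. Hence a policy is
a stack of at most m = K^(1/4) layers (`exists_layerPolicy_eq`), and a value estimate is described
by d² + (m+1)(d+1) real numbers. A perturbation of the parameters at most doubles per layer in the
log-ratio of policies (`ratioLE_layerPolicy`), so a mesh of order 4^(-m), up to powers of K,
suffices. The logarithm of the size of the net is of order m² d² log K, and its square root is the
source of the factor K^(1/4) d in β_p.

Breaking the circle. The net consists of functions bounded by H, and boundedness of the estimates in
turn needs accurate transition estimates. `estimates_bounded` resolves this by induction over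
episodes and, inside an episode, backwards over steps: a bounded value estimate is near the net,
hence its transition estimate is accurate, hence the preceding Q-estimate exceeds it by at most 1
(`abs_qStep_le`). The last implication is where the sigmoid contraction enters: it caps bonus plus
error at 1.

Bonuses. The sum W_k lies in a bounded interval and its conditional mean is the value of the bonus
under the current policy (`integral_mul_Wsum`), so `event3` is a multiplicative Freedman inequality,
obtained from exp(-x) ≤ 1 - x/2 on [0,1]. -/

theorem l2norm_sq (x : Fin d → ℝ) : l2norm x ^ 2 = x ⬝ᵥ x := by
  rw [l2norm, EuclideanSpace.norm_sq_eq]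
  simp [dotProduct, pow_two]

theorem l2norm_nonneg (x : Fin d → ℝ) : 0 ≤ l2norm x := norm_nonneg _

theorem l2norm_eq_sqrt (x : Fin d → ℝ) : l2norm x = √(x ⬝ᵥ x) := by
  rw [← l2norm_sq, Real.sqrt_sq (l2norm_nonneg x)]

theorem wnorm_nonneg (Λ : Matrix (Fin d) (Fin d) ℝ) (x : Fin d → ℝ) : 0 ≤ wnorm Λ x :=
  Real.sqrt_nonneg _

theorem wnorm_one (x : Fin d → ℝ) : wnorm 1 x = l2norm x := by
  rw [wnorm, one_mulVec, l2norm_eq_sqrt]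

theorem abs_le_l2norm (x : Fin d → ℝ) (i : Fin d) : |x i| ≤ l2norm x := by
  simpa [l2norm] using PiLp.norm_apply_le (WithLp.toLp 2 x) i

theorem wnorm_smul (Λ : Matrix (Fin d) (Fin d) ℝ) (c : ℝ) (x : Fin d → ℝ) :
    wnorm Λ (c • x) = |c| * wnorm Λ x := by
  simp only [wnorm, mulVec_smul, dotProduct_smul, smul_dotProduct, smul_eq_mul]
  rw [← mul_assoc, Real.sqrt_mul (mul_self_nonneg c), Real.sqrt_mul_self_eq_abs]

variable {N : Matrix (Fin d) (Fin d) ℝ}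

theorem quad_nonneg (hN : N.PosSemidef) (x : Fin d → ℝ) : 0 ≤ x ⬝ᵥ N *ᵥ x := by
  simpa using hN.dotProduct_mulVec_nonneg x

theorem wnorm_sq (hN : N.PosSemidef) (x : Fin d → ℝ) : wnorm N x ^ 2 = x ⬝ᵥ N *ᵥ x :=
  Real.sq_sqrt (quad_nonneg hN x)

open scoped MatrixOrder in
-- Factoring the matrix as BᵀB turns the weighted norm into a Euclidean one, from which the triangle
-- and Cauchy–Schwarz inequalities are inherited.
theorem exists_wnorm_eq_l2norm (hN : N.PosSemidef) :
    ∃ B : Matrix (Fin d) (Fin d) ℝ, N = Bᵀ * B ∧ ∀ x, wnorm N x = l2norm (B *ᵥ x) := by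
  obtain ⟨B, hB⟩ := CStarAlgebra.nonneg_iff_eq_star_mul_self.mp hN.nonneg
  have hB' : N = Bᵀ * B := by rw [hB, star_eq_conjTranspose, conjTranspose_eq_transpose_of_trivial]
  refine ⟨B, hB', fun x => ?_⟩
  rw [wnorm, l2norm_eq_sqrt, hB', ← mulVec_mulVec, dotProduct_mulVec, vecMul_transpose]

theorem wnorm_add_le (hN : N.PosSemidef) (x y : Fin d → ℝ) :
    wnorm N (x + y) ≤ wnorm N x + wnorm N y := by
  obtain ⟨B, -, h⟩ := exists_wnorm_eq_l2norm hN
  rw [h, h, h, mulVec_add]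
  exact norm_add_le (WithLp.toLp 2 (B *ᵥ x)) (WithLp.toLp 2 (B *ᵥ y))

theorem wnorm_neg (x : Fin d → ℝ) : wnorm N (-x) = wnorm N x := by
  simp [wnorm, mulVec_neg]

theorem wnorm_sub_le (hN : N.PosSemidef) (x y : Fin d → ℝ) :
    wnorm N (x - y) ≤ wnorm N x + wnorm N y := by
  rw [sub_eq_add_neg]
  exact (wnorm_add_le hN _ _).trans_eq (by rw [wnorm_neg])

theorem wnorm_zero : wnorm N (0 : Fin d → ℝ) = 0 := by simp [wnorm]

theorem wnorm_sum_le (hN : N.PosSemidef) {ι : Type*} (s : Finset ι) (f : ι → Fin d → ℝ) :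
    wnorm N (∑ i ∈ s, f i) ≤ ∑ i ∈ s, wnorm N (f i) :=
  Finset.le_sum_of_subadditive _ wnorm_zero.le (wnorm_add_le hN) s f

theorem abs_dotProduct_mulVec_le (hN : N.PosSemidef) (x y : Fin d → ℝ) :
    |x ⬝ᵥ N *ᵥ y| ≤ wnorm N x * wnorm N y := by
  obtain ⟨B, hB, h⟩ := exists_wnorm_eq_l2norm hN
  rw [h, h, hB, ← mulVec_mulVec, dotProduct_mulVec, vecMul_transpose]
  have := abs_real_inner_le_norm (WithLp.toLp 2 (B *ᵥ x)) (WithLp.toLp 2 (B *ᵥ y))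
  simpa [EuclideanSpace.inner_eq_star_dotProduct, l2norm, dotProduct_comm] using this

/-- Cauchy–Schwarz in the inverse norm, applied to x and Λy. It converts a parameter error measured
in Λ into a prediction error proportional to the bonus. -/
theorem abs_dotProduct_le_wnorm_mul {Λ : Matrix (Fin d) (Fin d) ℝ} (hΛ : Λ.PosDef)
    (x y : Fin d → ℝ) : |x ⬝ᵥ y| ≤ wnorm Λ⁻¹ x * wnorm Λ y := by
  have hu : IsUnit Λ.det := (isUnit_iff_isUnit_det _).1 hΛ.isUnit
  have h := abs_dotProduct_mulVec_le hΛ.inv.posSemidef x (Λ *ᵥ y)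
  have h2 : wnorm Λ⁻¹ (Λ *ᵥ y) = wnorm Λ y := by
    rw [wnorm, wnorm, mulVec_mulVec, nonsing_inv_mul _ hu, one_mulVec, dotProduct_comm]
  rwa [h2, mulVec_mulVec, nonsing_inv_mul _ hu, one_mulVec] at h

theorem wnorm_inv_mulVec {Λ : Matrix (Fin d) (Fin d) ℝ} (hΛ : Λ.PosDef) (x : Fin d → ℝ) :
    wnorm Λ (Λ⁻¹ *ᵥ x) = wnorm Λ⁻¹ x := by
  have hu : IsUnit Λ.det := (isUnit_iff_isUnit_det _).1 hΛ.isUnit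
  rw [wnorm, wnorm, mulVec_mulVec, mul_nonsing_inv _ hu, one_mulVec, dotProduct_comm]

end WeightedNorm

/-! ### Regularised Gram matrices -/

section Gram

variable {d : ℕ}

theorem isSymm_of_posDef {Λ : Matrix (Fin d) (Fin d) ℝ} (hΛ : Λ.PosDef) : Λᵀ = Λ := by
  simpa [conjTranspose_eq_transpose_of_trivial] using hΛ.isHermitian.eq

theorem dotProduct_mulVec_symm {N : Matrix (Fin d) (Fin d) ℝ} (hN : Nᵀ = N) (x y : Fin d → ℝ) :
    x ⬝ᵥ N *ᵥ y = y ⬝ᵥ N *ᵥ x := by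
  rw [dotProduct_mulVec, ← mulVec_transpose, hN, dotProduct_comm]

theorem posDef_add_vecMulVec {Λ : Matrix (Fin d) (Fin d) ℝ} (hΛ : Λ.PosDef) (v : Fin d → ℝ) :
    (Λ + vecMulVec v v).PosDef := by
  simpa using hΛ.add_posSemidef (posSemidef_vecMulVec_self_star v)

/-- Rank-one update of the determinant. -/
theorem det_add_vecMulVec_self {Λ : Matrix (Fin d) (Fin d) ℝ} (hΛ : Λ.PosDef) (v : Fin d → ℝ) :
    (Λ + vecMulVec v v).det = Λ.det * (1 + v ⬝ᵥ Λ⁻¹ *ᵥ v) := by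
  have hu : IsUnit Λ.det := (isUnit_iff_isUnit_det _).1 hΛ.isUnit
  rw [vecMulVec_eq Unit, det_add_replicateCol_mul_replicateRow hu, Matrix.mul_assoc,
    ← replicateCol_mulVec]
  congr 1
  rw [det_unique]
  simp [dotProduct, Matrix.mul_apply]

/-- Sherman–Morrison formula for the quadratic form of the inverse. -/
theorem quad_inv_add_vecMulVec {Λ : Matrix (Fin d) (Fin d) ℝ} (hΛ : Λ.PosDef)
    (v y : Fin d → ℝ) :
    y ⬝ᵥ (Λ + vecMulVec v v)⁻¹ *ᵥ y
      = y ⬝ᵥ Λ⁻¹ *ᵥ y - (v ⬝ᵥ Λ⁻¹ *ᵥ y) ^ 2 / (1 + v ⬝ᵥ Λ⁻¹ *ᵥ v) := by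
  have hu : IsUnit Λ.det := (isUnit_iff_isUnit_det _).1 hΛ.isUnit
  have hpos : 0 ≤ v ⬝ᵥ Λ⁻¹ *ᵥ v := quad_nonneg hΛ.inv.posSemidef v
  set Λ' := Λ + vecMulVec v v with hΛ'
  have hu' : IsUnit Λ'.det := (isUnit_iff_isUnit_det _).1 (posDef_add_vecMulVec hΛ v).isUnit
  set u := v ⬝ᵥ Λ⁻¹ *ᵥ v
  set t := v ⬝ᵥ Λ⁻¹ *ᵥ y
  -- The inverse is avoided: the corrected vector is checked to solve the updated linear system.
  have key : Λ' *ᵥ (Λ⁻¹ *ᵥ y - (t / (1 + u)) • (Λ⁻¹ *ᵥ v)) = y := by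
    rw [hΛ', add_mulVec, vecMulVec_mulVec, mulVec_sub, mulVec_smul, mulVec_mulVec, mulVec_mulVec,
      mul_nonsing_inv _ hu, one_mulVec, one_mulVec, dotProduct_sub, dotProduct_smul]
    change y - (t / (1 + u)) • v + MulOpposite.op (t - (t / (1 + u)) * u) • v = y
    ext i
    simp only [Pi.add_apply, Pi.sub_apply, Pi.smul_apply, smul_eq_mul, MulOpposite.smul_eq_mul_unop,
      MulOpposite.unop_op]
    field_simp
    ring
  have hinv : Λ'⁻¹ *ᵥ y = Λ⁻¹ *ᵥ y - (t / (1 + u)) • (Λ⁻¹ *ᵥ v) := by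
    conv_lhs => rw [← key]
    rw [mulVec_mulVec, nonsing_inv_mul _ hu', one_mulVec]
  rw [hinv, dotProduct_sub, dotProduct_smul,
    dotProduct_mulVec_symm (isSymm_of_posDef hΛ.inv) y v, smul_eq_mul]
  change _ - t / (1 + u) * t = _
  ring

/-- `I + ∑_{τ<k} x_τ x_τᵀ`. -/
def gram (x : ℕ → Fin d → ℝ) (k : ℕ) : Matrix (Fin d) (Fin d) ℝ :=
  1 + ∑ τ ∈ Finset.range k, vecMulVec (x τ) (x τ)

variable (x : ℕ → Fin d → ℝ)

theorem gram_zero : gram x 0 = 1 := by simp [gram]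

theorem gram_succ (k : ℕ) : gram x (k + 1) = gram x k + vecMulVec (x k) (x k) := by
  rw [gram, gram, Finset.sum_range_succ, add_assoc]

theorem gram_posDef (k : ℕ) : (gram x k).PosDef := by
  induction k with
  | zero => rw [gram_zero]; exact PosDef.one
  | succ k ih => rw [gram_succ]; exact posDef_add_vecMulVec ih _

theorem gram_inv_posSemidef (k : ℕ) : (gram x k)⁻¹.PosSemidef := (gram_posDef x k).inv.posSemidef

theorem gram_isUnit_det (k : ℕ) : IsUnit (gram x k).det :=
  (isUnit_iff_isUnit_det _).1 (gram_posDef x k).isUnit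

/-- By Sherman–Morrison each new feature subtracts a nonnegative square. This lets a bonus computed
at the start of an epoch dominate the one of a later episode. -/
theorem wnorm_gram_inv_antitone (y : Fin d → ℝ) : Antitone fun k => wnorm (gram x k)⁻¹ y := by
  refine antitone_nat_of_succ_le fun k => Real.sqrt_le_sqrt ?_
  rw [gram_succ, quad_inv_add_vecMulVec (gram_posDef x k)]
  have := quad_nonneg (gram_inv_posSemidef x k) (x k)
  have : 0 ≤ (x k ⬝ᵥ (gram x k)⁻¹ *ᵥ y) ^ 2 / (1 + x k ⬝ᵥ (gram x k)⁻¹ *ᵥ x k) := by positivity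
  linarith

theorem wnorm_gram_inv_le (k : ℕ) (y : Fin d → ℝ) : wnorm (gram x k)⁻¹ y ≤ l2norm y := by
  have := wnorm_gram_inv_antitone x y (Nat.zero_le k)
  simpa [gram_zero, wnorm_one] using this

theorem abs_gram_inv_mulVec_le (k : ℕ) (y : Fin d → ℝ) (i : Fin d) :
    |((gram x k)⁻¹ *ᵥ y) i| ≤ l2norm y := by
  have h := abs_dotProduct_mulVec_le (gram_inv_posSemidef x k) (Pi.single i 1) y
  have h1 : wnorm (gram x k)⁻¹ (Pi.single i 1) ≤ 1 :=
    (wnorm_gram_inv_le x k _).trans_eq (by simp [l2norm])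
  rw [single_one_dotProduct] at h
  calc _ ≤ _ := h
    _ ≤ 1 * l2norm y := mul_le_mul h1 (wnorm_gram_inv_le x k y) (wnorm_nonneg _ _) zero_le_one
    _ = _ := one_mul _

theorem abs_gram_inv_apply_le (k : ℕ) (i j : Fin d) : |(gram x k)⁻¹ i j| ≤ 1 := by
  have h := abs_gram_inv_mulVec_le x k (Pi.single j 1) i
  rw [mulVec_single_one] at h
  exact h.trans_eq (by simp [l2norm])

variable {x}

theorem quad_gram_le (hx : ∀ τ, l2norm (x τ) ≤ 1) (k : ℕ) (y : Fin d → ℝ) :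
    y ⬝ᵥ gram x k *ᵥ y ≤ (1 + k) * (y ⬝ᵥ y) := by
  induction k with
  | zero => simp [gram_zero]
  | succ k ih =>
    rw [gram_succ, add_mulVec, dotProduct_add, vecMulVec_mulVec, dotProduct_smul]
    have h1 : |x k ⬝ᵥ y| ≤ l2norm (x k) * l2norm y := by
      simpa [wnorm_one] using abs_dotProduct_mulVec_le PosSemidef.one (x k) y
    have h2 : |x k ⬝ᵥ y| ≤ l2norm y :=
      h1.trans (mul_le_of_le_one_left (l2norm_nonneg y) (hx k))
    have h3 : (x k ⬝ᵥ y) ^ 2 ≤ y ⬝ᵥ y := by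
      rw [← l2norm_sq, ← sq_abs]
      exact pow_le_pow_left₀ (abs_nonneg _) h2 2
    rw [dotProduct_comm y (x k), MulOpposite.smul_eq_mul_unop, MulOpposite.unop_op]
    push_cast
    nlinarith

theorem one_le_det_gram (k : ℕ) : 1 ≤ (gram x k).det := by
  induction k with
  | zero => simp [gram_zero]
  | succ k ih =>
    rw [gram_succ, det_add_vecMulVec_self (gram_posDef x k)]
    have := quad_nonneg (gram_inv_posSemidef x k) (x k)
    nlinarith

/-- The determinant is the product of the d eigenvalues, each a value of the quadratic form at a
unit vector and so at most 1 + k. -/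
theorem det_gram_le (hx : ∀ τ, l2norm (x τ) ≤ 1) (k : ℕ) :
    (gram x k).det ≤ (1 + k) ^ d := by
  have hH := (gram_posDef x k).isHermitian
  have hd : (gram x k).det = ∏ i, hH.eigenvalues i := hH.det_eq_prod_eigenvalues
  rw [hd]
  calc ∏ i, hH.eigenvalues i ≤ ∏ _i : Fin d, (1 + (k : ℝ)) := by
        refine Finset.prod_le_prod
          (fun i _ => ((gram_posDef x k).eigenvalues_pos i).le) fun i _ => ?_
        rw [hH.eigenvalues_eq i]
        simp only [star_trivial, RCLike.re_to_real]
        refine (quad_gram_le hx k _).trans_eq ?_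
        rw [← l2norm_sq]
        have : l2norm ⇑(hH.eigenvectorBasis i) = 1 := hH.eigenvectorBasis.orthonormal.1 i
        rw [this]
        ring
    _ = _ := by simp

end Gram

/-! ### Measurability of matrix operations -/

section MatrixMeasurability

variable {Ω : Type*} {m : MeasurableSpace Ω} {d : ℕ}

theorem measurable_dotProduct {f g : Ω → Fin d → ℝ} (hf : Measurable f) (hg : Measurable g) :
    Measurable fun ω => f ω ⬝ᵥ g ω := by
  unfold dotProduct
  fun_prop

theorem measurable_det {A : Ω → Matrix (Fin d) (Fin d) ℝ}
    (hA : ∀ i j, Measurable fun ω => A ω i j) : Measurable fun ω => (A ω).det := by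
  simp only [det_apply]
  fun_prop

theorem measurable_inv_apply {A : Ω → Matrix (Fin d) (Fin d) ℝ}
    (hA : ∀ i j, Measurable fun ω => A ω i j) (i j : Fin d) :
    Measurable fun ω => (A ω)⁻¹ i j := by
  simp only [inv_def, Matrix.smul_apply, adjugate_apply, Ring.inverse_eq_inv', smul_eq_mul]
  refine (measurable_det hA).inv.mul (measurable_det fun i' j' => ?_)
  by_cases h : i' = j
  · subst h; simp
  · simpa [updateRow_apply, h] using hA i' j'

theorem measurable_mulVec {A : Ω → Matrix (Fin d) (Fin d) ℝ} {f : Ω → Fin d → ℝ}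
    (hA : ∀ i j, Measurable fun ω => A ω i j) (hf : Measurable f) :
    Measurable fun ω => A ω *ᵥ f ω := by
  refine measurable_pi_lambda _ fun i => ?_
  exact measurable_dotProduct (measurable_pi_lambda _ fun j => hA i j) hf

theorem measurable_wnorm {A : Ω → Matrix (Fin d) (Fin d) ℝ} {f : Ω → Fin d → ℝ}
    (hA : ∀ i j, Measurable fun ω => A ω i j) (hf : Measurable f) :
    Measurable fun ω => wnorm (A ω) (f ω) :=
  (measurable_dotProduct hf (measurable_mulVec hA hf)).sqrt

theorem measurable_gram_apply {x : ℕ → Ω → Fin d → ℝ} {k : ℕ}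
    (hx : ∀ τ < k, Measurable (x τ)) (i j : Fin d) :
    Measurable fun ω => gram (fun τ => x τ ω) k i j := by
  simp only [gram, Matrix.add_apply, Matrix.sum_apply, vecMulVec_apply]
  refine measurable_const.add (Finset.measurable_sum _ fun τ hτ => ?_)
  have := hx τ (Finset.mem_range.1 hτ)
  exact ((measurable_pi_apply i).comp this).mul ((measurable_pi_apply j).comp this)

/-- Evaluation of a random function at a random point of a discrete space. -/
theorem measurable_eval_discrete {ι : Type*} [Countable ι] [MeasurableSpace ι]
    [DiscreteMeasurableSpace ι] {β : Type*} [MeasurableSpace β] {F : ι → Ω → β}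
    (hF : ∀ i, Measurable (F i)) {y : Ω → ι} (hy : Measurable y) :
    Measurable fun ω => F (y ω) ω :=
  (measurable_from_prod_countable_right (f := fun q : ι × Ω => F q.1 q.2) hF).comp
    (hy.prodMk measurable_id)

end MatrixMeasurability

/-! ### A self-normalised exponential inequality -/

section SelfNormalized

/-- The graph of exp on [-z, z] lies below its chord. The bound is affine in the noise, so a
mean-zero hypothesis can be applied to it directly. -/
theorem exp_mul_le_cosh_add {b ε : ℝ} (hb : 0 < b) (hε : |ε| ≤ b) (z : ℝ) :
    Real.exp (z * (ε / b)) ≤ Real.cosh z + ε / b * Real.sinh z := by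
  obtain ⟨h1, h2⟩ := abs_le.1 hε
  have h3 : -1 ≤ ε / b := by rw [le_div_iff₀ hb]; linarith
  have h4 : ε / b ≤ 1 := by rw [div_le_iff₀ hb]; linarith
  have := convexOn_exp.2 (Set.mem_univ z) (Set.mem_univ (-z))
    (show 0 ≤ (1 + ε / b) / 2 by linarith) (show 0 ≤ (1 - ε / b) / 2 by linarith) (by ring)
  simp only [smul_eq_mul] at this
  rw [Real.cosh_eq, Real.sinh_eq]
  calc Real.exp (z * (ε / b))
      = Real.exp ((1 + ε / b) / 2 * z + (1 - ε / b) / 2 * -z) := by congr 1; ring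
    _ ≤ _ := this
    _ = _ := by ring

/-- Coefficient of the noise in the linearised one-step inequality. -/
def tilt (b t u : ℝ) : ℝ :=
  Real.exp (-((t / (b * (1 + u))) ^ 2 * (1 + u) / 2)) * Real.sinh (t / (b * (1 + u))) / b

theorem measurable_tilt {Ω : Type*} {m : MeasurableSpace Ω} {b : ℝ} {f g : Ω → ℝ}
    (hf : Measurable f) (hg : Measurable g) : Measurable fun ω => tilt b (f ω) (g ω) := by
  unfold tilt
  fun_prop

/-- Since cosh z ≤ exp(z²/2), a factor exp(-z²u/2) is left over. -/
theorem exp_half_mul_cosh_le {u : ℝ} (hu : 0 ≤ u) (z : ℝ) :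
    Real.exp (-(z ^ 2 * (1 + u) / 2)) * Real.cosh z ≤ 1 := by
  calc _ ≤ Real.exp (-(z ^ 2 * (1 + u) / 2)) * Real.exp (z ^ 2 / 2) := by
        gcongr; exact Real.cosh_le_exp_half_sq z
    _ = Real.exp (-(z ^ 2 * u / 2)) := by rw [← Real.exp_add]; congr 1; ring
    _ ≤ 1 := Real.exp_le_one_iff.2 (by have : 0 ≤ z ^ 2 * u := by positivity
                                       linarith)

theorem abs_tilt_le {b u : ℝ} (hb : 0 < b) (hu : 0 ≤ u) (t : ℝ) : |tilt b t u| ≤ 1 / b := by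
  rw [tilt, abs_div, abs_mul, abs_of_pos (Real.exp_pos _), abs_of_pos hb]
  gcongr
  refine le_trans ?_ (exp_half_mul_cosh_le hu (t / (b * (1 + u))))
  gcongr
  rw [abs_le]
  constructor
  · linarith [Real.cosh_add_sinh (t / (b * (1 + u))), Real.exp_pos (t / (b * (1 + u)))]
  · exact (Real.sinh_lt_cosh _).le

/-- The numerator over 1 + u is the increment of the squared self-normalised norm when one feature
is added, with u its squared norm and t its pairing with the old noise sum. The part quadratic in ε
is paid by the factor √(1+u), which the determinant will cancel; the linear part goes through the
chord bound at z = t / (b(1+u)), and the term -t² absorbs the resulting cosh. -/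
theorem exp_quad_step_le {b ε u : ℝ} (hb : 0 < b) (hε : |ε| ≤ b) (hu : 0 ≤ u) (t : ℝ) :
    Real.exp ((2 * ε * t + ε ^ 2 * u - t ^ 2) / (1 + u) / (2 * b ^ 2))
      ≤ √(1 + u) * (1 + ε * tilt b t u) := by
  have hu1 : 0 < 1 + u := by linarith
  set z := t / (b * (1 + u)) with hz
  have hsq : ε ^ 2 ≤ b ^ 2 := sq_le_sq' (abs_le.1 hε).1 (abs_le.1 hε).2
  have h1 : Real.exp (ε ^ 2 * u / (1 + u) / (2 * b ^ 2)) ≤ √(1 + u) := by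
    have hlog : u / (1 + u) ≤ Real.log (1 + u) := by
      have := Real.one_sub_inv_le_log_of_pos hu1
      have h : 1 - (1 + u)⁻¹ = u / (1 + u) := by field_simp; ring
      linarith
    rw [← Real.exp_log (Real.sqrt_pos.2 hu1), Real.log_sqrt hu1.le]
    apply Real.exp_le_exp.2
    calc ε ^ 2 * u / (1 + u) / (2 * b ^ 2) ≤ b ^ 2 * u / (1 + u) / (2 * b ^ 2) := by gcongr
      _ = u / (1 + u) / 2 := by field_simp
      _ ≤ _ := by linarith
  have h2 : (2 * ε * t + ε ^ 2 * u - t ^ 2) / (1 + u) / (2 * b ^ 2)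
      = ε ^ 2 * u / (1 + u) / (2 * b ^ 2) + (z * (ε / b) + -(z ^ 2 * (1 + u) / 2)) := by
    rw [hz]; field_simp; ring
  rw [h2, Real.exp_add]
  refine mul_le_mul h1 ?_ (Real.exp_pos _).le (Real.sqrt_nonneg _)
  rw [Real.exp_add]
  calc _ ≤ (Real.cosh z + ε / b * Real.sinh z) * Real.exp (-(z ^ 2 * (1 + u) / 2)) := by
        gcongr; exact exp_mul_le_cosh_add hb hε z
    _ = Real.exp (-(z ^ 2 * (1 + u) / 2)) * Real.cosh z + ε * tilt b t u := by
        rw [tilt, ← hz]; ring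
    _ ≤ _ := by gcongr; exact exp_half_mul_cosh_le hu z

variable {Ω ι : Type*} {d : ℕ}

/-- `∑_{τ<k} ε_τ φ(y_τ)`. -/
def noiseSum (φ : ι → Fin d → ℝ) (y : ℕ → Ω → ι) (ε : ℕ → Ω → ℝ) (k : ℕ) (ω : Ω) : Fin d → ℝ :=
  ∑ τ ∈ Finset.range k, ε τ ω • φ (y τ ω)

/-- `I + ∑_{τ<k} φ(y_τ) φ(y_τ)ᵀ`. -/
def noiseGram (φ : ι → Fin d → ℝ) (y : ℕ → Ω → ι) (k : ℕ) (ω : Ω) : Matrix (Fin d) (Fin d) ℝ :=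
  gram (fun τ => φ (y τ ω)) k

theorem noiseGram_inv_posSemidef (φ : ι → Fin d → ℝ) (y : ℕ → Ω → ι) (k : ℕ) (ω : Ω) :
    (noiseGram φ y k ω)⁻¹.PosSemidef := gram_inv_posSemidef _ k

/-- `det(Λ_k)^{-1/2} exp(‖S_k‖²_{Λ_k⁻¹} / (2b²))`. -/
def selfNormExp (φ : ι → Fin d → ℝ) (y : ℕ → Ω → ι) (ε : ℕ → Ω → ℝ) (b : ℝ) (k : ℕ) (ω : Ω) : ℝ :=
  (√(noiseGram φ y k ω).det)⁻¹ *
    Real.exp ((noiseSum φ y ε k ω ⬝ᵥ (noiseGram φ y k ω)⁻¹ *ᵥ noiseSum φ y ε k ω) / (2 * b ^ 2))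

variable {φ : ι → Fin d → ℝ} {y : ℕ → Ω → ι} {ε : ℕ → Ω → ℝ} {b : ℝ}

theorem selfNormExp_nonneg (k : ℕ) (ω : Ω) : 0 ≤ selfNormExp φ y ε b k ω := by
  unfold selfNormExp; positivity

/-- The determinant grows by exactly 1 + u, so its inverse square root cancels the factor √(1+u) of
`exp_quad_step_le`. What remains is the old value times an expression affine in the new noise. -/
theorem selfNormExp_succ_le (hb : 0 < b) (k : ℕ) (ω : Ω) (hε : |ε k ω| ≤ b) :
    selfNormExp φ y ε b (k + 1) ω ≤ selfNormExp φ y ε b k ω *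
      (1 + ε k ω * tilt b (φ (y k ω) ⬝ᵥ (noiseGram φ y k ω)⁻¹ *ᵥ noiseSum φ y ε k ω)
        (φ (y k ω) ⬝ᵥ (noiseGram φ y k ω)⁻¹ *ᵥ φ (y k ω))) := by
  set Λ := noiseGram φ y k ω with hΛ
  have hpd : Λ.PosDef := gram_posDef _ _
  have hS : noiseSum φ y ε (k + 1) ω = noiseSum φ y ε k ω + ε k ω • φ (y k ω) :=
    Finset.sum_range_succ _ _
  have hG : noiseGram φ y (k + 1) ω = Λ + vecMulVec (φ (y k ω)) (φ (y k ω)) := gram_succ _ _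
  set S := noiseSum φ y ε k ω
  set v := φ (y k ω)
  set t := v ⬝ᵥ Λ⁻¹ *ᵥ S with ht
  set u := v ⬝ᵥ Λ⁻¹ *ᵥ v with hu
  have hu0 : 0 ≤ u := quad_nonneg hpd.inv.posSemidef v
  have hdet : 0 < Λ.det := hpd.det_pos
  have hsymm : S ⬝ᵥ Λ⁻¹ *ᵥ v = t := dotProduct_mulVec_symm (isSymm_of_posDef hpd.inv) _ _
  have hquad : (S + ε k ω • v) ⬝ᵥ (Λ + vecMulVec v v)⁻¹ *ᵥ (S + ε k ω • v)
      = S ⬝ᵥ Λ⁻¹ *ᵥ S + (2 * ε k ω * t + ε k ω ^ 2 * u - t ^ 2) / (1 + u) := by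
    rw [quad_inv_add_vecMulVec hpd]
    simp only [mulVec_add, mulVec_smul, dotProduct_add, add_dotProduct, dotProduct_smul,
      smul_dotProduct, smul_eq_mul, hsymm, ← ht, ← hu]
    have : 1 + u ≠ 0 := by linarith
    field_simp
    ring
  rw [selfNormExp, selfNormExp, hS, hG, det_add_vecMulVec_self hpd, hquad, add_div, Real.exp_add,
    Real.sqrt_mul hdet.le, mul_inv]
  have hs : 0 < √(1 + u) := Real.sqrt_pos.2 (by linarith)
  calc _ = (√Λ.det)⁻¹ * Real.exp (S ⬝ᵥ Λ⁻¹ *ᵥ S / (2 * b ^ 2)) * ((√(1 + u))⁻¹ *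
        Real.exp ((2 * ε k ω * t + ε k ω ^ 2 * u - t ^ 2) / (1 + u) / (2 * b ^ 2))) := by ring
    _ ≤ (√Λ.det)⁻¹ * Real.exp (S ⬝ᵥ Λ⁻¹ *ᵥ S / (2 * b ^ 2)) * (1 + ε k ω * tilt b t u) := by
        gcongr
        rw [inv_mul_le_iff₀ hs]
        exact exp_quad_step_le hb hε hu0 t

/-- A crude pathwise bound, needed only for integrability and for admissible test functions in
`IsNoise`. -/
theorem selfNormExp_le (hb : 0 < b) (hφ : ∀ i, l2norm (φ i) ≤ 1) (k : ℕ) (ω : Ω)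
    (hε : ∀ τ < k, |ε τ ω| ≤ b) :
    selfNormExp φ y ε b k ω ≤ Real.exp ((k * b) ^ 2 / (2 * b ^ 2)) := by
  have hdet : 1 ≤ (noiseGram φ y k ω).det := one_le_det_gram k
  have hw : wnorm (noiseGram φ y k ω)⁻¹ (noiseSum φ y ε k ω) ≤ k * b := by
    refine (wnorm_sum_le (gram_inv_posSemidef _ k) _ _).trans ?_
    refine (Finset.sum_le_card_nsmul _ _ b fun τ hτ => ?_).trans_eq (by simp)
    rw [wnorm_smul]
    calc |ε τ ω| * _ ≤ b * 1 := mul_le_mul (hε τ (Finset.mem_range.1 hτ))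
          ((wnorm_gram_inv_le _ k _).trans (hφ _)) (wnorm_nonneg _ _) hb.le
      _ = b := mul_one b
  rw [selfNormExp, ← wnorm_sq (noiseGram_inv_posSemidef φ y k ω)]
  have h1 : (√(noiseGram φ y k ω).det)⁻¹ ≤ 1 := inv_le_one_of_one_le₀ (Real.one_le_sqrt.2 hdet)
  rw [← one_mul (Real.exp ((k * b) ^ 2 / (2 * b ^ 2)))]
  gcongr
  exact wnorm_nonneg _ _

variable [mΩ : MeasurableSpace Ω] {𝓕 : Filtration ℕ mΩ} {n : ℕ}
  [MeasurableSpace ι] [DiscreteMeasurableSpace ι]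

theorem measurable_selfNormExp_parts
    (hy : ∀ τ < n, Measurable[𝓕 (τ + 1)] (y τ)) (hε : ∀ τ < n, Measurable[𝓕 (τ + 1)] (ε τ))
    {k : ℕ} (hk : k ≤ n) :
    Measurable[𝓕 k] (noiseSum φ y ε k) ∧
      (∀ i j, Measurable[𝓕 k] fun ω => noiseGram φ y k ω i j) := by
  have h1 : ∀ τ < k, Measurable[𝓕 k] (y τ) := fun τ hτ =>
    (hy τ (hτ.trans_le hk)).mono (𝓕.mono hτ) le_rfl
  have h2 : ∀ τ < k, Measurable[𝓕 k] (ε τ) := fun τ hτ =>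
    (hε τ (hτ.trans_le hk)).mono (𝓕.mono hτ) le_rfl
  have h3 : ∀ τ < k, Measurable[𝓕 k] fun ω => φ (y τ ω) := fun τ hτ =>
    (Measurable.of_discrete (f := φ)).comp (h1 τ hτ)
  refine ⟨?_, fun i j => measurable_gram_apply (x := fun τ ω => φ (y τ ω)) h3 i j⟩
  refine @measurable_pi_lambda _ _ _ (𝓕 k) _ _ fun i => ?_
  simp only [noiseSum, Finset.sum_apply, Pi.smul_apply, smul_eq_mul]
  exact Finset.measurable_sum _ fun τ hτ => (h2 τ (Finset.mem_range.1 hτ)).mul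
    ((measurable_pi_apply i).comp (h3 τ (Finset.mem_range.1 hτ)))

theorem measurable_selfNormExp
    (hy : ∀ τ < n, Measurable[𝓕 (τ + 1)] (y τ)) (hε : ∀ τ < n, Measurable[𝓕 (τ + 1)] (ε τ))
    {k : ℕ} (hk : k ≤ n) : Measurable[𝓕 k] (selfNormExp φ y ε b k) := by
  obtain ⟨h1, h2⟩ := measurable_selfNormExp_parts (φ := φ) hy hε hk
  exact (measurable_det h2).sqrt.inv.mul
    (((measurable_dotProduct h1 (measurable_mulVec (measurable_inv_apply h2) h1)).div_const _).exp)

/-- `E[ε_τ ∣ 𝓕_τ, y_τ] = 0` for `τ < n`, in integrated form. -/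
def IsNoise (μ : Measure Ω) (𝓕 : Filtration ℕ mΩ) (y : ℕ → Ω → ι) (ε : ℕ → Ω → ℝ) (n : ℕ) : Prop :=
  ∀ τ < n, ∀ F : ι → Ω → ℝ, (∀ i, Measurable[𝓕 τ] (F i)) → (∃ C, ∀ i ω, |F i ω| ≤ C) →
    ∫ ω, F (y τ ω) ω * ε τ ω ∂μ = 0

theorem integrable_of_abs_le {μ : Measure Ω} [IsFiniteMeasure μ] {f : Ω → ℝ} (hf : Measurable f)
    {C : ℝ} (h : ∀ ω, |f ω| ≤ C) : Integrable f μ :=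
  Integrable.of_bound hf.aestronglyMeasurable C (ae_of_all _ h)

variable {μ : Measure Ω}

theorem integral_selfNormExp_le_one [IsProbabilityMeasure μ] [Countable ι]
    (hb : 0 < b) (hφ : ∀ i, l2norm (φ i) ≤ 1)
    (hy : ∀ τ < n, Measurable[𝓕 (τ + 1)] (y τ)) (hε : ∀ τ < n, Measurable[𝓕 (τ + 1)] (ε τ))
    (hεb : ∀ τ < n, ∀ ω, |ε τ ω| ≤ b) (hN : IsNoise μ 𝓕 y ε n) :
    ∀ k ≤ n, ∫ ω, selfNormExp φ y ε b k ω ∂μ ≤ 1 := by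
  have hint : ∀ k ≤ n, Integrable (selfNormExp φ y ε b k) μ := fun k hk =>
    integrable_of_abs_le ((measurable_selfNormExp hy hε hk).mono (𝓕.le k) le_rfl) fun ω => by
      rw [abs_of_nonneg (selfNormExp_nonneg k ω)]
      exact selfNormExp_le hb hφ k ω fun τ hτ => hεb τ (hτ.trans_le hk) ω
  intro k
  induction k with
  | zero =>
    intro _
    simp [selfNormExp, noiseSum, noiseGram, gram_zero]
  | succ k ih =>
    intro hk
    have hk' : k ≤ n := by omega
    -- The coefficient of the new noise term, with the current point frozen at i. For fixed i it
    -- depends only on the past, which makes it a legitimate test function for the noise hypothesis.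
    obtain ⟨F, hF⟩ : ∃ F : ι → Ω → ℝ, ∀ i ω, F i ω = selfNormExp φ y ε b k ω *
      tilt b (φ i ⬝ᵥ (noiseGram φ y k ω)⁻¹ *ᵥ noiseSum φ y ε k ω)
        (φ i ⬝ᵥ (noiseGram φ y k ω)⁻¹ *ᵥ φ i) := ⟨_, fun _ _ => rfl⟩
    obtain ⟨h1, h2⟩ := measurable_selfNormExp_parts (φ := φ) hy hε hk'
    have hFm : ∀ i, Measurable[𝓕 k] (F i) := by
      intro i
      have e1 : Measurable[𝓕 k] fun ω => φ i ⬝ᵥ (noiseGram φ y k ω)⁻¹ *ᵥ noiseSum φ y ε k ω :=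
        measurable_dotProduct (@measurable_const _ _ _ (𝓕 k) _)
          (measurable_mulVec (measurable_inv_apply h2) h1)
      have e2 : Measurable[𝓕 k] fun ω => φ i ⬝ᵥ (noiseGram φ y k ω)⁻¹ *ᵥ φ i :=
        measurable_dotProduct (@measurable_const _ _ _ (𝓕 k) _)
          (measurable_mulVec (measurable_inv_apply h2) (@measurable_const _ _ _ (𝓕 k) _))
      rw [show F i = _ from funext (hF i)]
      exact (measurable_selfNormExp hy hε hk').mul (measurable_tilt e1 e2)
    have hFb : ∀ i ω, |F i ω| ≤ Real.exp ((k * b) ^ 2 / (2 * b ^ 2)) * (1 / b) := by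
      intro i ω
      rw [hF, abs_mul, abs_of_nonneg (selfNormExp_nonneg k ω)]
      exact mul_le_mul (selfNormExp_le hb hφ k ω fun τ hτ => hεb τ (hτ.trans_le hk') ω)
        (abs_tilt_le hb (quad_nonneg (noiseGram_inv_posSemidef φ y k ω) _) _) (abs_nonneg _)
        (Real.exp_pos _).le
    have hz := hN k (by omega) F hFm ⟨_, hFb⟩
    have hym : Measurable (y k) := (hy k (by omega)).mono (𝓕.le _) le_rfl
    have hεm : Measurable (ε k) := (hε k (by omega)).mono (𝓕.le _) le_rfl
    have hFi : Integrable (fun ω => F (y k ω) ω * ε k ω) μ := by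
      refine integrable_of_abs_le (C := Real.exp ((k * b) ^ 2 / (2 * b ^ 2)) * (1 / b) * b)
        ((measurable_eval_discrete (F := F) (fun i => (hFm i).mono (𝓕.le k) le_rfl) hym).mul hεm)
        fun ω => ?_
      rw [abs_mul]
      exact mul_le_mul (hFb _ _) (hεb k (by omega) ω) (abs_nonneg _) (by positivity)
    calc ∫ ω, selfNormExp φ y ε b (k + 1) ω ∂μ
        ≤ ∫ ω, (selfNormExp φ y ε b k ω + F (y k ω) ω * ε k ω) ∂μ := by
          refine integral_mono (hint _ hk) ((hint k hk').add hFi) fun ω => ?_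
          refine (selfNormExp_succ_le hb k ω (hεb k (by omega) ω)).trans_eq ?_
          rw [hF]
          ring
      _ = ∫ ω, selfNormExp φ y ε b k ω ∂μ := by
          rw [integral_add (hint k hk') hFi, hz, add_zero]
      _ ≤ 1 := ih hk'

theorem measureReal_le_mul_integral {f : Ω → ℝ} (hf0 : ∀ ω, 0 ≤ f ω) (hf : Integrable f μ)
    (h1 : ∫ ω, f ω ∂μ ≤ 1) {δ : ℝ} (hδ : 0 < δ) : μ.real {ω | δ⁻¹ ≤ f ω} ≤ δ := by
  have := mul_meas_ge_le_integral_of_nonneg (ae_of_all _ hf0) hf δ⁻¹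
  rw [inv_mul_le_iff₀ hδ] at this
  nlinarith

/-- Self-normalised tail bound. -/
theorem measureReal_selfNormalized_le [IsProbabilityMeasure μ] [Countable ι]
    (hb : 0 < b) (hφ : ∀ i, l2norm (φ i) ≤ 1)
    (hy : ∀ τ < n, Measurable[𝓕 (τ + 1)] (y τ)) (hε : ∀ τ < n, Measurable[𝓕 (τ + 1)] (ε τ))
    (hεb : ∀ τ < n, ∀ ω, |ε τ ω| ≤ b) (hN : IsNoise μ 𝓕 y ε n) {k : ℕ} (hk : k ≤ n)
    {δ : ℝ} (hδ : 0 < δ) :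
    μ.real {ω | b ^ 2 * (d * Real.log (1 + k) + 2 * Real.log δ⁻¹)
      < wnorm (noiseGram φ y k ω)⁻¹ (noiseSum φ y ε k ω) ^ 2} ≤ δ := by
  have hint : Integrable (selfNormExp φ y ε b k) μ :=
    integrable_of_abs_le ((measurable_selfNormExp hy hε hk).mono (𝓕.le k) le_rfl) fun ω => by
      rw [abs_of_nonneg (selfNormExp_nonneg k ω)]
      exact selfNormExp_le hb hφ k ω fun τ hτ => hεb τ (hτ.trans_le hk) ω
  refine le_trans (measureReal_mono fun ω hω => ?_) (measureReal_le_mul_integral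
    (fun ω => selfNormExp_nonneg k ω) hint (integral_selfNormExp_le_one hb hφ hy hε hεb hN k hk) hδ)
  have hω' : b ^ 2 * (d * Real.log (1 + k) + 2 * Real.log δ⁻¹)
      < wnorm (noiseGram φ y k ω)⁻¹ (noiseSum φ y ε k ω) ^ 2 := hω
  change δ⁻¹ ≤ selfNormExp φ y ε b k ω
  have hdet1 : 1 ≤ (noiseGram φ y k ω).det := one_le_det_gram k
  have hdet : (noiseGram φ y k ω).det ≤ (1 + k) ^ d := det_gram_le (fun τ => hφ _) k
  have hlog : Real.log (noiseGram φ y k ω).det ≤ d * Real.log (1 + k) := by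
    rw [← Real.log_pow]
    exact Real.log_le_log (by linarith) hdet
  rw [selfNormExp, ← wnorm_sq (noiseGram_inv_posSemidef φ y k ω)]
  have hs : 0 < √(noiseGram φ y k ω).det := Real.sqrt_pos.2 (by linarith)
  rw [le_inv_mul_iff₀ hs, ← Real.log_le_iff_le_exp (by positivity),
    Real.log_mul hs.ne' (by positivity), Real.log_sqrt (by linarith), le_div_iff₀ (by positivity)]
  have hb2 : 0 < b ^ 2 := by positivity
  refine le_trans ?_ hω'.le
  have : (Real.log (noiseGram φ y k ω).det / 2 + Real.log δ⁻¹) * (2 * b ^ 2)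
      = b ^ 2 * (Real.log (noiseGram φ y k ω).det + 2 * Real.log δ⁻¹) := by ring
  rw [this]
  gcongr

end SelfNormalized

/-! ### A multiplicative Freedman inequality -/

section Freedman

/-- From exp(-x) ≤ 1/(1+x), because (1+x)(1-x/2) ≥ 1 on the unit interval. -/
theorem exp_neg_le_one_sub_half {x : ℝ} (h0 : 0 ≤ x) (h1 : x ≤ 1) : Real.exp (-x) ≤ 1 - x / 2 := by
  rw [Real.exp_neg]
  calc (Real.exp x)⁻¹ ≤ (x + 1)⁻¹ := by
        gcongr; exact Real.add_one_le_exp x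
    _ ≤ 1 - x / 2 := by
        rw [inv_le_iff_one_le_mul₀ (by linarith)]
        nlinarith

variable {Ω : Type*} [mΩ : MeasurableSpace Ω] {𝓕 : Filtration ℕ mΩ} {n : ℕ} {μ : Measure Ω}
  [IsProbabilityMeasure μ] {W v : ℕ → Ω → ℝ} {B : ℝ}

/-- If `v_k = E[W_k ∣ 𝓕_k]` and `W_k ∈ [0, B]`, then `∑ v_k ≤ 2 ∑ W_k + 2 B log(1/δ)` with
probability at least `1 - δ`. -/
theorem measureReal_freedman_le (hB : 0 < B)
    (hW : ∀ k < n, Measurable[𝓕 (k + 1)] (W k)) (hv : ∀ k < n, Measurable[𝓕 k] (v k))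
    (hWb : ∀ k < n, ∀ ω, W k ω ∈ Set.Icc 0 B) (hvb : ∀ k < n, ∀ ω, v k ω ∈ Set.Icc 0 B)
    (hmean : ∀ k < n, ∀ Z : Ω → ℝ, Measurable[𝓕 k] Z → (∃ C, ∀ ω, |Z ω| ≤ C) →
      ∫ ω, Z ω * W k ω ∂μ = ∫ ω, Z ω * v k ω ∂μ) {δ : ℝ} (hδ : 0 < δ) :
    μ.real {ω | 2 * ∑ k ∈ Finset.range n, W k ω + 2 * B * Real.log δ⁻¹
      < ∑ k ∈ Finset.range n, v k ω} ≤ δ := by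
  -- This process has expectation at most 1 at every time: the conditional mean of exp(-W/B) is at
  -- most 1 - v/(2B), hence at most exp(-v/(2B)).
  let X : ℕ → Ω → ℝ := fun k ω => Real.exp (∑ τ ∈ Finset.range k, (v τ ω / (2 * B) - W τ ω / B))
  have hXm : ∀ k ≤ n, Measurable[𝓕 k] (X k) := by
    intro k hk
    refine Measurable.exp (Finset.measurable_sum _ fun τ hτ => ?_)
    have hτ' := Finset.mem_range.1 hτ
    exact (((hv τ (by omega)).mono (𝓕.mono hτ'.le) le_rfl).div_const _).sub
      (((hW τ (by omega)).mono (𝓕.mono hτ') le_rfl).div_const _)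
  have hXb : ∀ k ≤ n, ∀ ω, |X k ω| ≤ Real.exp k := by
    intro k hk ω
    rw [Real.abs_exp]
    refine Real.exp_le_exp.2 ((Finset.sum_le_card_nsmul _ _ 1 fun τ hτ => ?_).trans_eq (by simp))
    have hτ' := Finset.mem_range.1 hτ
    have h1 := hvb τ (by omega) ω
    have h2 := hWb τ (by omega) ω
    have e1 : v τ ω / (2 * B) ≤ 1 := by rw [div_le_one (by positivity)]; linarith [h1.2]
    have e2 : 0 ≤ W τ ω / B := div_nonneg h2.1 hB.le
    linarith
  have hXi : ∀ k ≤ n, Integrable (X k) μ := fun k hk =>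
    integrable_of_abs_le ((hXm k hk).mono (𝓕.le k) le_rfl) (hXb k hk)
  have hle : ∀ k ≤ n, ∫ ω, X k ω ∂μ ≤ 1 := by
    intro k
    induction k with
    | zero => simp [X]
    | succ k ih =>
      intro hk
      have hk' : k ≤ n := by omega
      have hvk := hvb k (by omega)
      have hWk := hWb k (by omega)
      -- The part of the next value of X known at time k. Once exp(-W/B) has been linearised,
      -- testing the mean hypothesis against Z replaces W by v.
      let Z : Ω → ℝ := fun ω => X k ω * Real.exp (v k ω / (2 * B))
      have hZm : Measurable[𝓕 k] Z := (hXm k hk').mul ((hv k (by omega)).div_const _).exp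
      have hZb : ∀ ω, |Z ω| ≤ Real.exp k * Real.exp 1 := by
        intro ω
        rw [abs_mul]
        refine mul_le_mul (hXb k hk' ω) ?_ (abs_nonneg _) (Real.exp_pos _).le
        rw [Real.abs_exp, Real.exp_le_exp, div_le_one (by positivity)]
        linarith [(hvk ω).2]
      have hZm' : Measurable Z := hZm.mono (𝓕.le k) le_rfl
      have hZi : Integrable Z μ := integrable_of_abs_le hZm' hZb
      have hprod : ∀ f : Ω → ℝ, Measurable f → (∀ ω, f ω ∈ Set.Icc 0 B) →
          Integrable (fun ω => Z ω * f ω) μ := fun f hf hfb =>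
        hZi.mul_bdd (c := B) hf.aestronglyMeasurable (ae_of_all _ fun ω => by
          rw [Real.norm_eq_abs, abs_of_nonneg (hfb ω).1]; exact (hfb ω).2)
      have hWi := hprod _ ((hW k (by omega)).mono (𝓕.le _) le_rfl) hWk
      have hvi := hprod _ ((hv k (by omega)).mono (𝓕.le _) le_rfl) hvk
      calc ∫ ω, X (k + 1) ω ∂μ ≤ ∫ ω, (Z ω - (2 * B)⁻¹ * (Z ω * W k ω)) ∂μ := by
            refine integral_mono (hXi _ hk) (hZi.sub (hWi.const_mul _)) fun ω => ?_
            have h1 : X (k + 1) ω = Z ω * Real.exp (-(W k ω / B)) := by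
              simp only [X, Z, Finset.sum_range_succ, Real.exp_add, Real.exp_sub, Real.exp_neg]
              ring
            have h2 := exp_neg_le_one_sub_half (div_nonneg (hWk ω).1 hB.le)
              ((div_le_one hB).2 (hWk ω).2)
            have hZ0 : 0 ≤ Z ω := by positivity
            calc X (k + 1) ω = _ := h1
              _ ≤ Z ω * (1 - W k ω / B / 2) := by gcongr
              _ = _ := by field_simp
        _ = ∫ ω, (Z ω - (2 * B)⁻¹ * (Z ω * v k ω)) ∂μ := by
            rw [integral_sub hZi (hWi.const_mul _), integral_sub hZi (hvi.const_mul _),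
              integral_const_mul, integral_const_mul, hmean k (by omega) Z hZm ⟨_, hZb⟩]
        _ ≤ ∫ ω, X k ω ∂μ := by
            refine integral_mono (hZi.sub (hvi.const_mul _)) (hXi k hk') fun ω => ?_
            have h3 := Real.add_one_le_exp (-(v k ω / (2 * B)))
            calc Z ω - (2 * B)⁻¹ * (Z ω * v k ω)
                = X k ω * (Real.exp (v k ω / (2 * B)) * (-(v k ω / (2 * B)) + 1)) := by
                  simp only [Z]; ring
              _ ≤ X k ω * (Real.exp (v k ω / (2 * B)) * Real.exp (-(v k ω / (2 * B)))) := by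
                  gcongr
              _ = X k ω := by rw [← Real.exp_add, add_neg_cancel, Real.exp_zero, mul_one]
        _ ≤ 1 := ih hk'
  refine le_trans (measureReal_mono fun ω hω => ?_) (measureReal_le_mul_integral
    (fun ω => (Real.exp_pos _).le) (hXi n le_rfl) (hle n le_rfl) hδ)
  have hω' : 2 * ∑ k ∈ Finset.range n, W k ω + 2 * B * Real.log δ⁻¹
    < ∑ k ∈ Finset.range n, v k ω := hω
  change δ⁻¹ ≤ Real.exp _
  rw [← Real.log_le_iff_le_exp (by positivity), Finset.sum_sub_distrib, ← Finset.sum_div,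
    ← Finset.sum_div]
  have : (∑ τ ∈ Finset.range n, v τ ω) / (2 * B) - (∑ τ ∈ Finset.range n, W τ ω) / B
      = (∑ τ ∈ Finset.range n, v τ ω - 2 * ∑ τ ∈ Finset.range n, W τ ω) / (2 * B) := by
    field_simp
  rw [this, le_div_iff₀ (by positivity)]
  linarith

end Freedman

/-! ### Deterministic properties of the learner -/

section Learner

variable {S A : Type*} [Fintype A] {H d : ℕ}
  (E : KnownPart S A d) (p : Params) (o : Observations S A H d)

theorem vEst_last (st : LearnerState S A H) (k : ℕ) (l : Kind) :
    vEst E p o st k l (Fin.last H) = 0 := by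
  rw [vEst, Fin.reverseInduction_last]; rfl

theorem vEst_castSucc (st : LearnerState S A H) (k : ℕ) (l : Kind) (j : Fin H) (s : S) :
    vEst E p o st k l j.castSucc s = ∑ a, st.policy j s a * qEst E p o st k l j s a := by
  rw [vEst, Fin.reverseInduction_castSucc]; rfl

theorem learner_zero : learner E p o 0 = newEpoch S A H 0 := by rw [learner]

theorem learner_succ (k : ℕ) :
    learner E p o (k + 1) = newEpoch S A H (k + 1) ∨
      learner E p o (k + 1) = endEpisode E p o (learner E p o k) k := by
  rw [learner]
  split_ifs
  · exact Or.inl rfl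
  · exact Or.inr rfl

theorem learner_start_le (k : ℕ) : (learner E p o k).start ≤ k := by
  induction k with
  | zero => rw [learner_zero]; rfl
  | succ k ih =>
    rcases learner_succ E p o k with h | h <;> rw [h]
    · rfl
    · exact ih.trans (Nat.le_succ k)

theorem learner_Y_nonneg (k : ℕ) : 0 ≤ (learner E p o k).Y := by
  induction k with
  | zero => rw [learner_zero]; rfl
  | succ k ih =>
    rcases learner_succ E p o k with h | h <;> rw [h]
    · rfl
    · exact le_max_left _ _

/-- Mixing with the uniform distribution. -/
def mixUnif (π : S → A → ℝ) (s : S) (a : A) : ℝ :=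
  (1 - p.θ) * π s a + p.θ * (Fintype.card A : ℝ)⁻¹

/-- Exponential-weights update with losses `f`. -/
def expUpdate (π f : S → A → ℝ) (s : S) (a : A) : ℝ :=
  π s a * Real.exp (-f s a) / ∑ a', π s a' * Real.exp (-f s a')

theorem theta_mem (hK : 0 < p.K) : 0 ≤ p.θ ∧ p.θ ≤ 1 := by
  have : (1 : ℝ) ≤ p.K := by exact_mod_cast hK
  exact ⟨by unfold Params.θ; positivity, inv_le_one_of_one_le₀ this⟩

section Positivity

variable [Nonempty A]

theorem card_inv_pos : 0 < (Fintype.card A : ℝ)⁻¹ := by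
  have : 0 < Fintype.card A := Fintype.card_pos
  positivity

variable {p}

theorem mixUnif_pos (hK : 0 < p.K) {π : S → A → ℝ} (hπ : ∀ s a, 0 < π s a) (s : S) (a : A) :
    0 < mixUnif p π s a := by
  obtain ⟨h0, h1⟩ := theta_mem p hK
  have hc : 0 < (Fintype.card A : ℝ)⁻¹ := card_inv_pos
  unfold mixUnif
  -- For K = 1 the mixing weight is 1 and positivity comes from the uniform part alone.
  rcases h1.eq_or_lt with h | h
  · rw [h]; linarith
  · have := mul_pos (sub_pos.2 h) (hπ s a)
    have := mul_nonneg h0 hc.le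
    linarith

theorem expUpdate_sum_pos {π : S → A → ℝ} (hπ : ∀ s a, 0 < π s a) (f : S → A → ℝ) (s : S) :
    0 < ∑ a, π s a * Real.exp (-f s a) :=
  Finset.sum_pos (fun a _ => mul_pos (hπ s a) (Real.exp_pos _)) Finset.univ_nonempty

theorem expUpdate_pos {π : S → A → ℝ} (hπ : ∀ s a, 0 < π s a) (f : S → A → ℝ) (s : S) (a : A) :
    0 < expUpdate π f s a :=
  div_pos (mul_pos (hπ s a) (Real.exp_pos _)) (expUpdate_sum_pos hπ f s)

theorem expUpdate_sum {π : S → A → ℝ} (hπ : ∀ s a, 0 < π s a) (f : S → A → ℝ) (s : S) :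
    ∑ a, expUpdate π f s a = 1 := by
  simp only [expUpdate]
  rw [← Finset.sum_div, div_self (expUpdate_sum_pos hπ f s).ne']

/-- Normalising constants cancel, so consecutive updates without mixing cost a single layer. This is
what keeps the number of layers, and hence the net, small. -/
theorem expUpdate_expUpdate {π : S → A → ℝ} (hπ : ∀ s a, 0 < π s a) (f g : S → A → ℝ) :
    expUpdate (expUpdate π f) g = expUpdate π (fun s a => f s a + g s a) := by
  funext s a
  have h1 := expUpdate_sum_pos hπ f s
  simp only [expUpdate]
  have h2 : ∀ a, π s a * Real.exp (-f s a) / (∑ a', π s a' * Real.exp (-f s a'))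
      * Real.exp (-g s a)
      = π s a * Real.exp (-(f s a + g s a)) / (∑ a', π s a' * Real.exp (-f s a')) := by
    intro a
    rw [neg_add, Real.exp_add]
    ring
  simp only [h2]
  rw [← Finset.sum_div]
  field_simp

end Positivity

theorem endEpisode_policy (st : LearnerState S A H) (k : ℕ) (h : Fin H) :
    (endEpisode E p o st k).policy h =
      expUpdate (if p.period ∣ (k - st.start) then mixUnif p (st.policy h) else st.policy h)
        (fun s a => p.α * (qEst E p o st k .f h s a + st.Y * qEst E p o st k .g h s a)) := by
  have key : ∀ s a, policyWeight E p o st k h s a =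
      (if p.period ∣ (k - st.start) then mixUnif p (st.policy h) else st.policy h) s a *
        Real.exp (-(p.α * (qEst E p o st k .f h s a + st.Y * qEst E p o st k .g h s a))) := by
    intro s a
    rw [policyWeight, mixedPolicy, neg_mul]
    split_ifs <;> rfl
  funext s a
  simp only [endEpisode, expUpdate, key]

theorem learner_policy_pos [Nonempty A] (hK : 0 < p.K) (k : ℕ) (h : Fin H) (s : S) (a : A) :
    0 < (learner E p o k).policy h s a := by
  induction k generalizing s a with
  | zero => rw [learner_zero]; exact card_inv_pos
  | succ k ih =>
    rcases learner_succ E p o k with h' | h' <;> rw [h']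
    · exact card_inv_pos
    · rw [endEpisode_policy]
      refine expUpdate_pos (fun s a => ?_) _ s a
      split_ifs
      · exact mixUnif_pos hK ih s a
      · exact ih s a

theorem unif_sum [Nonempty A] : ∑ _a : A, (Fintype.card A : ℝ)⁻¹ = 1 := by
  have : (Fintype.card A : ℝ) ≠ 0 := by exact_mod_cast Fintype.card_ne_zero
  simp [this]

theorem learner_policy_sum [Nonempty A] (hK : 0 < p.K) (k : ℕ) (h : Fin H) (s : S) :
    ∑ a, (learner E p o k).policy h s a = 1 := by
  cases k with
  | zero => rw [learner_zero]; exact unif_sum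
  | succ k =>
    rcases learner_succ E p o k with h' | h' <;> rw [h']
    · exact unif_sum
    · rw [endEpisode_policy]
      refine expUpdate_sum (fun s a => ?_) _ s
      split_ifs
      · exact mixUnif_pos hK (learner_policy_pos E p o hK k h) s a
      · exact learner_policy_pos E p o hK k h s a

/-! ### Linear parametrisation of the value estimates -/

/-- Contraction factor of the features for the inverse design matrix `N`. -/
def contraction (N : Matrix (Fin d) (Fin d) ℝ) (s : S) (a : A) : ℝ :=
  Real.sigmoid (-p.βw H d (Fintype.card A) * wnorm N (E.φ s a) + Real.log p.K)

/-- Contracted features, extended by one coordinate for the bonus. -/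
def featPlus (H : ℕ) (N : Matrix (Fin d) (Fin d) ℝ) (s : S) (a : A) : Option (Fin d) → ℝ
  | some i => contraction (H := H) E p N s a * E.φ s a i
  | none => -(contraction (H := H) E p N s a * wnorm N (E.φ s a))

/-- Linear function of the extended contracted features. -/
def linQ (H : ℕ) (N : Matrix (Fin d) (Fin d) ℝ) (θ : Option (Fin d) → ℝ) (s : S) (a : A) : ℝ :=
  ∑ i, θ i * featPlus E p H N s a i

/-- Coefficients of `Q̂_{ℓ,h}^k` in the extended contracted features. -/
def qParam (k : ℕ) (l : Kind) (h : Fin H) (V : S → ℝ) : Option (Fin d) → ℝ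
  | some i => (thetaHat E o k h l + psiHat E o k h V) i
  | none => p.βb H d (Fintype.card A)

/-- Putting the negated bonus into an extra feature coordinate makes the estimate linear in its
coefficients. The features depend only on the design matrix of the epoch start, so losses of
different episodes of one epoch can be added coefficientwise. -/
theorem qStep_eq_linQ (ke k : ℕ) (l : Kind) (h : Fin H) (V : S → ℝ) (s : S) (a : A) :
    qStep E p o ke k l h V s a = linQ E p H (design E o ke h)⁻¹ (qParam E p o k l h V) s a := by
  rw [qStep, linQ, Fintype.sum_option]
  have h1 : contracted E p o ke h s a
      = contraction (H := H) E p (design E o ke h)⁻¹ s a • E.φ s a := rfl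
  have h2 : 0 ≤ contraction (H := H) E p (design E o ke h)⁻¹ s a := Real.sigmoid_nonneg _
  rw [h1, wnorm_smul, abs_of_nonneg h2]
  simp only [dotProduct, featPlus, qParam, Pi.smul_apply, smul_eq_mul]
  rw [sub_eq_add_neg, add_comm]
  congr 1
  · ring
  · exact Finset.sum_congr rfl fun i _ => mul_comm _ _

theorem linQ_add (N : Matrix (Fin d) (Fin d) ℝ) (θ θ' : Option (Fin d) → ℝ) (s : S) (a : A) :
    linQ E p H N (θ + θ') s a = linQ E p H N θ s a + linQ E p H N θ' s a := by
  simp only [linQ, Pi.add_apply, add_mul, Finset.sum_add_distrib]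

theorem linQ_smul (N : Matrix (Fin d) (Fin d) ℝ) (c : ℝ) (θ : Option (Fin d) → ℝ) (s : S) (a : A) :
    linQ E p H N (c • θ) s a = c * linQ E p H N θ s a := by
  simp only [linQ, Pi.smul_apply, smul_eq_mul, Finset.mul_sum, mul_assoc]

/-- Policy after `n` rounds of mixing followed by an exponential-weights update. -/
def layerPolicy (H : ℕ) (N : Matrix (Fin d) (Fin d) ℝ) (θ : ℕ → Option (Fin d) → ℝ) :
    ℕ → S → A → ℝ
  | 0 => fun _ _ => (Fintype.card A : ℝ)⁻¹
  | n + 1 => expUpdate (mixUnif p (layerPolicy H N θ n)) (linQ E p H N (θ n))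

theorem layerPolicy_congr (N : Matrix (Fin d) (Fin d) ℝ) {θ θ' : ℕ → Option (Fin d) → ℝ} {n : ℕ}
    (h : ∀ i < n, θ i = θ' i) : layerPolicy E p H N θ n = layerPolicy E p H N θ' n := by
  induction n with
  | zero => rfl
  | succ n ih =>
    rw [layerPolicy, layerPolicy, ih fun i hi => h i (by omega), h n (by omega)]

theorem layerPolicy_pos [Nonempty A] {p} (hK : 0 < p.K) (N : Matrix (Fin d) (Fin d) ℝ)
    (θ : ℕ → Option (Fin d) → ℝ) (n : ℕ) (s : S) (a : A) : 0 < layerPolicy E p H N θ n s a := by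
  induction n generalizing s a with
  | zero => exact card_inv_pos
  | succ n ih => exact expUpdate_pos (mixUnif_pos hK ih) _ s a

theorem layerPolicy_sum [Nonempty A] {p} (hK : 0 < p.K) (N : Matrix (Fin d) (Fin d) ℝ)
    (θ : ℕ → Option (Fin d) → ℝ) (n : ℕ) (s : S) : ∑ a, layerPolicy E p H N θ n s a = 1 := by
  cases n with
  | zero => exact unif_sum
  | succ n => exact expUpdate_sum (mixUnif_pos hK (layerPolicy_pos E hK N θ n)) _ s

/-- Within an epoch the policy is a layered policy with few layers and bounded coefficients. -/
theorem exists_layerPolicy_eq [Nonempty A] (hK : 0 < p.K) (hα : 0 ≤ p.α) (hper : 0 < p.period)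
    (h : Fin H) {R Y : ℝ} (hR : 0 ≤ R) (k : ℕ)
    (hq : ∀ j < k, ∀ l i, |qParam E p o j l h (Vhat E p o j l h.succ) i| ≤ R)
    (hY : ∀ j < k, (learner E p o j).Y ≤ Y) (hY0 : 0 ≤ Y) :
    ∃ (n : ℕ) (θ : ℕ → Option (Fin d) → ℝ),
      (learner E p o k).policy h
        = layerPolicy E p H (design E o (learner E p o k).start h)⁻¹ θ n ∧
      n * p.period < k - (learner E p o k).start + p.period ∧
      k - (learner E p o k).start ≤ n * p.period ∧
      ∀ i j, |θ i j| ≤ (k - (learner E p o k).start : ℕ) * (p.α * ((1 + Y) * R)) := by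
  have hc : 0 ≤ p.α * ((1 + Y) * R) := by positivity
  induction k with
  | zero =>
    rw [learner_zero]
    exact ⟨0, 0, rfl, by simpa [newEpoch] using hper, by simp [newEpoch], by simp [newEpoch]⟩
  | succ k ih =>
    rcases learner_succ E p o k with h' | h'
    · rw [h']
      exact ⟨0, 0, rfl, by simpa [newEpoch] using hper, by simp [newEpoch], by simp [newEpoch]⟩
    obtain ⟨n, θ, h1, h2, h3, h4⟩ := ih (fun j hj => hq j (by omega)) (fun j hj => hY j (by omega))
    have hst := learner_start_le E p o k
    rw [h', endEpisode_policy]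
    set st := learner E p o k with hst'
    have hstart : (endEpisode E p o st k).start = st.start := rfl
    rw [hstart]
    obtain ⟨r, hr⟩ : ∃ r, k = st.start + r := ⟨k - st.start, by omega⟩
    have hr1 : k - st.start = r := by omega
    have hr2 : k + 1 - st.start = r + 1 := by omega
    rw [hr2]
    rw [hr1] at h2 h3 h4 ⊢
    set N := (design E o st.start h)⁻¹ with hN
    -- Coefficients of the combined loss of episode k; the dual variable enters only as a scalar
    -- weight.
    let θnew : Option (Fin d) → ℝ := p.α • (qParam E p o k .f h (Vhat E p o k .f h.succ)
      + st.Y • qParam E p o k .g h (Vhat E p o k .g h.succ))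
    have hloss : (fun s a => p.α * (qEst E p o st k .f h s a + st.Y * qEst E p o st k .g h s a))
        = linQ E p H N θnew := by
      funext s a
      rw [linQ_smul, linQ_add, linQ_smul, hN, ← qStep_eq_linQ, ← qStep_eq_linQ]
      rfl
    have hnew : ∀ i, |θnew i| ≤ p.α * ((1 + Y) * R) := by
      intro i
      simp only [θnew, Pi.smul_apply, Pi.add_apply, smul_eq_mul]
      rw [abs_mul, abs_of_nonneg hα]
      refine mul_le_mul_of_nonneg_left ?_ hα
      refine (abs_add_le _ _).trans ?_
      rw [abs_mul, abs_of_nonneg (learner_Y_nonneg E p o k), add_mul, one_mul]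
      exact add_le_add (hq k (by omega) _ _) (mul_le_mul (hY k (by omega))
        (hq k (by omega) _ _) (abs_nonneg _) hY0)
    rw [hloss, h1]
    -- The two inequalities in the induction say that n is r divided by the period, rounded up. A
    -- new layer opens exactly when the current episode mixes.
    by_cases hdvd : p.period ∣ r
    · rw [if_pos hdvd]
      obtain ⟨q, rfl⟩ := hdvd
      have hnq : n = q := by
        have e1 : q ≤ n := by
          rw [mul_comm n] at h3
          exact Nat.le_of_mul_le_mul_left h3 hper
        have e2 : n < q + 1 := by
          refine Nat.lt_of_mul_lt_mul_left (a := p.period) ?_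
          rw [mul_comm, mul_add, mul_one]; exact h2
        omega
      subst hnq
      refine ⟨n + 1, Function.update θ n θnew, ?_, ?_, ?_, ?_⟩
      · rw [layerPolicy, Function.update_self]
        congr 2
        exact layerPolicy_congr E p N fun i hi => (Function.update_of_ne hi.ne _ _).symm
      · rw [add_mul, one_mul, mul_comm n]; omega
      · rw [add_mul, one_mul, mul_comm n]; omega
      · intro i j
        push_cast at h4 ⊢
        rcases eq_or_ne i n with rfl | hi
        · rw [Function.update_self]
          refine (hnew j).trans ?_
          rw [add_mul, one_mul]
          have : 0 ≤ (p.period : ℝ) * i * (p.α * ((1 + Y) * R)) := by positivity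
          linarith
        · rw [Function.update_of_ne hi]
          refine (h4 i j).trans ?_
          gcongr
          linarith
    · rw [if_neg hdvd]
      -- Without mixing r is not a multiple of the period, so r > 0 and a last layer already exists.
      obtain ⟨n, rfl⟩ : ∃ n', n = n' + 1 := by
        refine Nat.exists_eq_succ_of_ne_zero fun h0 => hdvd ?_
        subst h0
        have : r = 0 := by omega
        simp [this]
      -- The new loss is merged into the last layer. One more episode adds at most one increment to
      -- any coefficient, which accounts for the factor counting episodes of the epoch.
      refine ⟨n + 1, Function.update θ n (θ n + θnew), ?_, by omega, ?_, ?_⟩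
      · rw [layerPolicy, layerPolicy, Function.update_self,
          expUpdate_expUpdate (mixUnif_pos hK (layerPolicy_pos E hK N θ n))]
        congr 1
        · congr 1
          exact layerPolicy_congr E p N fun i hi => (Function.update_of_ne hi.ne _ _).symm
        · funext s a
          rw [linQ_add]
      · have : r ≠ (n + 1) * p.period := fun e => hdvd ⟨n + 1, by rw [e, mul_comm]⟩
        omega
      · intro i j
        push_cast
        rcases eq_or_ne i n with rfl | hi
        · rw [Function.update_self, add_mul, one_mul]
          exact (abs_add_le _ _).trans (add_le_add (h4 i j) (hnew j))
        · rw [Function.update_of_ne hi]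
          refine (h4 i j).trans ?_
          gcongr
          linarith

end Learner

/-! ### Measurability of the learner -/

section LearnerMeasurability

/-- The observations before episode `n` are measurable. -/
structure ObsMeasurable {S A : Type*} [MeasurableSpace S] [MeasurableSpace A] {H d : ℕ}
    {Ω : Type*} [MeasurableSpace Ω] (o : Ω → Observations S A H d) (n : ℕ) : Prop where
  s : ∀ τ < n, ∀ h, Measurable fun ω => (o ω).s τ h
  a : ∀ τ < n, ∀ h, Measurable fun ω => (o ω).a τ h
  c : ∀ τ < n, ∀ h, Measurable fun ω => (o ω).c τ h
  θf : ∀ τ < n, ∀ h, Measurable fun ω => (o ω).θf τ h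

/-- The components of the learner's state are measurable. -/
structure StateMeasurable {S A : Type*} {H : ℕ} {Ω : Type*} [MeasurableSpace Ω]
    (st : Ω → LearnerState S A H) : Prop where
  start : Measurable fun ω => (st ω).start
  policy : ∀ h s a, Measurable fun ω => (st ω).policy h s a
  Y : Measurable fun ω => (st ω).Y

variable {S A : Type*} [Fintype S] [Fintype A] [MeasurableSpace S] [DiscreteMeasurableSpace S]
  [MeasurableSpace A] [DiscreteMeasurableSpace A] {H d : ℕ}
  (E : KnownPart S A d) (p : Params) {Ω : Type*} {m : MeasurableSpace Ω}
  {o : Ω → Observations S A H d} {n : ℕ}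

theorem measurable_visited (ho : ObsMeasurable o n) {τ : ℕ} (hτ : τ < n) (h : Fin H) :
    Measurable fun ω => visited E (o ω) τ h := by
  have h1 : Measurable fun q : S × A => E.φ q.1 q.2 := Measurable.of_discrete
  exact h1.comp ((ho.s τ hτ h.castSucc).prodMk (ho.a τ hτ h))

theorem measurable_design (ho : ObsMeasurable o n) {k : ℕ} (hk : k ≤ n) (h : Fin H)
    (i j : Fin d) : Measurable fun ω => design E (o ω) k h i j :=
  measurable_gram_apply (x := fun τ ω => visited E (o ω) τ h)
    (fun _ hτ => measurable_visited E ho (hτ.trans_le hk) h) i j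

theorem measurable_design_inv (ho : ObsMeasurable o n) {k : ℕ} (hk : k ≤ n) (h : Fin H)
    (i j : Fin d) : Measurable fun ω => (design E (o ω) k h)⁻¹ i j :=
  measurable_inv_apply (measurable_design E ho hk h) i j

theorem measurable_range_sum {k : ℕ} {f : ℕ → Ω → Fin d → ℝ} (hf : ∀ τ < k, Measurable (f τ)) :
    Measurable fun ω => ∑ τ ∈ Finset.range k, f τ ω :=
  Finset.measurable_sum _ fun τ hτ => hf τ (Finset.mem_range.1 hτ)

theorem measurable_thetaHat (ho : ObsMeasurable o n) {k : ℕ} (hk : k < n) (h : Fin H) (l : Kind) :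
    Measurable fun ω => thetaHat E (o ω) k h l := by
  cases l with
  | f => exact ho.θf k hk h
  | g => exact measurable_mulVec (measurable_design_inv E ho hk.le h) (measurable_range_sum
      fun τ hτ => (ho.c τ (hτ.trans hk) h).smul (measurable_visited E ho (hτ.trans hk) h))

theorem measurable_psiHat (ho : ObsMeasurable o n) {k : ℕ} (hk : k ≤ n) (h : Fin H)
    {V : Ω → S → ℝ} (hV : ∀ s, Measurable fun ω => V ω s) :
    Measurable fun ω => psiHat E (o ω) k h (V ω) :=
  measurable_mulVec (measurable_design_inv E ho hk h) (measurable_range_sum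
    fun τ hτ => (measurable_eval_discrete (F := fun s ω => V ω s) hV
      (ho.s τ (hτ.trans_le hk) h.succ)).smul (measurable_visited E ho (hτ.trans_le hk) h))

theorem measurable_qStep_fixed (ho : ObsMeasurable o n) {ke k : ℕ} (hke : ke ≤ n) (hk : k < n)
    (l : Kind) (h : Fin H) {V : Ω → S → ℝ} (hV : ∀ s, Measurable fun ω => V ω s) (s : S) (a : A) :
    Measurable fun ω => qStep E p (o ω) ke k l h (V ω) s a := by
  have hN := measurable_design_inv E ho hke h
  have hc : Measurable fun ω => contracted E p (o ω) ke h s a := by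
    have h1 : Measurable fun ω => wnorm (design E (o ω) ke h)⁻¹ (E.φ s a) :=
      measurable_wnorm hN measurable_const
    have h2 := continuous_sigmoid.measurable.comp ((h1.const_mul
      (-p.βw H d (Fintype.card A))).add_const (Real.log p.K))
    exact h2.smul measurable_const
  exact (measurable_dotProduct hc ((measurable_thetaHat E ho hk h l).add
    (measurable_psiHat E ho hk.le h hV))).sub ((measurable_wnorm hN hc).const_mul _)

theorem measurable_qStep (ho : ObsMeasurable o n) {ke : Ω → ℕ} (hke : Measurable ke) {k : ℕ}
    (hle : ∀ ω, ke ω ≤ k) (hk : k < n) (l : Kind) (h : Fin H) {V : Ω → S → ℝ}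
    (hV : ∀ s, Measurable fun ω => V ω s) (s : S) (a : A) :
    Measurable fun ω => qStep E p (o ω) (ke ω) k l h (V ω) s a := by
  -- The epoch start is random. Capping the index at k makes the expression measurable for every
  -- deterministic start; the random start is then substituted, where the cap has no effect.
  have h1 : ∀ j, Measurable fun ω => qStep E p (o ω) (min j k) k l h (V ω) s a := fun j =>
    measurable_qStep_fixed E p ho ((min_le_right _ _).trans hk.le) hk l h hV s a
  have h2 := measurable_eval_discrete h1 hke
  simpa only [min_eq_left (hle _)] using h2

variable {st : Ω → LearnerState S A H}

theorem measurable_vEst (ho : ObsMeasurable o n) (hst : StateMeasurable st) {k : ℕ}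
    (hle : ∀ ω, (st ω).start ≤ k) (hk : k < n) (l : Kind) (h : Fin (H + 1)) (s : S) :
    Measurable fun ω => vEst E p (o ω) (st ω) k l h s := by
  induction h using Fin.reverseInduction generalizing s with
  | last =>
    simp only [vEst_last]
    exact measurable_const
  | cast j ih =>
    simp only [vEst_castSucc]
    exact Finset.measurable_sum _ fun a _ => (hst.policy j s a).mul
      (measurable_qStep E p ho hst.start hle hk l j ih s a)

theorem measurable_qEst (ho : ObsMeasurable o n) (hst : StateMeasurable st) {k : ℕ}
    (hle : ∀ ω, (st ω).start ≤ k) (hk : k < n) (l : Kind) (h : Fin H) (s : S) (a : A) :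
    Measurable fun ω => qEst E p (o ω) (st ω) k l h s a :=
  measurable_qStep E p ho hst.start hle hk l h (measurable_vEst E p ho hst hle hk l h.succ) s a

theorem stateMeasurable_endEpisode (ho : ObsMeasurable o n) (hst : StateMeasurable st) {k : ℕ}
    (hle : ∀ ω, (st ω).start ≤ k) (hk : k < n) :
    StateMeasurable fun ω => endEpisode E p (o ω) (st ω) k where
  start := hst.start
  policy := by
    intro h s a
    have hw : ∀ a, Measurable fun ω => policyWeight E p (o ω) (st ω) k h s a := by
      intro a
      refine Measurable.mul ?_ (Measurable.exp (Measurable.const_mul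
        ((measurable_qEst E p ho hst hle hk _ h s a).add
          (hst.Y.mul (measurable_qEst E p ho hst hle hk _ h s a))) _))
      refine Measurable.ite ?_ (((hst.policy h s a).const_mul _).add_const _) (hst.policy h s a)
      exact hst.start (MeasurableSet.of_discrete (s := {j | p.period ∣ (k - j)}))
    exact (hw a).div (Finset.measurable_sum _ fun a' _ => hw a')
  Y := measurable_const.max ((hst.Y.const_mul _).add
    (((((measurable_vEst E p ho hst hle hk _ 0 E.s₁).sub_const _).sub_const _).sub_const
      _).const_mul _))

theorem stateMeasurable_learner (ho : ObsMeasurable o n) {k : ℕ} (hk : k ≤ n) :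
    StateMeasurable fun ω => learner E p (o ω) k := by
  classical
  induction k with
  | zero =>
    simp only [learner_zero]
    exact ⟨measurable_const, fun _ _ _ => measurable_const, measurable_const⟩
  | succ k ih =>
    have ih := ih (by omega)
    have hle : ∀ ω, (learner E p (o ω) k).start ≤ k := fun ω => learner_start_le E p (o ω) k
    have he := stateMeasurable_endEpisode E p ho ih hle hk
    have hset : MeasurableSet {ω | ∃ h : Fin H,
        2 * (design E (o ω) (learner E p (o ω) k).start h).det
          ≤ (design E (o ω) (k + 1) h).det} := by
      rw [Set.ofPred_exists]
      refine MeasurableSet.iUnion fun h => measurableSet_le ?_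
        (measurable_det (measurable_design E ho hk h))
      -- Again the random epoch start is replaced by a capped deterministic index before evaluation.
      have h1 : ∀ j, Measurable fun ω => 2 * (design E (o ω) (min j k) h).det := fun j =>
        (measurable_det (measurable_design E ho
          ((min_le_right _ _).trans (by omega)) h)).const_mul 2
      have h2 := measurable_eval_discrete h1 ih.start
      simpa only [min_eq_left (hle _)] using h2
    refine ⟨?_, fun h s a => ?_, ?_⟩ <;> simp only [learner, apply_ite LearnerState.start,
      apply_ite LearnerState.policy, apply_ite LearnerState.Y, ite_apply]
    · exact Measurable.ite hset measurable_const he.start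
    · exact Measurable.ite hset measurable_const (he.policy h s a)
    · exact Measurable.ite hset measurable_const he.Y

end LearnerMeasurability

/-! ### Value functions -/

section Value

variable {S A : Type*} [Fintype S] [Fintype A] {H d : ℕ} (M : LinearCMDP S A H d)
  {π w : Fin H → S → A → ℝ}

theorem value_last (π w : Fin H → S → A → ℝ) (x : S) : M.value π w (Fin.last H) x = 0 := by
  rw [LinearCMDP.value, Fin.reverseInduction_last]

theorem value_castSucc (π w : Fin H → S → A → ℝ) (j : Fin H) (x : S) :
    M.value π w j.castSucc x
      = ∑ u, π j x u * (w j x u + ∑ x', M.P j x u x' * M.value π w j.succ x') := by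
  rw [LinearCMDP.value, Fin.reverseInduction_castSucc]; rfl

theorem value_const_mul (π w : Fin H → S → A → ℝ) (c : ℝ) (j : Fin (H + 1)) (x : S) :
    M.value π (fun h x u => c * w h x u) j x = c * M.value π w j x := by
  induction j using Fin.reverseInduction generalizing x with
  | last => simp [value_last]
  | cast j ih =>
    simp only [value_castSucc, ih, Finset.mul_sum]
    refine Finset.sum_congr rfl fun u _ => ?_
    rw [mul_add, mul_add, mul_add, Finset.mul_sum, Finset.mul_sum, Finset.mul_sum]
    congr 1
    · ring
    · exact Finset.sum_congr rfl fun _ _ => by ring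

theorem value_nonneg (hπ : ∀ h x u, 0 ≤ π h x u) (hw : ∀ h x u, 0 ≤ w h x u) (j : Fin (H + 1))
    (x : S) : 0 ≤ M.value π w j x := by
  induction j using Fin.reverseInduction generalizing x with
  | last => simp [value_last]
  | cast j ih =>
    rw [value_castSucc]
    exact Finset.sum_nonneg fun u _ => mul_nonneg (hπ _ _ _) (add_nonneg (hw _ _ _)
      (Finset.sum_nonneg fun x' _ => mul_nonneg (M.P_nonneg _ _ _ _) (ih x')))

theorem abs_value_le (hπ : ∀ h x u, 0 ≤ π h x u) (hπ1 : ∀ h x, ∑ u, π h x u = 1) {c : ℝ}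
    (hw : ∀ h x u, |w h x u| ≤ c) (j : Fin (H + 1)) (x : S) :
    |M.value π w j x| ≤ (H - (j : ℕ)) * c := by
  induction j using Fin.reverseInduction generalizing x with
  | last => simp [value_last]
  | cast j ih =>
    rw [value_castSucc]
    refine (Finset.abs_sum_le_sum_abs _ _).trans ?_
    calc ∑ u, |π j x u * (w j x u + ∑ x', M.P j x u x' * M.value π w j.succ x')|
        ≤ ∑ u, π j x u * (c + (H - (j.succ : ℕ)) * c) := by
          refine Finset.sum_le_sum fun u _ => ?_
          rw [abs_mul, abs_of_nonneg (hπ j x u)]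
          refine mul_le_mul_of_nonneg_left ((abs_add_le _ _).trans (add_le_add (hw j x u) ?_))
            (hπ j x u)
          refine (Finset.abs_sum_le_sum_abs _ _).trans ?_
          calc ∑ x', |M.P j x u x' * M.value π w j.succ x'|
              ≤ ∑ x', M.P j x u x' * ((H - (j.succ : ℕ)) * c) := by
                refine Finset.sum_le_sum fun x' _ => ?_
                rw [abs_mul, abs_of_nonneg (M.P_nonneg j x u x')]
                exact mul_le_mul_of_nonneg_left (ih x') (M.P_nonneg _ _ _ _)
            _ = _ := by rw [← Finset.sum_mul, M.P_sum, one_mul]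
      _ = _ := by
          rw [← Finset.sum_mul, hπ1, one_mul, Fin.val_succ, Fin.val_castSucc]
          push_cast
          ring

theorem measurable_value {Ω : Type*} {m : MeasurableSpace Ω} {π w : Ω → Fin H → S → A → ℝ}
    (hπ : ∀ h x u, Measurable fun ω => π ω h x u) (hw : ∀ h x u, Measurable fun ω => w ω h x u)
    (j : Fin (H + 1)) (x : S) : Measurable fun ω => M.value (π ω) (w ω) j x := by
  induction j using Fin.reverseInduction generalizing x with
  | last => simp only [value_last]; exact measurable_const
  | cast j ih =>
    simp only [value_castSucc]
    exact Finset.measurable_sum _ fun u _ => (hπ j x u).mul ((hw j x u).add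
      (Finset.measurable_sum _ fun x' _ => (ih x').const_mul _))

end Value

/-! ### Integration along the trajectory of an episode -/

section CondExp

/-- Averaging over a finite random variable with known conditional law. -/
theorem integral_eval_of_condExp {Ω : Type*} {m mΩ : MeasurableSpace Ω} {μ : Measure Ω}
    [IsProbabilityMeasure μ] (hm : m ≤ mΩ) {ι : Type*} [Fintype ι] [MeasurableSpace ι]
    [DiscreteMeasurableSpace ι] {X : Ω → ι} (hX : Measurable X)
    {q : ι → Ω → ℝ}
    (hq : ∀ i, μ[({ω | X ω = i}).indicator (fun _ => (1 : ℝ)) | m] =ᵐ[μ] q i)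
    {F : ι → Ω → ℝ} (hF : ∀ i, Measurable[m] (F i)) (hb : ∃ C, ∀ i ω, |F i ω| ≤ C) :
    ∫ ω, F (X ω) ω ∂μ = ∫ ω, ∑ i, q i ω * F i ω ∂μ := by
  classical
  obtain ⟨C, hC⟩ := hb
  have hset : ∀ i, MeasurableSet {ω | X ω = i} := fun i => hX (measurableSet_singleton i)
  have hone : ∀ i, Integrable (({ω | X ω = i}).indicator fun _ => (1 : ℝ)) μ := fun i =>
    (integrable_const _).indicator (hset i)
  have hprod : ∀ i (f : Ω → ℝ), Integrable f μ → Integrable (fun ω => F i ω * f ω) μ :=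
    fun i f hf => hf.bdd_mul (c := C) ((hF i).mono hm le_rfl).aestronglyMeasurable
      (ae_of_all _ fun ω => hC i ω)
  have hqi : ∀ i, Integrable (q i) μ := fun i => integrable_condExp.congr (hq i)
  -- Splitting over the finitely many values of X leaves indicators with coefficients measurable for
  -- the conditioning σ-algebra, which can be pulled out of the conditional expectation.
  have h1 : ∀ ω, F (X ω) ω = ∑ i, F i ω * ({ω | X ω = i}).indicator (fun _ => (1 : ℝ)) ω := by
    intro ω
    rw [Finset.sum_eq_single (X ω)]
    · simp
    · intro i _ hi
      have : ω ∉ {ω | X ω = i} := fun h => hi h.symm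
      simp [Set.indicator_of_notMem this]
    · simp
  simp only [h1]
  rw [integral_finsetSum _ fun i _ => hprod i _ (hone i), integral_finsetSum _ fun i _ => by
    simpa only [mul_comm] using hprod i _ (hqi i)]
  refine Finset.sum_congr rfl fun i _ => ?_
  rw [← integral_condExp hm]
  refine integral_congr_ae ?_
  have h2 := condExp_mul_of_stronglyMeasurable_left (μ := μ) (m := m)
    (hF i).stronglyMeasurable (hprod i _ (hone i)) (hone i)
  filter_upwards [h2, hq i] with ω e1 e2
  rw [mul_comm (q i ω), ← e2]
  exact e1

end CondExp

section BeforeAction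

variable {S A : Type*} [MeasurableSpace S] [MeasurableSpace A] {H : ℕ} {Ω : Type*}
  {m : MeasurableSpace Ω} {s : ℕ → Fin (H + 1) → Ω → S} {a : ℕ → Fin H → Ω → A}
  {g : ℕ → Ω → Fin H → S → A → ℝ} {k : ℕ} {h : Fin H}

theorem start_le_beforeAction :
    m ⊔ MeasurableSpace.comap (g k) inferInstance ≤ beforeAction m s a g k h :=
  le_sup_left.trans le_sup_left

theorem measurable_s_beforeAction : Measurable[beforeAction m s a g k h] (s k h.castSucc) := by
  refine (comap_measurable (s k h.castSucc)).mono ?_ le_rfl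
  exact (le_iSup₂_of_le (f := fun (j : Fin (H + 1)) (_ : j ≤ h.castSucc) =>
    MeasurableSpace.comap (s k j) inferInstance) h.castSucc le_rfl le_rfl).trans
      (le_sup_right.trans le_sup_left)

end BeforeAction

namespace IsInteraction

variable {S A : Type*} [Fintype S] [Fintype A] [MeasurableSpace S] [MeasurableSpace A]
  {H d : ℕ} {Ω : Type*} [mΩ : MeasurableSpace Ω]
  {M : LinearCMDP S A H d} {p : Params} {μ : Measure Ω}
  {𝓕 : Filtration ℕ mΩ} {s : ℕ → Fin (H + 1) → Ω → S} {a : ℕ → Fin H → Ω → A}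
  {g : ℕ → Ω → Fin H → S → A → ℝ} {θf : ℕ → Fin H → Ω → Fin d → ℝ}

theorem measurable_s (hI : IsInteraction M p μ 𝓕 s a g θf) {k : ℕ}
    (hk : k < p.K) (h : Fin (H + 1)) : Measurable (s k h) :=
  (hI.s_past k hk h).mono (𝓕.le _) le_rfl

theorem measurable_a (hI : IsInteraction M p μ 𝓕 s a g θf) {k : ℕ}
    (hk : k < p.K) (h : Fin H) : Measurable (a k h) :=
  (hI.a_past k hk h).mono (𝓕.le _) le_rfl

theorem measurable_g (hI : IsInteraction M p μ 𝓕 s a g θf) {k : ℕ}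
    (hk : k < p.K) : Measurable (g k) :=
  (hI.g_past k hk).mono (𝓕.le _) le_rfl

theorem beforeAction_le (hI : IsInteraction M p μ 𝓕 s a g θf) {k : ℕ}
    (hk : k < p.K) (h : Fin H) :
    beforeAction (𝓕 k) s a g k h ≤ mΩ := by
  refine sup_le (sup_le (sup_le (𝓕.le k) (hI.measurable_g hk).comap_le) ?_) ?_
  · exact iSup₂_le fun j _ => (hI.measurable_s hk j).comap_le
  · exact iSup₂_le fun j _ => (hI.measurable_a hk j).comap_le

/-- Integration over the next state. -/
theorem integral_next_state [DiscreteMeasurableSpace S] [IsProbabilityMeasure μ]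
    (hI : IsInteraction M p μ 𝓕 s a g θf) {k : ℕ} (hk : k < p.K)
    (h : Fin H) {F : S → Ω → ℝ}
    (hF : ∀ x,
      Measurable[beforeAction (𝓕 k) s a g k h ⊔ MeasurableSpace.comap (a k h) inferInstance]
      (F x)) (hb : ∃ C, ∀ x ω, |F x ω| ≤ C) :
    ∫ ω, F (s k h.succ ω) ω ∂μ
      = ∫ ω, ∑ x, M.P h (s k h.castSucc ω) (a k h ω) x * F x ω ∂μ :=
  integral_eval_of_condExp
    (sup_le (hI.beforeAction_le hk h) (hI.measurable_a hk h).comap_le)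
    (hI.measurable_s hk h.succ) (hI.s_law k hk h) hF hb

/-- Integration over the action. -/
theorem integral_action [DiscreteMeasurableSpace A] [IsProbabilityMeasure μ]
    (hI : IsInteraction M p μ 𝓕 s a g θf) {k : ℕ} (hk : k < p.K)
    (h : Fin H) {F : A → Ω → ℝ} (hF : ∀ u, Measurable[beforeAction (𝓕 k) s a g k h] (F u))
    (hb : ∃ C, ∀ u ω, |F u ω| ≤ C) :
    ∫ ω, F (a k h ω) ω ∂μ
      = ∫ ω, ∑ u, (learner M.toKnownPart p (observe s a g θf ω) k).policy h
          (s k h.castSucc ω) u * F u ω ∂μ :=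
  integral_eval_of_condExp (hI.beforeAction_le hk h) (hI.measurable_a hk h) (hI.a_law k hk h) hF hb

variable [DiscreteMeasurableSpace S] [DiscreteMeasurableSpace A]

theorem obsMeasurable (hI : IsInteraction M p μ 𝓕 s a g θf) {k : ℕ} (hk : k ≤ p.K) :
    @ObsMeasurable S A _ _ H d Ω (𝓕 k) (observe s a g θf) k := by
  have hs : ∀ τ < k, ∀ h, Measurable[𝓕 k] (s τ h) := fun τ hτ h =>
    (hI.s_past τ (by omega) h).mono (𝓕.mono hτ) le_rfl
  have ha : ∀ τ < k, ∀ h, Measurable[𝓕 k] (a τ h) := fun τ hτ h =>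
    (hI.a_past τ (by omega) h).mono (𝓕.mono hτ) le_rfl
  refine @ObsMeasurable.mk S A _ _ H d Ω (𝓕 k) _ _ hs ha (fun τ hτ h => ?_) fun τ hτ h =>
    (hI.θf_start τ (by omega) h).mono (𝓕.mono hτ.le) le_rfl
  have hg : Measurable[𝓕 k] (g τ) := (hI.g_past τ (by omega)).mono (𝓕.mono hτ) le_rfl
  exact measurable_eval_discrete (F := fun (q : S × A) ω => g τ ω h q.1 q.2)
    (fun q => (measurable_pi_apply q.2).comp ((measurable_pi_apply q.1).comp
      ((measurable_pi_apply h).comp hg))) ((hs τ hτ h.castSucc).prodMk (ha τ hτ h))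

theorem measurable_policy (hI : IsInteraction M p μ 𝓕 s a g θf) {k : ℕ} (hk : k ≤ p.K)
    (h : Fin H) (x : S) (u : A) :
    Measurable[𝓕 k] fun ω =>
      (learner M.toKnownPart p (observe s a g θf ω) k).policy h x u :=
  @StateMeasurable.policy S A H Ω (𝓕 k) _ (@stateMeasurable_learner S A _ _ _ _ _ _ H d
    M.toKnownPart p Ω (𝓕 k) _ k (hI.obsMeasurable hk) k le_rfl) h x u

variable [IsProbabilityMeasure μ]

/-- The expected sum of `w` along an episode is the value of `w` at the initial state. -/
theorem integral_trajectory [Nonempty A] (hI : IsInteraction M p μ 𝓕 s a g θf) {k : ℕ}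
    (hk : k < p.K) {w : Ω → Fin H → S → A → ℝ}
    (hw : ∀ h x u, Measurable[𝓕 k ⊔ MeasurableSpace.comap (g k) inferInstance] fun ω => w ω h x u)
    {C : ℝ} (hC : ∀ ω h x u, |w ω h x u| ≤ C) :
    ∫ ω, M.value (learner M.toKnownPart p (observe s a g θf ω) k).policy (w ω) 0 M.s₁ ∂μ
      = ∫ ω, ∑ h, w ω h (s k h.castSucc ω) (a k h ω) ∂μ := by
  have hK : 0 < p.K := by omega
  let π : Ω → Fin H → S → A → ℝ := fun ω =>
    (learner M.toKnownPart p (observe s a g θf ω) k).policy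
  let v : Fin (H + 1) → S → Ω → ℝ := fun j x ω => M.value (π ω) (w ω) j x
  have hπm : ∀ h x u, Measurable[𝓕 k] fun ω => π ω h x u := hI.measurable_policy hk.le
  have hπm' : ∀ h x u, Measurable[𝓕 k ⊔ MeasurableSpace.comap (g k) inferInstance]
      fun ω => π ω h x u := fun h x u => (hπm h x u).mono le_sup_left le_rfl
  have hvm : ∀ j x, Measurable[𝓕 k ⊔ MeasurableSpace.comap (g k) inferInstance] (v j x) :=
    fun j x => measurable_value M hπm' hw j x
  have hvb : ∀ j x ω, |v j x ω| ≤ H * C := by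
    intro j x ω
    -- Nonnegativity of C can only be read off an existing step; with no steps the bound is
    -- trivially zero.
    have hC0 : 0 ≤ C ∨ H = 0 := by
      rcases Nat.eq_zero_or_pos H with h0 | h0
      · exact Or.inr h0
      · exact Or.inl ((abs_nonneg _).trans (hC ω ⟨0, h0⟩ x (Classical.arbitrary A)))
    refine (abs_value_le M (fun h x u => (learner_policy_pos _ p _ hK k h x u).le)
      (fun h x => learner_policy_sum _ p _ hK k h x) (hC ω) j x).trans ?_
    rcases hC0 with h0 | h0
    · exact mul_le_mul_of_nonneg_right (by simp) h0
    · subst h0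
      simp
  have hstart : 𝓕 k ⊔ MeasurableSpace.comap (g k) inferInstance ≤ mΩ :=
    sup_le (𝓕.le k) (hI.measurable_g hk).comap_le
  have hsm := fun h => hI.measurable_s hk h
  have ham := fun h => hI.measurable_a hk h
  have hwm : ∀ h, Measurable fun ω => w ω h (s k h.castSucc ω) (a k h ω) := fun h =>
    measurable_eval_discrete (F := fun (q : S × A) ω => w ω h q.1 q.2)
      (fun q => (hw h q.1 q.2).mono hstart le_rfl) ((hsm _).prodMk (ham h))
  have hwi : ∀ h, Integrable (fun ω => w ω h (s k h.castSucc ω) (a k h ω)) μ := fun h =>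
    integrable_of_abs_le (hwm h) fun ω => hC ω _ _ _
  -- The expected remaining value along the realised trajectory. Each step of D sheds the expected
  -- weight collected there, so the differences telescope from D 0 down to zero.
  let D : Fin (H + 1) → ℝ := fun j => ∫ ω, v j (s k j ω) ω ∂μ
  have hstep : ∀ h : Fin H, D h.castSucc
      = ∫ ω, w ω h (s k h.castSucc ω) (a k h ω) ∂μ + D h.succ := by
    intro h
    have hs' : Measurable[beforeAction (𝓕 k) s a g k h] (s k h.castSucc) :=
      measurable_s_beforeAction
    have hle : 𝓕 k ⊔ MeasurableSpace.comap (g k) inferInstance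
      ≤ beforeAction (𝓕 k) s a g k h := start_le_beforeAction
    have hnext := hI.integral_next_state hk h (F := v h.succ)
      (fun x => (hvm h.succ x).mono (hle.trans le_sup_left) le_rfl) ⟨_, hvb h.succ⟩
    -- Reward plus expected continuation for a frozen action. Averaging over the action gives the
    -- Bellman recursion, and averaging over the next state has turned the continuation into the
    -- value there.
    let F : A → Ω → ℝ := fun u ω => w ω h (s k h.castSucc ω) u
      + ∑ x, M.P h (s k h.castSucc ω) u x * v h.succ x ω
    have hPm : ∀ x, Measurable fun q : S × A => M.P h q.1 q.2 x := fun x => Measurable.of_discrete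
    have hFm : ∀ u, Measurable[beforeAction (𝓕 k) s a g k h] (F u) := by
      intro u
      refine Measurable.add (measurable_eval_discrete (F := fun x ω => w ω h x u)
        (fun x => (hw h x u).mono hle le_rfl) hs') (Finset.measurable_sum _ fun x _ => ?_)
      exact ((Measurable.of_discrete (f := fun y => M.P h y u x)).comp hs').mul
        ((hvm h.succ x).mono hle le_rfl)
    have hsum : ∀ ω y u, |∑ x, M.P h y u x * v h.succ x ω| ≤ H * C := by
      intro ω y u
      refine (Finset.abs_sum_le_sum_abs _ _).trans ?_
      calc ∑ x, |M.P h y u x * v h.succ x ω| ≤ ∑ x, M.P h y u x * (H * C) := by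
            refine Finset.sum_le_sum fun x _ => ?_
            rw [abs_mul, abs_of_nonneg (M.P_nonneg h y u x)]
            exact mul_le_mul_of_nonneg_left (hvb _ _ _) (M.P_nonneg _ _ _ _)
        _ = H * C := by rw [← Finset.sum_mul, M.P_sum, one_mul]
    have hFb : ∀ u ω, |F u ω| ≤ C + H * C := fun u ω =>
      (abs_add_le _ _).trans (add_le_add (hC _ _ _ _) (hsum _ _ _))
    have hact := hI.integral_action hk h hFm ⟨_, hFb⟩
    have hsi : Integrable
        (fun ω => ∑ x, M.P h (s k h.castSucc ω) (a k h ω) x * v h.succ x ω) μ := by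
      refine integrable_of_abs_le (Finset.measurable_sum _ fun x _ => ?_) fun ω => hsum ω _ _
      exact ((hPm x).comp ((hsm _).prodMk (ham h))).mul ((hvm h.succ x).mono hstart le_rfl)
    calc D h.castSucc = ∫ ω, ∑ u, π ω h (s k h.castSucc ω) u * F u ω ∂μ := by
          refine integral_congr_ae (ae_of_all _ fun ω => ?_)
          exact value_castSucc M (π ω) (w ω) h _
      _ = ∫ ω, F (a k h ω) ω ∂μ := hact.symm
      _ = _ := by rw [integral_add (hwi h) hsi, ← hnext]
  have hD0 : D 0 = ∫ ω, M.value (π ω) (w ω) 0 M.s₁ ∂μ := by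
    refine integral_congr_ae (ae_of_all _ fun ω => ?_)
    change M.value (π ω) (w ω) 0 (s k 0 ω) = _
    rw [hI.s_init k hk ω]
  have hDl : D (Fin.last H) = 0 := by
    change ∫ ω, M.value (π ω) (w ω) (Fin.last H) (s k (Fin.last H) ω) ∂μ = 0
    simp only [value_last, integral_zero]
  have htel : ∑ h : Fin H, D h.castSucc + D (Fin.last H) = D 0 + ∑ h : Fin H, D h.succ := by
    rw [← Fin.sum_univ_castSucc, ← Fin.sum_univ_succ]
  simp only [hstep, Finset.sum_add_distrib, hDl] at htel
  rw [integral_finsetSum _ fun h _ => hwi h, ← hD0]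
  linarith

/-- The noise of the transitions, for a fixed next-step value function `V`. -/
theorem isNoise_transition (hI : IsInteraction M p μ 𝓕 s a g θf) (h : Fin H) (V : S → ℝ) :
    IsNoise μ 𝓕 (fun τ ω => (s τ h.castSucc ω, a τ h ω))
      (fun τ ω => V (s τ h.succ ω) - ∑ x, M.P h (s τ h.castSucc ω) (a τ h ω) x * V x) p.K := by
  rintro k hk F hF ⟨C, hC⟩
  have hs' : Measurable[beforeAction (𝓕 k) s a g k h ⊔ MeasurableSpace.comap (a k h) inferInstance]
      (s k h.castSucc) :=
    measurable_s_beforeAction.mono le_sup_left le_rfl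
  have ha' : Measurable[beforeAction (𝓕 k) s a g k h ⊔ MeasurableSpace.comap (a k h) inferInstance]
      (a k h) := (comap_measurable (a k h)).mono le_sup_right le_rfl
  have hle : 𝓕 k ≤ beforeAction (𝓕 k) s a g k h ⊔ MeasurableSpace.comap (a k h) inferInstance :=
    le_sup_left.trans (start_le_beforeAction.trans le_sup_left)
  let pv : S × A → ℝ := fun q => ∑ x, M.P h q.1 q.2 x * V x
  obtain ⟨B, hB⟩ := (Set.finite_range fun z : S × S × A => |V z.1 - pv z.2|).bddAbove
  have hpm : Measurable pv := Measurable.of_discrete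
  have h1 := hI.integral_next_state hk h
    (F := fun x ω => F (s k h.castSucc ω, a k h ω) ω * (V x - pv (s k h.castSucc ω, a k h ω)))
    (fun x => (measurable_eval_discrete (fun q => (hF q).mono hle le_rfl) (hs'.prodMk ha')).mul
      ((hpm.comp (hs'.prodMk ha')).const_sub _))
    ⟨C * B, fun x ω => by
      rw [abs_mul]
      exact mul_le_mul (hC _ _) (hB ⟨(x, s k h.castSucc ω, a k h ω), rfl⟩) (abs_nonneg _)
        ((abs_nonneg _).trans (hC (s k h.castSucc ω, a k h ω) ω))⟩
  refine h1.trans ?_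
  refine integral_eq_zero_of_ae (ae_of_all _ fun ω => ?_)
  simp only [Pi.zero_apply]
  have h2 : ∀ x, M.P h (s k h.castSucc ω) (a k h ω) x * (F (s k h.castSucc ω, a k h ω) ω *
      (V x - pv (s k h.castSucc ω, a k h ω)))
      = F (s k h.castSucc ω, a k h ω) ω * (M.P h (s k h.castSucc ω) (a k h ω) x * V x)
        - F (s k h.castSucc ω, a k h ω) ω * pv (s k h.castSucc ω, a k h ω)
          * M.P h (s k h.castSucc ω) (a k h ω) x := fun x => by ring
  simp only [h2]
  rw [Finset.sum_sub_distrib, ← Finset.mul_sum, ← Finset.mul_sum, M.P_sum]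
  simp [pv]

end IsInteraction

/-! ### Noise of the costs, and the conditional mean of the bonuses -/

/-- Truncation to `[-c, c]`. -/
def clip (c x : ℝ) : ℝ := max (-c) (min c x)

theorem abs_clip_le {c : ℝ} (hc : 0 ≤ c) (x : ℝ) : |clip c x| ≤ c :=
  abs_le.2 ⟨le_max_left _ _, max_le (by linarith) (min_le_left _ _)⟩

theorem clip_eq_self {c x : ℝ} (h : |x| ≤ c) : clip c x = x := by
  rw [clip, min_eq_right (abs_le.1 h).2, max_eq_right (abs_le.1 h).1]

theorem abs_clip_sub_clip_le (c x y : ℝ) : |clip c x - clip c y| ≤ |x - y| := by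
  rw [clip, clip, max_comm (-c), max_comm (-c), min_comm c, min_comm c]
  exact (abs_max_sub_max_le_abs _ _ _).trans (abs_inf_sub_inf_le_abs x y c)

/-- Truncation to `[0, 1]`. -/
def unitClip (x : ℝ) : ℝ := max 0 (min 1 x)

theorem unitClip_mem (x : ℝ) : unitClip x ∈ Set.Icc (0 : ℝ) 1 :=
  ⟨le_max_left _ _, max_le zero_le_one (min_le_left _ _)⟩

theorem abs_unitClip_le (x : ℝ) : |unitClip x| ≤ 1 := by
  rw [abs_of_nonneg (unitClip_mem x).1]; exact (unitClip_mem x).2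

theorem unitClip_eq_self {x : ℝ} (h : x ∈ Set.Icc (0 : ℝ) 1) : unitClip x = x := by
  rw [unitClip, min_eq_right h.2, max_eq_right h.1]

theorem measurable_unitClip : Measurable unitClip :=
  measurable_const.max (measurable_const.min measurable_id)

theorem measurable_apply_cost {S A : Type*} {H : ℕ} (h : Fin H) (x : S) (u : A) :
    Measurable fun q : Fin H → S → A → ℝ => q h x u :=
  (measurable_pi_apply u).comp ((measurable_pi_apply x).comp (measurable_pi_apply h))

theorem cost_mean_mem {S A : Type*} [Fintype S] {H d : ℕ} (M : LinearCMDP S A H d)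
    (h : Fin H) (x : S) (u : A) :
    M.φ x u ⬝ᵥ M.θg h ∈ Set.Icc (0 : ℝ) 1 := by
  have := M.G_prob
  rw [← M.G_mean h x u]
  have h0 : ∀ᵐ q ∂M.G, 0 ≤ q h x u := M.G_mem.mono fun q hq => (hq h x u).1
  have h1 : ∀ᵐ q ∂M.G, q h x u ≤ 1 := M.G_mem.mono fun q hq => (hq h x u).2
  refine ⟨integral_nonneg_of_ae h0, ?_⟩
  have hi : Integrable (fun q => q h x u) M.G :=
    Integrable.of_bound (measurable_apply_cost h x u).aestronglyMeasurable 1 (by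
      filter_upwards [h0, h1] with q e0 e1
      rwa [Real.norm_eq_abs, abs_of_nonneg e0])
  calc _ ≤ ∫ _, (1 : ℝ) ∂M.G := integral_mono_ae hi (integrable_const _) h1
    _ = 1 := by simp

namespace IsInteraction

variable {S A : Type*} [Fintype S] [Fintype A] [MeasurableSpace S] [MeasurableSpace A]
  {H d : ℕ} {Ω : Type*} [mΩ : MeasurableSpace Ω]
  {M : LinearCMDP S A H d} {p : Params} {μ : Measure Ω}
  {𝓕 : Filtration ℕ mΩ} {s : ℕ → Fin (H + 1) → Ω → S} {a : ℕ → Fin H → Ω → A}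
  {g : ℕ → Ω → Fin H → S → A → ℝ} {θf : ℕ → Fin H → Ω → Fin d → ℝ}

theorem ae_cost_mem (hI : IsInteraction M p μ 𝓕 s a g θf) :
    ∀ᵐ ω ∂μ, ∀ k < p.K, ∀ h x u, g k ω h x u ∈ Set.Icc (0 : ℝ) 1 := by
  refine ae_all_iff.2 fun k => ?_
  by_cases hk : k < p.K
  · have h1 := M.G_mem
    rw [← hI.g_law k hk] at h1
    filter_upwards [ae_of_ae_map (hI.measurable_g hk).aemeasurable h1] with ω hω _
    exact hω
  · exact ae_of_all _ fun ω h => absurd h hk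

theorem integral_unitClip_cost (hI : IsInteraction M p μ 𝓕 s a g θf) {k : ℕ} (hk : k < p.K)
    (h : Fin H) (x : S) (u : A) :
    ∫ ω, unitClip (g k ω h x u) ∂μ = M.φ x u ⬝ᵥ M.θg h := by
  rw [← M.G_mean h x u, ← hI.g_law k hk,
    integral_map (hI.measurable_g hk).aemeasurable
      (measurable_apply_cost h x u).aestronglyMeasurable]
  refine integral_congr_ae ?_
  filter_upwards [hI.ae_cost_mem] with ω hω
  have := hω k hk h x u
  exact unitClip_eq_self this

/-- At a deterministic pair the clipped cost is a function of the fresh draw alone, hence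
independent of the past. Randomly visited pairs are handled in `isNoise_cost`. -/
theorem integral_mul_cost_noise [IsProbabilityMeasure μ] (hI : IsInteraction M p μ 𝓕 s a g θf)
    {k : ℕ} (hk : k < p.K) (h : Fin H) (x : S) (u : A) {Z : Ω → ℝ} (hZ : Measurable[𝓕 k] Z)
    (hb : ∃ C, ∀ ω, |Z ω| ≤ C) :
    ∫ ω, Z ω * (unitClip (g k ω h x u) - M.φ x u ⬝ᵥ M.θg h) ∂μ = 0 := by
  obtain ⟨C, hC⟩ := hb
  have hm : Measurable[MeasurableSpace.comap (g k) inferInstance] fun ω => unitClip (g k ω h x u) :=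
    measurable_unitClip.comp ((measurable_apply_cost h x u).comp (comap_measurable (g k)))
  have hm' : Measurable fun ω => unitClip (g k ω h x u) :=
    hm.mono (hI.measurable_g hk).comap_le le_rfl
  have hZ' : Measurable Z := hZ.mono (𝓕.le k) le_rfl
  have hind : IndepFun Z (fun ω => unitClip (g k ω h x u)) μ := by
    rw [IndepFun_iff_Indep]
    exact indep_of_indep_of_le_left (indep_of_indep_of_le_right (hI.g_indep k hk).symm
      hm.comap_le) hZ.comap_le
  have hZi : Integrable Z μ := integrable_of_abs_le hZ' hC
  have h1 := hind.integral_fun_mul_eq_mul_integral hZ'.aestronglyMeasurable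
    hm'.aestronglyMeasurable
  have hprod : Integrable (fun ω => Z ω * unitClip (g k ω h x u)) μ :=
    hZi.mul_bdd (c := 1) hm'.aestronglyMeasurable
      (ae_of_all _ fun ω => abs_unitClip_le _)
  simp only [mul_sub]
  rw [integral_sub hprod (hZi.mul_const _), h1, integral_mul_const,
    hI.integral_unitClip_cost hk, sub_self]

variable [DiscreteMeasurableSpace S] [DiscreteMeasurableSpace A]

theorem measurable_bonusW (hI : IsInteraction M p μ 𝓕 s a g θf) {k : ℕ} (hk : k ≤ p.K)
    (h : Fin H) (x : S) (u : A) :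
    Measurable[𝓕 k] fun ω => bonusW M.toKnownPart p (observe s a g θf ω) k h x u := by
  have hN : Measurable[𝓕 k] fun ω =>
      wnorm (design M.toKnownPart (observe s a g θf ω) k h)⁻¹ (M.φ x u) :=
    measurable_wnorm (@measurable_design_inv S A _ _ _ _ _ _ H d M.toKnownPart Ω (𝓕 k) _ k
      (hI.obsMeasurable hk) k le_rfl h) (@measurable_const _ _ _ (𝓕 k) _)
  exact (hN.const_mul _).add ((hN.pow_const 2).const_mul _)

variable [IsProbabilityMeasure μ]

/-- The noise of the costs at step `h`. -/
theorem isNoise_cost [Nonempty A] (hI : IsInteraction M p μ 𝓕 s a g θf) (h : Fin H) :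
    IsNoise μ 𝓕 (fun τ ω => (s τ h.castSucc ω, a τ h ω))
      (fun τ ω => unitClip (g τ ω h (s τ h.castSucc ω) (a τ h ω))
        - M.φ (s τ h.castSucc ω) (a τ h ω) ⬝ᵥ M.θg h) p.K := by
  rintro k hk F hF ⟨C, hC⟩
  have hK : 0 < p.K := by omega
  -- The noise at step h, viewed as a weight on trajectories. It involves the cost function of the
  -- episode, which `integral_trajectory` permits: actions and transitions have the same law given
  -- that function as without it.
  let w : Ω → Fin H → S → A → ℝ := fun ω j x u => if j = h then
    F (x, u) ω * (unitClip (g k ω h x u) - M.φ x u ⬝ᵥ M.θg h) else 0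
  have hclip : ∀ x u, Measurable[MeasurableSpace.comap (g k) inferInstance]
      fun ω => unitClip (g k ω h x u) := fun x u =>
    measurable_unitClip.comp ((measurable_apply_cost h x u).comp (comap_measurable (g k)))
  have hw : ∀ j x u, Measurable[𝓕 k ⊔ MeasurableSpace.comap (g k) inferInstance]
      fun ω => w ω j x u := by
    intro j x u
    by_cases hj : j = h
    · simp only [w, if_pos hj]
      exact ((hF (x, u)).mono le_sup_left le_rfl).mul
        (((hclip x u).mono le_sup_right le_rfl).sub_const _)
    · simp only [w, if_neg hj]
      exact measurable_const
  have hnoise : ∀ ω x u, |unitClip (g k ω h x u) - M.φ x u ⬝ᵥ M.θg h| ≤ 2 := by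
    intro ω x u
    have h1 := abs_le.1 (abs_unitClip_le (g k ω h x u))
    have h2 := cost_mean_mem M h x u
    exact abs_le.2 ⟨by linarith [h2.1, h2.2], by linarith [h2.1, h2.2]⟩
  have hwb : ∀ ω j x u, |w ω j x u| ≤ C * 2 := by
    intro ω j x u
    have hC0 : 0 ≤ C := (abs_nonneg _).trans (hC (x, u) ω)
    by_cases hj : j = h
    · simp only [w, if_pos hj, abs_mul]
      exact mul_le_mul (hC _ _) (hnoise _ _ _) (abs_nonneg _) hC0
    · simp only [w, if_neg hj, abs_zero]
      positivity
  have htraj := hI.integral_trajectory hk hw hwb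
  let π : Ω → Fin H → S → A → ℝ := fun ω =>
    (learner M.toKnownPart p (observe s a g θf ω) k).policy
  have hπm : ∀ j x u, Measurable[𝓕 k] fun ω => π ω j x u := hI.measurable_policy hk.le
  have hπb : ∀ j x u ω, |π ω j x u| ≤ 1 := by
    intro j x u ω
    have hpos := fun u' => (learner_policy_pos M.toKnownPart p (observe s a g θf ω) hK k j x u').le
    rw [abs_of_nonneg (hpos u), ← learner_policy_sum M.toKnownPart p (observe s a g θf ω) hK k j x]
    exact Finset.single_le_sum (fun u' _ => hpos u') (Finset.mem_univ u)
  have hstart : 𝓕 k ⊔ MeasurableSpace.comap (g k) inferInstance ≤ mΩ :=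
    sup_le (𝓕.le k) (hI.measurable_g hk).comap_le
  have hvm : ∀ j x, Measurable fun ω => M.value (π ω) (w ω) j x := fun j x =>
    measurable_value M (fun j x u => (hπm j x u).mono (𝓕.le k) le_rfl)
      (fun j x u => (hw j x u).mono hstart le_rfl) j x
  have hvb : ∀ j x, ∃ B, ∀ ω, |M.value (π ω) (w ω) j x| ≤ B := fun j x =>
    ⟨_, fun ω => abs_value_le M (fun j x u => (learner_policy_pos _ p _ hK k j x u).le)
      (fun j x => learner_policy_sum _ p _ hK k j x) (hwb ω) j x⟩
  -- Unfolding the value recursion leaves past-measurable factors times the noise at deterministic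
  -- pairs, and each such term integrates to zero. The arbitrary past factor Z is needed because the
  -- policy multiplies it at every step.
  have hzero : ∀ (j : Fin (H + 1)) (x : S) (Z : Ω → ℝ), Measurable[𝓕 k] Z →
      (∃ B, ∀ ω, |Z ω| ≤ B) → ∫ ω, Z ω * M.value (π ω) (w ω) j x ∂μ = 0 := by
    intro j
    induction j using Fin.reverseInduction with
    | last => intro x Z _ _; simp [value_last]
    | cast j ih =>
      rintro x Z hZ ⟨B, hB⟩
      have hZπ : ∀ u, Measurable[𝓕 k] fun ω => Z ω * π ω j x u := fun u => hZ.mul (hπm j x u)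
      have hZπb : ∀ u ω, |Z ω * π ω j x u| ≤ B * 1 := by
        intro u ω
        rw [abs_mul]
        exact mul_le_mul (hB ω) (hπb _ _ _ _) (abs_nonneg _) ((abs_nonneg _).trans (hB ω))
      have hint : ∀ (Y f : Ω → ℝ), Measurable[𝓕 k] Y → (∃ B, ∀ ω, |Y ω| ≤ B) → Measurable f →
          (∃ B, ∀ ω, |f ω| ≤ B) → Integrable (fun ω => Y ω * f ω) μ := by
        rintro Y f hY ⟨B1, hB1⟩ hf ⟨B2, hB2⟩
        exact (integrable_of_abs_le (hY.mono (𝓕.le k) le_rfl) hB1).mul_bdd (c := B2)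
          hf.aestronglyMeasurable (ae_of_all _ hB2)
      have e1 : ∀ u, ∫ ω, Z ω * π ω j x u * w ω j x u ∂μ = 0 := by
        intro u
        by_cases hj : j = h
        · simp only [w, if_pos hj, ← mul_assoc]
          refine hI.integral_mul_cost_noise hk h x u ((hZπ u).mul (hF (x, u)))
            ⟨B * 1 * C, fun ω => ?_⟩
          rw [abs_mul]
          exact mul_le_mul (hZπb u ω) (hC _ _) (abs_nonneg _) ((abs_nonneg _).trans (hZπb u ω))
        · simp [w, if_neg hj]
      have e2 : ∀ u x', ∫ ω, Z ω * π ω j x u * M.P j x u x' * M.value (π ω) (w ω) j.succ x' ∂μ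
          = 0 := by
        intro u x'
        refine ih x' (fun ω => Z ω * π ω j x u * M.P j x u x') ((hZπ u).mul_const _)
          ⟨B * 1 * |M.P j x u x'|, fun ω => ?_⟩
        rw [abs_mul]
        exact mul_le_mul_of_nonneg_right (hZπb u ω) (abs_nonneg _)
      have i1 : ∀ u, Integrable (fun ω => Z ω * π ω j x u * w ω j x u) μ := fun u =>
        hint (fun ω => Z ω * π ω j x u) (fun ω => w ω j x u) (hZπ u) ⟨_, hZπb u⟩
          ((hw j x u).mono hstart le_rfl) ⟨_, fun ω => hwb ω j x u⟩
      have i2 : ∀ u x', Integrable (fun ω => Z ω * π ω j x u * M.P j x u x'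
          * M.value (π ω) (w ω) j.succ x') μ := fun u x' =>
        hint (fun ω => Z ω * π ω j x u * M.P j x u x') (fun ω => M.value (π ω) (w ω) j.succ x')
          ((hZπ u).mul_const _) ⟨B * 1 * |M.P j x u x'|, fun ω => by
            rw [abs_mul]
            exact mul_le_mul_of_nonneg_right (hZπb u ω) (abs_nonneg _)⟩ (hvm _ _) (hvb _ _)
      have hexp : ∀ ω, Z ω * M.value (π ω) (w ω) j.castSucc x
          = ∑ u, (Z ω * π ω j x u * w ω j x u
            + ∑ x', Z ω * π ω j x u * M.P j x u x' * M.value (π ω) (w ω) j.succ x') := by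
        intro ω
        rw [value_castSucc, Finset.mul_sum]
        refine Finset.sum_congr rfl fun u _ => ?_
        rw [mul_add, mul_add, Finset.mul_sum, Finset.mul_sum]
        congr 1
        · ring
        · exact Finset.sum_congr rfl fun _ _ => by ring
      have i3 : ∀ u, Integrable (fun ω => ∑ x', Z ω * π ω j x u * M.P j x u x'
          * M.value (π ω) (w ω) j.succ x') μ := fun u => integrable_finsetSum _ fun x' _ => i2 u x'
      have i4 : ∀ u, Integrable (fun ω => Z ω * π ω j x u * w ω j x u + ∑ x', Z ω * π ω j x u
          * M.P j x u x' * M.value (π ω) (w ω) j.succ x') μ := fun u => (i1 u).add (i3 u)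
      simp only [hexp]
      rw [integral_finsetSum _ fun u _ => i4 u]
      refine Finset.sum_eq_zero fun u _ => ?_
      rw [integral_add (i1 u) (i3 u), e1, integral_finsetSum _ fun x' _ => i2 u x']
      simp [e2]
  have h0 := hzero 0 M.s₁ (fun _ => 1) measurable_const ⟨1, fun _ => by simp⟩
  simp only [one_mul] at h0
  rw [h0] at htraj
  rw [htraj]
  refine integral_congr_ae (ae_of_all _ fun ω => ?_)
  simp [w]

/-- The conditional mean of the sum of the bonuses along an episode is their value. -/
theorem integral_mul_Wsum [Nonempty A] (hI : IsInteraction M p μ 𝓕 s a g θf) {k : ℕ}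
    (hk : k < p.K) {B : ℝ}
    (hB : ∀ o : Observations S A H d, ∀ h x u, |bonusW M.toKnownPart p o k h x u| ≤ B)
    {Z : Ω → ℝ} (hZ : Measurable[𝓕 k] Z) (hb : ∃ C, ∀ ω, |Z ω| ≤ C) :
    ∫ ω, Z ω * Wsum M.toKnownPart p (observe s a g θf ω) k ∂μ
      = ∫ ω, Z ω * M.value (learner M.toKnownPart p (observe s a g θf ω) k).policy
          (bonusW M.toKnownPart p (observe s a g θf ω) k) 0 M.s₁ ∂μ := by
  obtain ⟨C, hC⟩ := hb
  have hm := fun h x u => hI.measurable_bonusW hk.le h x u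
  have := hI.integral_trajectory hk
    -- A past-measurable Z may be included in the weight, and is pathwise a constant that factors
    -- out of the value.
    (w := fun ω h x u => Z ω * bonusW M.toKnownPart p (observe s a g θf ω) k h x u)
    (fun h x u => (hZ.mul (hm h x u)).mono le_sup_left le_rfl)
    (C := C * B) (fun ω h x u => by
      rw [abs_mul]
      exact mul_le_mul (hC ω) (hB _ _ _ _) (abs_nonneg _) ((abs_nonneg _).trans (hC ω)))
  simp only [value_const_mul, ← Finset.mul_sum] at this
  exact this.symm

end IsInteraction

/-! ### Stability of the value estimates in their parameters -/

section Stability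

/-- Valid for all reals, with the square root zero on negatives. This matters because rounding a
matrix to the grid can destroy positive semidefiniteness. -/
theorem abs_sqrt_sub_sqrt_le (x y : ℝ) : |√x - √y| ≤ √|x - y| := by
  have key : ∀ u v : ℝ, √u ≤ √v + √|u - v| := by
    intro u v
    rw [Real.sqrt_le_left (by positivity), add_sq, Real.sq_sqrt (abs_nonneg _)]
    have h1 : v ≤ √v ^ 2 := by
      rcases le_total 0 v with h | h
      · exact (Real.sq_sqrt h).ge
      · exact h.trans (sq_nonneg _)
    have h2 := le_abs_self (u - v)
    have h3 : 0 ≤ 2 * √v * √|u - v| := by positivity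
    linarith
  rw [abs_le]
  have h1 := key x y
  have h2 := key y x
  rw [abs_sub_comm y x] at h2
  constructor <;> linarith

theorem abs_sigmoid_sub_le (x y : ℝ) : |Real.sigmoid x - Real.sigmoid y| ≤ |x - y| := by
  have h := Convex.norm_image_sub_le_of_norm_deriv_le (f := Real.sigmoid) (C := 1)
    (s := Set.univ) (fun z _ => differentiableAt_sigmoid) (fun z _ => ?_) convex_univ
    (Set.mem_univ y) (Set.mem_univ x)
  · simpa using h
  · rw [Real.deriv_sigmoid, Real.norm_eq_abs, abs_of_nonneg
      (mul_nonneg (Real.sigmoid_nonneg z) (sub_nonneg.2 (Real.sigmoid_le_one z)))]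
    have h0 := Real.sigmoid_nonneg z
    have h1 := Real.sigmoid_le_one z
    nlinarith

/-- The quadratic form moves by at most d²ε, but the square root is only 1/2-Hölder. The loss of √ε
is why the mesh is later chosen as a square. -/
theorem abs_wnorm_sub_le {d : ℕ} {N N' : Matrix (Fin d) (Fin d) ℝ} {ε : ℝ} (hε : 0 ≤ ε)
    (h : ∀ i j, |N i j - N' i j| ≤ ε) {x : Fin d → ℝ} (hx : l2norm x ≤ 1) :
    |wnorm N x - wnorm N' x| ≤ d * √ε := by
  have hxi : ∀ i, |x i| ≤ 1 := fun i => (abs_le_l2norm x i).trans hx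
  have key : |x ⬝ᵥ N *ᵥ x - x ⬝ᵥ N' *ᵥ x| ≤ d ^ 2 * ε := by
    rw [← dotProduct_sub, ← sub_mulVec]
    simp only [dotProduct, mulVec]
    refine (Finset.abs_sum_le_sum_abs _ _).trans ?_
    calc ∑ i, |x i * ∑ j, (N - N') i j * x j| ≤ ∑ _i : Fin d, (d * ε : ℝ) := by
          refine Finset.sum_le_sum fun i _ => ?_
          rw [abs_mul]
          have h1 : |∑ j, (N - N') i j * x j| ≤ d * ε := by
            refine (Finset.abs_sum_le_sum_abs _ _).trans ?_
            calc ∑ j, |(N - N') i j * x j| ≤ ∑ _j : Fin d, ε := by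
                  refine Finset.sum_le_sum fun j _ => ?_
                  rw [abs_mul]
                  calc _ ≤ ε * 1 := mul_le_mul (h i j) (hxi j) (abs_nonneg _) hε
                    _ = ε := mul_one ε
              _ = d * ε := by simp
          calc _ ≤ 1 * (d * ε) := mul_le_mul (hxi i) h1 (abs_nonneg _) zero_le_one
            _ = _ := one_mul _
      _ = d ^ 2 * ε := by simp; ring
  refine (abs_sqrt_sub_sqrt_le _ _).trans ((Real.sqrt_le_sqrt key).trans_eq ?_)
  rw [Real.sqrt_mul (by positivity), Real.sqrt_sq (by positivity)]

variable {S A : Type*} [Fintype A] {H d : ℕ} (E : KnownPart S A d) (p : Params)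
  {N N' : Matrix (Fin d) (Fin d) ℝ} {s : S} {a : A}

theorem contraction_mem : contraction (H := H) E p N s a ∈ Set.Icc (0 : ℝ) 1 :=
  ⟨Real.sigmoid_nonneg _, Real.sigmoid_le_one _⟩

theorem abs_featPlus_le (hφ : l2norm (E.φ s a) ≤ 1) (hN : wnorm N (E.φ s a) ≤ 1)
    (i : Option (Fin d)) : |featPlus E p H N s a i| ≤ 1 := by
  obtain ⟨h0, h1⟩ := contraction_mem (H := H) E p (N := N) (s := s) (a := a)
  cases i with
  | some i =>
    rw [featPlus, abs_mul, abs_of_nonneg h0]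
    exact mul_le_one₀ h1 (abs_nonneg _) ((abs_le_l2norm _ i).trans hφ)
  | none =>
    rw [featPlus, abs_neg, abs_mul, abs_of_nonneg h0, abs_of_nonneg (wnorm_nonneg _ _)]
    exact mul_le_one₀ h1 (wnorm_nonneg _ _) hN

/-- The sigmoid is 1-Lipschitz, so a change ρ of the weighted norm moves the contraction by at most
β_w ρ; the bonus coordinate contributes one further ρ. -/
theorem abs_featPlus_sub_le (hφ : l2norm (E.φ s a) ≤ 1) (hN : wnorm N (E.φ s a) ≤ 1) {ρ : ℝ}
    (hρ : |wnorm N (E.φ s a) - wnorm N' (E.φ s a)| ≤ ρ) (hβ : 0 ≤ p.βw H d (Fintype.card A))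
    (i : Option (Fin d)) :
    |featPlus E p H N s a i - featPlus E p H N' s a i| ≤ (p.βw H d (Fintype.card A) + 1) * ρ := by
  have hρ0 : 0 ≤ ρ := (abs_nonneg _).trans hρ
  have hc : |contraction (H := H) E p N s a - contraction (H := H) E p N' s a|
      ≤ p.βw H d (Fintype.card A) * ρ := by
    refine (abs_sigmoid_sub_le _ _).trans ?_
    rw [add_sub_add_right_eq_sub, ← mul_sub, abs_mul, abs_neg, abs_of_nonneg hβ]
    gcongr
  have hc' := contraction_mem (H := H) E p (N := N') (s := s) (a := a)
  cases i with
  | some i =>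
    rw [featPlus, featPlus, ← sub_mul, abs_mul]
    calc _ ≤ p.βw H d (Fintype.card A) * ρ * 1 :=
          mul_le_mul hc ((abs_le_l2norm _ i).trans hφ) (abs_nonneg _) (by positivity)
      _ ≤ _ := by rw [mul_one]; gcongr; linarith
  | none =>
    have h1 : featPlus E p H N s a none - featPlus E p H N' s a none
        = -((contraction (H := H) E p N s a - contraction (H := H) E p N' s a) * wnorm N (E.φ s a)
          + contraction (H := H) E p N' s a * (wnorm N (E.φ s a) - wnorm N' (E.φ s a))) := by
      simp only [featPlus]; ring
    rw [h1, abs_neg]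
    refine (abs_add_le _ _).trans ?_
    rw [abs_mul, abs_mul, abs_of_nonneg (wnorm_nonneg N _), abs_of_nonneg hc'.1, add_mul]
    exact add_le_add ((mul_le_mul hc hN (wnorm_nonneg _ _) (by positivity)).trans_eq (mul_one _))
      (mul_le_mul hc'.2 hρ (abs_nonneg _) zero_le_one)

theorem abs_linQ_sub_le (hφ : l2norm (E.φ s a) ≤ 1) (hN : wnorm N (E.φ s a) ≤ 1) {ρ : ℝ}
    (hρ : |wnorm N (E.φ s a) - wnorm N' (E.φ s a)| ≤ ρ) (hβ : 0 ≤ p.βw H d (Fintype.card A))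
    {θ θ' : Option (Fin d) → ℝ} {R ε : ℝ} (hR : ∀ i, |θ i| ≤ R) (hε : ∀ i, |θ i - θ' i| ≤ ε)
    (hτ : (p.βw H d (Fintype.card A) + 1) * ρ ≤ 1) :
    |linQ E p H N θ s a - linQ E p H N' θ' s a|
      ≤ (d + 1) * (R * ((p.βw H d (Fintype.card A) + 1) * ρ) + ε * 2) := by
  have hR0 : 0 ≤ R := (abs_nonneg _).trans (hR none)
  have hε0 : 0 ≤ ε := (abs_nonneg _).trans (hε none)
  rw [linQ, linQ, ← Finset.sum_sub_distrib]
  refine (Finset.abs_sum_le_sum_abs _ _).trans ?_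
  calc _ ≤ ∑ _i : Option (Fin d), (R * ((p.βw H d (Fintype.card A) + 1) * ρ) + ε * 2) := by
        refine Finset.sum_le_sum fun i _ => ?_
        have h1 := abs_featPlus_sub_le E p hφ hN hρ hβ i
        have h2 := abs_featPlus_le (H := H) E p hφ hN i
        have h3 : |featPlus E p H N' s a i| ≤ 2 := by
          have e := abs_sub_abs_le_abs_sub (featPlus E p H N' s a i) (featPlus E p H N s a i)
          rw [abs_sub_comm] at e
          linarith
        have h4 : θ i * featPlus E p H N s a i - θ' i * featPlus E p H N' s a i
            = θ i * (featPlus E p H N s a i - featPlus E p H N' s a i)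
              + (θ i - θ' i) * featPlus E p H N' s a i := by ring
        rw [h4]
        refine (abs_add_le _ _).trans ?_
        rw [abs_mul, abs_mul]
        exact add_le_add (mul_le_mul (hR i) h1 (abs_nonneg _) hR0)
          (mul_le_mul (hε i) h3 (abs_nonneg _) hε0)
    _ = _ := by simp; ring

/-- The ratio of two policies is at most `exp t`, in both directions. -/
def RatioLE (t : ℝ) (π π' : S → A → ℝ) : Prop :=
  ∀ s a, π s a ≤ Real.exp t * π' s a ∧ π' s a ≤ Real.exp t * π s a

/-- Both policies receive the same nonnegative summand, which cannot enlarge the ratio. -/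
theorem ratioLE_mixUnif {p : Params} (hK : 0 < p.K) {t : ℝ} (ht : 0 ≤ t) {π π' : S → A → ℝ}
    (h : RatioLE t π π') : RatioLE t (mixUnif p π) (mixUnif p π') := by
  obtain ⟨h0, h1⟩ := theta_mem p hK
  have hc : p.θ * (Fintype.card A : ℝ)⁻¹ ≤ Real.exp t * (p.θ * (Fintype.card A : ℝ)⁻¹) :=
    le_mul_of_one_le_left (by positivity) (Real.one_le_exp ht)
  have key : ∀ x y : ℝ, x ≤ Real.exp t * y → (1 - p.θ) * x + p.θ * (Fintype.card A : ℝ)⁻¹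
      ≤ Real.exp t * ((1 - p.θ) * y + p.θ * (Fintype.card A : ℝ)⁻¹) := by
    intro x y hxy
    have := mul_le_mul_of_nonneg_left hxy (sub_nonneg.2 h1)
    linarith
  exact fun s a => ⟨key _ _ (h s a).1, key _ _ (h s a).2⟩

/-- Numerator and normalising sum each change by a factor at most exp(t + y), which explains the
doubling. -/
theorem ratioLE_expUpdate [Nonempty A] {t y : ℝ} {π π' f f' : S → A → ℝ}
    (hπ : ∀ s a, 0 < π s a) (hπ' : ∀ s a, 0 < π' s a) (h : RatioLE t π π')
    (hf : ∀ s a, |f s a - f' s a| ≤ y) :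
    RatioLE (2 * (t + y)) (expUpdate π f) (expUpdate π' f') := by
  have key : ∀ (π π' f f' : S → A → ℝ), (∀ s a, 0 < π s a) → (∀ s a, 0 < π' s a) →
      RatioLE t π π' → (∀ s a, |f s a - f' s a| ≤ y) → ∀ s a,
      expUpdate π f s a ≤ Real.exp (2 * (t + y)) * expUpdate π' f' s a := by
    intro π π' f f' hπ hπ' h hf s a
    have h1 : ∀ a, π s a * Real.exp (-f s a)
        ≤ Real.exp (t + y) * (π' s a * Real.exp (-f' s a)) := by
      intro a
      have e1 : Real.exp (-f s a) ≤ Real.exp y * Real.exp (-f' s a) := by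
        rw [← Real.exp_add]
        exact Real.exp_le_exp.2 (by linarith [(abs_le.1 (hf s a)).1])
      calc _ ≤ (Real.exp t * π' s a) * (Real.exp y * Real.exp (-f' s a)) :=
            mul_le_mul (h s a).1 e1 (Real.exp_pos _).le
              (mul_nonneg (Real.exp_pos _).le (hπ' s a).le)
        _ = _ := by rw [Real.exp_add]; ring
    have h2 : ∀ a, π' s a * Real.exp (-f' s a)
        ≤ Real.exp (t + y) * (π s a * Real.exp (-f s a)) := by
      intro a
      have e1 : Real.exp (-f' s a) ≤ Real.exp y * Real.exp (-f s a) := by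
        rw [← Real.exp_add]
        exact Real.exp_le_exp.2 (by linarith [(abs_le.1 (hf s a)).2])
      calc _ ≤ (Real.exp t * π s a) * (Real.exp y * Real.exp (-f s a)) :=
            mul_le_mul (h s a).2 e1 (Real.exp_pos _).le
              (mul_nonneg (Real.exp_pos _).le (hπ s a).le)
        _ = _ := by rw [Real.exp_add]; ring
    have s1 := expUpdate_sum_pos hπ f s
    have s2 := expUpdate_sum_pos hπ' f' s
    have h3 : ∑ a, π' s a * Real.exp (-f' s a)
        ≤ Real.exp (t + y) * ∑ a, π s a * Real.exp (-f s a) := by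
      rw [Finset.mul_sum]
      exact Finset.sum_le_sum fun a _ => h2 a
    rw [expUpdate, expUpdate, div_le_iff₀ s1, two_mul, Real.exp_add]
    have hnum : 0 ≤ π' s a * Real.exp (-f' s a) := mul_nonneg (hπ' s a).le (Real.exp_pos _).le
    calc π s a * Real.exp (-f s a) ≤ Real.exp (t + y) * (π' s a * Real.exp (-f' s a)) := h1 a
      _ = Real.exp (t + y) * (π' s a * Real.exp (-f' s a) / ∑ a, π' s a * Real.exp (-f' s a))
          * ∑ a, π' s a * Real.exp (-f' s a) := by field_simp
      _ ≤ Real.exp (t + y) * (π' s a * Real.exp (-f' s a) / ∑ a, π' s a * Real.exp (-f' s a))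
          * (Real.exp (t + y) * ∑ a, π s a * Real.exp (-f s a)) := by
          refine mul_le_mul_of_nonneg_left h3 ?_
          have := div_nonneg hnum s2.le
          positivity
      _ = _ := by ring
  exact fun s a => ⟨key π π' f f' hπ hπ' h hf s a, key π' π f' f hπ' hπ
    (fun s a => (h s a).symm) (fun s a => by rw [abs_sub_comm]; exact hf s a) s a⟩

/-- The exponent solves t_{n+1} = 2(t_n + y) with t_0 = 0. -/
theorem ratioLE_layerPolicy [Nonempty A] {p} (hK : 0 < p.K) {y : ℝ} (hy : 0 ≤ y)
    {θ θ' : ℕ → Option (Fin d) → ℝ} (n : ℕ)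
    (h : ∀ i < n, ∀ s a, |linQ E p H N (θ i) s a - linQ E p H N' (θ' i) s a| ≤ y) :
    RatioLE ((2 ^ (n + 1) - 2) * y) (layerPolicy E p H N θ n) (layerPolicy E p H N' θ' n) := by
  induction n with
  | zero => intro s a; simp [layerPolicy]
  | succ n ih =>
    have h1 := ih fun i hi => h i (by omega)
    have h0 : (0 : ℝ) ≤ (2 ^ (n + 1) - 2) * y := by
      have : (1 : ℝ) ≤ 2 ^ n := one_le_pow₀ one_le_two
      refine mul_nonneg ?_ hy
      rw [pow_succ]; linarith
    have h2 := ratioLE_expUpdate (mixUnif_pos hK (layerPolicy_pos E hK N θ n))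
      (mixUnif_pos hK (layerPolicy_pos E hK N' θ' n)) (ratioLE_mixUnif hK h0 h1)
      (h n (by omega))
    have h3 : 2 * ((2 ^ (n + 1) - 2) * y + y) = (2 ^ (n + 1 + 1) - 2) * y := by ring
    rw [h3] at h2
    exact h2

/-- For t ≤ 1 the ratio bound gives |π - π'| ≤ 2t(π + π') pointwise, so the ℓ¹ distance is at most
4t whatever the number of actions. -/
theorem abs_sum_policy_sub_le {t y C : ℝ} (ht0 : 0 ≤ t) (ht1 : t ≤ 1) {π π' q q' : S → A → ℝ}
    (hπ : ∀ s a, 0 < π s a) (hπ1 : ∀ s, ∑ a, π s a = 1)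
    (hπ' : ∀ s a, 0 < π' s a) (hπ1' : ∀ s, ∑ a, π' s a = 1) (h : RatioLE t π π')
    (hq : ∀ s a, |q s a - q' s a| ≤ y) (hC : ∀ s a, |q s a| ≤ C) (s : S) :
    |∑ a, π s a * q s a - ∑ a, π' s a * q' s a| ≤ 4 * t * C + y := by
  have he : Real.exp t - 1 ≤ 2 * t := by
    have := Real.abs_exp_sub_one_le (x := t) (by rwa [abs_of_nonneg ht0])
    rw [abs_of_nonneg ht0] at this
    exact (le_abs_self _).trans this
  have hd : ∀ a, |π s a - π' s a| ≤ 2 * t * (π s a + π' s a) := by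
    intro a
    obtain ⟨h1, h2⟩ := h s a
    have e1 := mul_le_mul_of_nonneg_right he (hπ s a).le
    have e2 := mul_le_mul_of_nonneg_right he (hπ' s a).le
    have e3 : 0 ≤ 2 * t * π s a := mul_nonneg (by linarith) (hπ s a).le
    have e4 : 0 ≤ 2 * t * π' s a := mul_nonneg (by linarith) (hπ' s a).le
    rw [abs_le]
    constructor <;> linarith
  rw [← Finset.sum_sub_distrib]
  refine (Finset.abs_sum_le_sum_abs _ _).trans ?_
  calc _ ≤ ∑ a, (2 * t * (π s a + π' s a) * C + π' s a * y) := by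
        refine Finset.sum_le_sum fun a _ => ?_
        have e : π s a * q s a - π' s a * q' s a
            = (π s a - π' s a) * q s a + π' s a * (q s a - q' s a) := by ring
        rw [e]
        refine (abs_add_le _ _).trans ?_
        rw [abs_mul, abs_mul, abs_of_pos (hπ' s a)]
        exact add_le_add (mul_le_mul (hd a) (hC s a) (abs_nonneg _)
          ((abs_nonneg _).trans (hd a))) (mul_le_mul_of_nonneg_left (hq s a) (hπ' s a).le)
    _ = _ := by
        rw [Finset.sum_add_distrib, ← Finset.sum_mul, ← Finset.sum_mul, ← Finset.mul_sum,
          Finset.sum_add_distrib, hπ1, hπ1']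
        ring

end Stability

/-! ### A finite net of value functions -/

section Net

variable {S A : Type*} [Fintype A] {H d : ℕ} (E : KnownPart S A d) (p : Params)

/-- Index set of the parameters of a value estimate with at most `m` policy layers. -/
abbrev ParamIdx (d m : ℕ) : Type := (Fin d × Fin d) ⊕ (Fin (m + 1) × Option (Fin d))

/-- Matrix parameter of a grid point. -/
def gridMatrix {m : ℕ} (ε : ℝ) (z : ParamIdx d m → ℤ) : Matrix (Fin d) (Fin d) ℝ :=
  fun i j => ε * z (Sum.inl (i, j))

/-- Layer parameters of a grid point. -/
def gridTheta {m : ℕ} (ε : ℝ) (z : ParamIdx d m → ℤ) (i : ℕ) (j : Option (Fin d)) : ℝ :=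
  if hi : i < m + 1 then ε * z (Sum.inr (⟨i, hi⟩, j)) else 0

/-- Value function of a grid point with `n` policy layers. -/
def gridValue (H : ℕ) {m : ℕ} (ε : ℝ) (n : ℕ) (z : ParamIdx d m → ℤ) (s : S) : ℝ :=
  clip H (∑ a, layerPolicy E p H (gridMatrix ε z) (gridTheta ε z) n s a
    * linQ E p H (gridMatrix ε z) (gridTheta ε z m) s a)

theorem card_paramIdx (d m : ℕ) : Fintype.card (ParamIdx d m) = d * d + (m + 1) * (d + 1) := by
  simp [ParamIdx]

theorem exists_int_mul_near {ε R : ℝ} (hε : 0 < ε) {L : ℕ} (hL : R ≤ L * ε) {x : ℝ} (hx : |x| ≤ R) :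
    ∃ z ∈ Finset.Icc (-(L : ℤ)) L, |x - ε * z| ≤ ε := by
  obtain ⟨h1, h2⟩ := abs_le.1 hx
  have hf := Int.floor_le (x / ε)
  have hf' := Int.lt_floor_add_one (x / ε)
  rw [le_div_iff₀ hε] at hf
  rw [div_lt_iff₀ hε] at hf'
  refine ⟨⌊x / ε⌋, Finset.mem_Icc.2 ⟨?_, ?_⟩, abs_le.2 ⟨?_, ?_⟩⟩
  · rw [Int.le_floor, le_div_iff₀ hε]
    push_cast
    linarith
  · have : (⌊x / ε⌋ : ℝ) ≤ L := by
      refine (Int.floor_le _).trans ?_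
      rw [div_le_iff₀ hε]
      linarith
    exact_mod_cast this
  · linarith
  · linarith

/-- Every value estimate with bounded parameters is close to a grid value function. -/
theorem exists_gridValue_near [Nonempty A] (hK : 0 < p.K) (hφ : ∀ s a, l2norm (E.φ s a) ≤ 1)
    (hβ : 0 ≤ p.βw H d (Fintype.card A)) {N : Matrix (Fin d) (Fin d) ℝ}
    (hN : ∀ s a, wnorm N (E.φ s a) ≤ 1) {m n : ℕ} (hn : n ≤ m) {ε R : ℝ} (hε : 0 < ε) {L : ℕ}
    (hL : R ≤ L * ε) (hNR : ∀ i j, |N i j| ≤ R) {θ : ℕ → Option (Fin d) → ℝ}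
    (hθ : ∀ i j, |θ i j| ≤ R) {θQ : Option (Fin d) → ℝ} (hθQ : ∀ j, |θQ j| ≤ R)
    (hτ : (p.βw H d (Fintype.card A) + 1) * (d * √ε) ≤ 1) {y : ℝ}
    (hy : (d + 1) * (R * ((p.βw H d (Fintype.card A) + 1) * (d * √ε)) + ε * 2) ≤ y)
    (hy1 : 2 ^ (m + 1) * y ≤ 1) (hQ : ∀ s a, |linQ E p H N θQ s a| ≤ H) :
    ∃ z ∈ Fintype.piFinset fun _ : ParamIdx d m => Finset.Icc (-(L : ℤ)) L, ∀ s,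
      |∑ a, layerPolicy E p H N θ n s a * linQ E p H N θQ s a - gridValue E p H ε n z s|
        ≤ 4 * (2 ^ (m + 1) * y) * H + y := by
  -- Slot m stores the coefficients of the Q-estimate. There is no clash, since the n ≤ m layers
  -- occupy slots below m.
  let x : ParamIdx d m → ℝ := Sum.elim (fun q => N q.1 q.2)
    fun q => if (q.1 : ℕ) = m then θQ q.2 else θ q.1 q.2
  have hx : ∀ q, |x q| ≤ R := by
    rintro (q | q)
    · exact hNR _ _
    · simp only [x, Sum.elim_inr]
      split_ifs
      · exact hθQ _
      · exact hθ _ _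
  choose z hz hzx using fun q => exists_int_mul_near hε hL (hx q)
  refine ⟨z, Fintype.mem_piFinset.2 hz, ?_⟩
  have hρ : ∀ s a, |wnorm N (E.φ s a) - wnorm (gridMatrix ε z) (E.φ s a)| ≤ d * √ε :=
    fun s a => abs_wnorm_sub_le hε.le (fun i j => hzx (Sum.inl (i, j))) (hφ s a)
  have hlin : ∀ i < m, ∀ s a, |linQ E p H N (θ i) s a
      - linQ E p H (gridMatrix ε z) (gridTheta ε z i) s a| ≤ y := by
    intro i hi s a
    refine (abs_linQ_sub_le E p (hφ s a) (hN s a) (hρ s a) hβ (hθ i) (fun j => ?_) hτ).trans hy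
    have h1 := hzx (Sum.inr (⟨i, by omega⟩, j))
    simp only [x, Sum.elim_inr, if_neg hi.ne] at h1
    rwa [gridTheta, dif_pos (by omega)]
  have hlinQ : ∀ s a, |linQ E p H N θQ s a
      - linQ E p H (gridMatrix ε z) (gridTheta ε z m) s a| ≤ y := by
    intro s a
    refine (abs_linQ_sub_le E p (hφ s a) (hN s a) (hρ s a) hβ hθQ (fun j => ?_) hτ).trans hy
    have h1 := hzx (Sum.inr (⟨m, by omega⟩, j))
    simp only [x, Sum.elim_inr, if_true] at h1
    rwa [gridTheta, dif_pos (by omega)]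
  have hR : 0 ≤ R := (abs_nonneg _).trans (hθQ none)
  have hy0 : 0 ≤ y := le_trans (by positivity) hy
  have h2n : (2 : ℝ) ^ (n + 1) ≤ 2 ^ (m + 1) := pow_le_pow_right₀ one_le_two (by omega)
  have h2n' : (2 : ℝ) ≤ 2 ^ (n + 1) := by
    rw [pow_succ]; linarith [one_le_pow₀ (M₀ := ℝ) one_le_two (n := n)]
  have ht : (2 ^ (n + 1) - 2) * y ≤ 2 ^ (m + 1) * y := by gcongr; linarith
  have hratio := ratioLE_layerPolicy E hK hy0 n fun i hi => hlin i (by omega)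
  intro s
  have hclip : |∑ a, layerPolicy E p H N θ n s a * linQ E p H N θQ s a| ≤ H := by
    refine (Finset.abs_sum_le_sum_abs _ _).trans ?_
    calc _ ≤ ∑ a, layerPolicy E p H N θ n s a * (H : ℝ) := by
          refine Finset.sum_le_sum fun a _ => ?_
          have := layerPolicy_pos (H := H) E hK N θ n s a
          rw [abs_mul, abs_of_pos this]
          gcongr
          exact hQ s a
      _ = H := by rw [← Finset.sum_mul, layerPolicy_sum E hK, one_mul]
  rw [gridValue]
  -- Clipping does not alter the estimate itself and is 1-Lipschitz, yet it makes every net function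
  -- bounded by H, as the noise bound on the net requires.
  nth_rewrite 1 [← clip_eq_self hclip]
  refine (abs_clip_sub_clip_le _ _ _).trans ?_
  refine (abs_sum_policy_sub_le (mul_nonneg (by linarith) hy0) (ht.trans hy1)
    (layerPolicy_pos E hK N θ n) (layerPolicy_sum E hK N θ n)
    (layerPolicy_pos E hK _ _ n) (layerPolicy_sum E hK _ _ n) hratio hlinQ hQ s).trans ?_
  gcongr

theorem abs_gridValue_le {m : ℕ} (ε : ℝ) (n : ℕ) (z : ParamIdx d m → ℤ) (s : S) :
    |gridValue E p H ε n z s| ≤ H := abs_clip_le (Nat.cast_nonneg H) _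

end Net

/-! ### Boundedness of the estimates under concentration on the net -/

section Ridge

variable {d : ℕ} (x : ℕ → Fin d → ℝ)

theorem gram_mulVec (k : ℕ) (θ : Fin d → ℝ) :
    gram x k *ᵥ θ = θ + ∑ τ ∈ Finset.range k, (x τ ⬝ᵥ θ) • x τ := by
  induction k with
  | zero => simp [gram_zero]
  | succ k ih =>
    rw [gram_succ, add_mulVec, ih, Finset.sum_range_succ, vecMulVec_mulVec, add_assoc]
    simp

/-- Error of ridge regression in terms of the accumulated noise. -/
theorem wnorm_sub_ridge_le (k : ℕ) (θ : Fin d → ℝ) (c : ℕ → ℝ) :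
    wnorm (gram x k) (θ - (gram x k)⁻¹ *ᵥ ∑ τ ∈ Finset.range k, c τ • x τ)
      ≤ l2norm θ
        + wnorm (gram x k)⁻¹ (∑ τ ∈ Finset.range k, (c τ - x τ ⬝ᵥ θ) • x τ) := by
  have h1 : θ = (gram x k)⁻¹ *ᵥ (gram x k *ᵥ θ) := by
    rw [mulVec_mulVec, nonsing_inv_mul _ (gram_isUnit_det x k), one_mulVec]
  have h2 : θ - (gram x k)⁻¹ *ᵥ ∑ τ ∈ Finset.range k, c τ • x τ
      = (gram x k)⁻¹ *ᵥ (θ - ∑ τ ∈ Finset.range k, (c τ - x τ ⬝ᵥ θ) • x τ) := by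
    nth_rewrite 1 [h1]
    rw [← mulVec_sub, gram_mulVec]
    congr 1
    simp only [sub_smul, Finset.sum_sub_distrib]
    abel
  rw [h2, wnorm_inv_mulVec (gram_posDef x k)]
  refine (wnorm_sub_le (gram_inv_posSemidef x k) _ _).trans ?_
  gcongr
  exact wnorm_gram_inv_le x k θ

theorem wnorm_gram_inv_sum_le (hx : ∀ τ, l2norm (x τ) ≤ 1) (k : ℕ) {c : ℕ → ℝ} {C : ℝ}
    (hc : ∀ τ < k, |c τ| ≤ C) :
    wnorm (gram x k)⁻¹ (∑ τ ∈ Finset.range k, c τ • x τ) ≤ k * C := by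
  refine (wnorm_sum_le (gram_inv_posSemidef x k) _ _).trans ?_
  calc _ ≤ ∑ _τ ∈ Finset.range k, C := by
        refine Finset.sum_le_sum fun τ hτ => ?_
        rw [wnorm_smul]
        have h1 := (wnorm_gram_inv_le x k (x τ)).trans (hx τ)
        have h2 := hc τ (Finset.mem_range.1 hτ)
        calc _ ≤ C * 1 := mul_le_mul h2 h1 (wnorm_nonneg _ _) ((abs_nonneg _).trans h2)
          _ = C := mul_one C
    _ = k * C := by simp

theorem l2norm_sum_le (hx : ∀ τ, l2norm (x τ) ≤ 1) (k : ℕ) {c : ℕ → ℝ} {C : ℝ}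
    (hc : ∀ τ < k, |c τ| ≤ C) : l2norm (∑ τ ∈ Finset.range k, c τ • x τ) ≤ k * C := by
  rw [← wnorm_one]
  refine (wnorm_sum_le PosSemidef.one _ _).trans ?_
  calc _ ≤ ∑ _τ ∈ Finset.range k, C := by
        refine Finset.sum_le_sum fun τ hτ => ?_
        rw [wnorm_smul, wnorm_one]
        have h2 := hc τ (Finset.mem_range.1 hτ)
        calc _ ≤ C * 1 := mul_le_mul h2 (hx τ) (l2norm_nonneg _) ((abs_nonneg _).trans h2)
          _ = C := mul_one C
    _ = k * C := by simp

theorem l2norm_mono {x y : Fin d → ℝ} (h : ∀ i, |x i| ≤ y i) : l2norm x ≤ l2norm y := by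
  rw [l2norm_eq_sqrt, l2norm_eq_sqrt]
  refine Real.sqrt_le_sqrt (Finset.sum_le_sum fun i _ => ?_)
  rw [← abs_mul_abs_self (x i)]
  exact mul_self_le_mul_self (abs_nonneg _) (h i)

theorem l2norm_smul (c : ℝ) (x : Fin d → ℝ) : l2norm (c • x) = |c| * l2norm x := by
  rw [← wnorm_one, wnorm_smul, wnorm_one]

end Ridge

/-! ### Ridge regression for the transition operators -/

section Transition

variable {S A : Type*} [Fintype S] {H d : ℕ} (M : LinearCMDP S A H d)

/-- Linearity of the kernel makes the expected next value linear in the feature, so estimating ψ_h V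
is a ridge regression with response V at the next state. -/
theorem phi_dotProduct_psiOp (h : Fin H) (V : S → ℝ) (s : S) (a : A) :
    M.φ s a ⬝ᵥ M.psiOp h V = ∑ x, M.P h s a x * V x := by
  rw [LinearCMDP.psiOp, dotProduct_sum]
  refine Finset.sum_congr rfl fun x _ => ?_
  rw [dotProduct_smul, ← M.P_linear, smul_eq_mul, mul_comm]

theorem l2norm_psiOp_le (h : Fin H) {V : S → ℝ} {C : ℝ} (hC : 0 ≤ C) (hV : ∀ s, |V s| ≤ C) :
    l2norm (M.psiOp h V) ≤ C * √d := by
  calc l2norm (M.psiOp h V) ≤ l2norm (C • fun i => ∑ s', |M.ψ h s' i|) := by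
        refine l2norm_mono fun i => ?_
        simp only [LinearCMDP.psiOp, Finset.sum_apply, Pi.smul_apply, smul_eq_mul, Finset.mul_sum]
        refine (Finset.abs_sum_le_sum_abs _ _).trans (Finset.sum_le_sum fun x _ => ?_)
        rw [abs_mul]
        exact mul_le_mul_of_nonneg_right (hV x) (abs_nonneg _)
    _ ≤ C * √d := by
        rw [l2norm_smul, abs_of_nonneg hC]
        exact mul_le_mul_of_nonneg_left (M.ψ_norm h) hC

theorem abs_transition_le (h : Fin H) {V : S → ℝ} {C : ℝ} (hV : ∀ s, |V s| ≤ C) (s : S) (a : A) :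
    |∑ x, M.P h s a x * V x| ≤ C := by
  refine (Finset.abs_sum_le_sum_abs _ _).trans ?_
  calc _ ≤ ∑ x, M.P h s a x * C := by
        refine Finset.sum_le_sum fun x _ => ?_
        rw [abs_mul, abs_of_nonneg (M.P_nonneg h s a x)]
        exact mul_le_mul_of_nonneg_left (hV x) (M.P_nonneg h s a x)
    _ = C := by rw [← Finset.sum_mul, M.P_sum, one_mul]

/-- Accumulated transition noise for the value function `V`. -/
def transitionNoise (o : Observations S A H d) (k : ℕ) (h : Fin H) (V : S → ℝ) : Fin d → ℝ :=
  ∑ τ ∈ Finset.range k, (V (o.s τ h.succ)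
    - ∑ x, M.P h (o.s τ h.castSucc) (o.a τ h) x * V x) • visited M.toKnownPart o τ h

theorem l2norm_visited_le (o : Observations S A H d) (τ : ℕ) (h : Fin H) :
    l2norm (visited M.toKnownPart o τ h) ≤ 1 := M.φ_norm _ _

theorem wnorm_psiOp_sub_psiHat_le (o : Observations S A H d) (k : ℕ) (h : Fin H) (V : S → ℝ) :
    wnorm (design M.toKnownPart o k h) (M.psiOp h V - psiHat M.toKnownPart o k h V)
      ≤ l2norm (M.psiOp h V)
        + wnorm (design M.toKnownPart o k h)⁻¹ (transitionNoise M o k h V) := by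
  have := wnorm_sub_ridge_le (fun τ => visited M.toKnownPart o τ h) k (M.psiOp h V)
    fun τ => V (o.s τ h.succ)
  simp only [visited, phi_dotProduct_psiOp] at this
  exact this

/-- Replacing V by a nearby function moves each noise term by at most 2ε, and each feature has
weighted norm at most 1. Thus the net transfers its bound to the data-dependent estimate. -/
theorem wnorm_transitionNoise_le (o : Observations S A H d) (k : ℕ) (h : Fin H) {V V' : S → ℝ}
    {ε : ℝ} (hV : ∀ s, |V s - V' s| ≤ ε) :
    wnorm (design M.toKnownPart o k h)⁻¹ (transitionNoise M o k h V)
      ≤ wnorm (design M.toKnownPart o k h)⁻¹ (transitionNoise M o k h V') + k * (2 * ε) := by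
  have h1 : transitionNoise M o k h V = transitionNoise M o k h V'
      + transitionNoise M o k h (fun s => V s - V' s) := by
    rw [transitionNoise, transitionNoise, transitionNoise, ← Finset.sum_add_distrib]
    refine Finset.sum_congr rfl fun τ _ => ?_
    rw [← add_smul]
    simp only [mul_sub, Finset.sum_sub_distrib]
    congr 1
    ring
  rw [h1]
  refine (wnorm_add_le (gram_inv_posSemidef _ k) _ _).trans (add_le_add le_rfl ?_)
  refine wnorm_gram_inv_sum_le _ (l2norm_visited_le M o · h) k fun τ _ => ?_
  refine (abs_sub _ _).trans ?_
  rw [two_mul]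
  exact add_le_add (hV _) (abs_transition_le M h hV _ _)

end Transition

/-! ### Effect of the sigmoid contraction in one Bellman step -/

section OneStep

/-- For wx ≤ 2L the sigmoid is bounded by 1. Beyond that it is at most exp(-wx/2), and y exp(-y) ≤ 1
gives the bound 2 ≤ 2L. -/
theorem mul_sigmoid_le {L w x : ℝ} (hL : 1 ≤ L) (hw : 0 < w) (hx : 0 ≤ x) :
    Real.sigmoid (-w * x + L) * x ≤ 2 * L / w := by
  rw [le_div_iff₀ hw]
  rcases le_total (w * x) (2 * L) with h | h
  · calc _ = Real.sigmoid (-w * x + L) * (w * x) := by ring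
      _ ≤ 1 * (w * x) := mul_le_mul_of_nonneg_right (Real.sigmoid_le_one _) (by positivity)
      _ ≤ 2 * L := by rwa [one_mul]
  · have h1 : Real.sigmoid (-w * x + L) ≤ Real.exp (-w * x + L) := by
      rw [Real.sigmoid_def, inv_le_comm₀ (by positivity) (Real.exp_pos _), ← Real.exp_neg]
      linarith
    have h2 : Real.exp (-w * x + L) ≤ Real.exp (-(w * x / 2)) := Real.exp_le_exp.2 (by linarith)
    have h3 : w * x / 2 * Real.exp (-(w * x / 2)) ≤ 1 := by
      rw [Real.exp_neg, ← div_eq_mul_inv, div_le_one (Real.exp_pos _)]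
      linarith [Real.add_one_le_exp (w * x / 2)]
    calc _ = Real.sigmoid (-w * x + L) * (w * x) := by ring
      _ ≤ Real.exp (-(w * x / 2)) * (w * x) :=
        mul_le_mul_of_nonneg_right (h1.trans h2) (by positivity)
      _ ≤ 2 * L := by linarith

variable {S A : Type*} [Fintype S] [Fintype A] {H d : ℕ} (M : LinearCMDP S A H d) (p : Params)
  {o : Observations S A H d}

/-- One step of the backward recursion enlarges the bound on the value estimate by at most one. -/
theorem abs_qStep_le (hβr : 0 ≤ p.βr H d) (hβp : 0 ≤ p.βp H d (Fintype.card A))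
    (hβw : 0 < p.βw H d (Fintype.card A)) (hlog : 1 ≤ Real.log p.K) {ke k : ℕ} (hke : ke ≤ k)
    (l : Kind) (h : Fin H) {V : S → ℝ} {C : ℝ} (hC : 0 ≤ C) (hV : ∀ s, |V s| ≤ C)
    {θ : Fin d → ℝ} (hθ : ∀ s a, M.φ s a ⬝ᵥ θ ∈ Set.Icc (0 : ℝ) 1)
    (hθ' : wnorm (design M.toKnownPart o k h) (θ - thetaHat M.toKnownPart o k h l) ≤ p.βr H d)
    (hψ : wnorm (design M.toKnownPart o k h) (M.psiOp h V - psiHat M.toKnownPart o k h V)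
      ≤ p.βp H d (Fintype.card A)) (s : S) (a : A) :
    |qStep M.toKnownPart p o ke k l h V s a| ≤ 1 + C := by
  set Λ := design M.toKnownPart o k h with hΛ
  set N := (design M.toKnownPart o ke h)⁻¹ with hN
  set σ := Real.sigmoid (-p.βw H d (Fintype.card A) * wnorm N (M.φ s a) + Real.log p.K) with hσ
  have hσ0 : 0 ≤ σ := Real.sigmoid_nonneg _
  have hσ1 : σ ≤ 1 := Real.sigmoid_le_one _
  have hx0 : 0 ≤ wnorm N (M.φ s a) := wnorm_nonneg _ _
  have hcon : contracted M.toKnownPart p o ke h s a = σ • M.φ s a := rfl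
  have hb0 : 0 ≤ p.βb H d (Fintype.card A) := add_nonneg hβr hβp
  set err := (θ - thetaHat M.toKnownPart o k h l)
    + (M.psiOp h V - psiHat M.toKnownPart o k h V) with herr
  have herrn : wnorm Λ err ≤ p.βb H d (Fintype.card A) :=
    (wnorm_add_le (gram_posDef _ k).posSemidef _ _).trans (add_le_add hθ' hψ)
  have hdot : |M.φ s a ⬝ᵥ err| ≤ p.βb H d (Fintype.card A) * wnorm N (M.φ s a) := by
    have hΛ' : Λ.PosDef := gram_posDef _ k
    refine (abs_dotProduct_le_wnorm_mul hΛ' _ _).trans ?_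
    rw [mul_comm]
    exact mul_le_mul herrn (wnorm_gram_inv_antitone _ _ hke) (wnorm_nonneg _ _) hb0
  -- The contracted Bellman target under the true parameters, minus contracted error plus bonus. The
  -- bonus dominates the error, so the second bracket lies between 0 and 2β_b‖φ‖.
  have hsplit : qStep M.toKnownPart p o ke k l h V s a
      = σ * (M.φ s a ⬝ᵥ θ + ∑ x, M.P h s a x * V x)
        - σ * (M.φ s a ⬝ᵥ err + p.βb H d (Fintype.card A) * wnorm N (M.φ s a)) := by
    rw [qStep, hcon, wnorm_smul, abs_of_nonneg hσ0, ← phi_dotProduct_psiOp, herr]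
    simp only [smul_dotProduct, dotProduct_add, dotProduct_sub, smul_eq_mul]
    ring
  have hP := abs_le.1 (abs_transition_le M h hV s a)
  have hr := hθ s a
  have hd := abs_le.1 hdot
  have hup : σ * (M.φ s a ⬝ᵥ θ + ∑ x, M.P h s a x * V x) ≤ 1 + C := by
    calc _ ≤ σ * (1 + C) := mul_le_mul_of_nonneg_left (add_le_add hr.2 hP.2) hσ0
      _ ≤ 1 * (1 + C) := mul_le_mul_of_nonneg_right hσ1 (by linarith)
      _ = _ := one_mul _
  have hlow : -C ≤ σ * (M.φ s a ⬝ᵥ θ + ∑ x, M.P h s a x * V x) := by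
    have h1 : σ * C ≤ C := mul_le_of_le_one_left hC hσ1
    have h2 : σ * -C ≤ σ * (M.φ s a ⬝ᵥ θ + ∑ x, M.P h s a x * V x) :=
      mul_le_mul_of_nonneg_left (by linarith [hr.1, hP.1]) hσ0
    linarith
  have hb1 : 0 ≤ σ * (M.φ s a ⬝ᵥ err + p.βb H d (Fintype.card A) * wnorm N (M.φ s a)) :=
    mul_nonneg hσ0 (by linarith [hd.1])
  -- The choice β_w = 4β_b log K is exactly what makes 2β_b · 2 log K / β_w equal to 1.
  have hb2 : σ * (M.φ s a ⬝ᵥ err + p.βb H d (Fintype.card A) * wnorm N (M.φ s a)) ≤ 1 := by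
    have h1 := mul_sigmoid_le hlog hβw hx0
    rw [← hσ] at h1
    have hbpos : 0 < p.βb H d (Fintype.card A) := by
      refine hb0.lt_of_ne fun e => hβw.ne' ?_
      rw [Params.βw, ← e]; ring
    calc _ ≤ σ * (2 * p.βb H d (Fintype.card A) * wnorm N (M.φ s a)) :=
          mul_le_mul_of_nonneg_left (by linarith [hd.2]) hσ0
      _ = 2 * p.βb H d (Fintype.card A) * (σ * wnorm N (M.φ s a)) := by ring
      _ ≤ 2 * p.βb H d (Fintype.card A) * (2 * Real.log p.K / p.βw H d (Fintype.card A)) := by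
          gcongr
      _ = 1 := by
          rw [Params.βw]
          have : Real.log p.K ≠ 0 := by linarith
          field_simp
          norm_num
  rw [hsplit, abs_le]
  constructor <;> linarith

end OneStep

/-! ### Induction over episodes and steps -/

section Bounded

variable {S A : Type*} [Fintype S] [Fintype A] {H d : ℕ} (M : LinearCMDP S A H d) (p : Params)
  {o : Observations S A H d}

/-- A crude polynomial bound is enough: the range of the grid enters the confidence radius only
through its logarithm. -/
theorem abs_qParam_le {k : ℕ} {h : Fin H} {V : S → ℝ} (hk : k ≤ p.K)
    (hH : 1 ≤ H) (hβ0 : 0 ≤ p.βb H d (Fintype.card A)) (hβ : p.βb H d (Fintype.card A) ≤ p.K)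
    (hdK : √d ≤ p.K) (hc : ∀ τ < k, |o.c τ h| ≤ 1) (hf : l2norm (o.θf k h) ≤ √d)
    (hV : ∀ s, |V s| ≤ H) (l : Kind) (i : Option (Fin d)) :
    |qParam M.toKnownPart p o k l h V i| ≤ p.K + p.K * H := by
  have hkK : (k : ℝ) ≤ p.K := by exact_mod_cast hk
  have hH' : (1 : ℝ) ≤ H := by exact_mod_cast hH
  have hψ : ∀ i, |psiHat M.toKnownPart o k h V i| ≤ p.K * H := fun i =>
    (abs_gram_inv_mulVec_le _ k _ i).trans
      ((l2norm_sum_le _ (l2norm_visited_le M o · h) k fun τ _ => hV _).trans (by gcongr))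
  have hθ : ∀ i, |thetaHat M.toKnownPart o k h l i| ≤ p.K := by
    intro i
    cases l with
    | f => exact (abs_le_l2norm _ i).trans (hf.trans hdK)
    | g =>
      exact (abs_gram_inv_mulVec_le _ k _ i).trans
        ((l2norm_sum_le _ (l2norm_visited_le M o · h) k hc).trans (by rwa [mul_one]))
  cases i with
  | some i => exact (abs_add_le _ _).trans (add_le_add (hθ i) (hψ i))
  | none =>
    rw [qParam, abs_of_nonneg hβ0]
    have : (0 : ℝ) ≤ p.K * H := by positivity
    linarith

theorem abs_sum_policy_mul_le {π q : A → ℝ} {C : ℝ} (hπ : ∀ a, 0 ≤ π a) (hπ1 : ∑ a, π a = 1)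
    (hq : ∀ a, |q a| ≤ C) : |∑ a, π a * q a| ≤ C := by
  refine (Finset.abs_sum_le_sum_abs _ _).trans ?_
  calc _ ≤ ∑ a, π a * C := by
        refine Finset.sum_le_sum fun a _ => ?_
        rw [abs_mul, abs_of_nonneg (hπ a)]
        exact mul_le_mul_of_nonneg_left (hq a) (hπ a)
    _ = C := by rw [← Finset.sum_mul, hπ1, one_mul]

/-- Since Y and b are nonnegative, the regularisation and all drift terms only decrease Y, leaving
the increment η V̂ ≤ ηH. -/
theorem learner_Y_succ_le {k : ℕ} (hα : 0 ≤ p.α) (hη : 0 ≤ p.η)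
    (hV : |Vhat M.toKnownPart p o k .g 0 M.s₁| ≤ H) :
    (learner M.toKnownPart p o (k + 1)).Y
      ≤ (learner M.toKnownPart p o k).Y + p.η * H := by
  have hY := learner_Y_nonneg M.toKnownPart p o k
  have hH : (0 : ℝ) ≤ p.η * H := by positivity
  rcases learner_succ M.toKnownPart p o k with h' | h' <;> rw [h']
  · change (0 : ℝ) ≤ _
    linarith
  · change max 0 _ ≤ _
    refine max_le (by linarith) ?_
    have h1 : (1 - 4 * p.α * p.η * H ^ 3) * (learner M.toKnownPart p o k).Y
        ≤ (learner M.toKnownPart p o k).Y := by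
      refine mul_le_of_le_one_left hY ?_
      have : 0 ≤ 4 * p.α * p.η * (H : ℝ) ^ 3 := by positivity
      linarith
    have hθ : 0 ≤ p.θ := by unfold Params.θ; positivity
    have h2 : p.η * (vEst M.toKnownPart p o (learner M.toKnownPart p o k) k .g 0 M.s₁ - M.b
        - 4 * p.α * H ^ 3 - 4 * p.θ * H ^ 2) ≤ p.η * H := by
      refine mul_le_mul_of_nonneg_left ?_ hη
      have e1 := (abs_le.1 hV).2
      rw [Vhat] at e1
      have e2 : 0 ≤ 4 * p.α * (H : ℝ) ^ 3 := by positivity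
      have e3 : 0 ≤ 4 * p.θ * (H : ℝ) ^ 2 := by positivity
      linarith [M.b_mem.1]
    linarith

/-- Scale of the coefficients of the value estimates. -/
def coeffBound (p : Params) (H : ℕ) : ℝ := p.K * ((1 + H * p.K) * (p.K + p.K * H))

/-- If the transition noise is small for all value functions of the net, then the transition
estimates are accurate for the value estimates of the algorithm, which are therefore bounded. -/
theorem estimates_bounded [Nonempty A] (hH : 1 ≤ H) (hK : 0 < p.K)
    (hα : p.α ∈ Set.Ioc (0 : ℝ) 1) (hη : p.η ∈ Set.Ioc (0 : ℝ) 1)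
    (hper : 0 < p.period)
    (hβr : 0 ≤ p.βr H d) (hβp : 0 ≤ p.βp H d (Fintype.card A))
    (hβw : 0 < p.βw H d (Fintype.card A)) (hlog : 1 ≤ Real.log p.K)
    (hβb : p.βb H d (Fintype.card A) ≤ p.K) (hdK : √d ≤ p.K)
    (hc : ∀ τ < p.K, ∀ h, |o.c τ h| ≤ 1) (hf : ∀ k < p.K, ∀ h, l2norm (o.θf k h) ≤ √d)
    (hloss : ∀ k < p.K, ∀ h s a, M.φ s a ⬝ᵥ o.θf k h ∈ Set.Icc (0 : ℝ) 1)
    (hcost : ∀ h s a, M.φ s a ⬝ᵥ M.θg h ∈ Set.Icc (0 : ℝ) 1)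
    (hE1 : o ∈ event1 M p)
    {m L : ℕ} (hm : p.K ≤ m * p.period) {ε y B : ℝ} (hε : 0 < ε) (hL : coeffBound p H ≤ L * ε)
    (hτ : (p.βw H d (Fintype.card A) + 1) * (d * √ε) ≤ 1)
    (hy : (d + 1) * (coeffBound p H * ((p.βw H d (Fintype.card A) + 1) * (d * √ε)) + ε * 2) ≤ y)
    (hy1 : 2 ^ (m + 1) * y ≤ 1)
    (hB : ∀ k < p.K, ∀ h : Fin H, ∀ n ≤ m,
      ∀ z ∈ Fintype.piFinset fun _ : ParamIdx d m => Finset.Icc (-(L : ℤ)) L,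
      wnorm (design M.toKnownPart o k h)⁻¹
        (transitionNoise M o k h (gridValue M.toKnownPart p H ε n z)) ≤ B)
    (hBβ : H * √d + (B + p.K * (2 * (4 * (2 ^ (m + 1) * y) * H + y)))
      ≤ p.βp H d (Fintype.card A))
    (k : ℕ) (hk : k < p.K) :
    (learner M.toKnownPart p o k).Y ≤ k * (p.η * H) ∧ ∀ l, ∀ j : Fin (H + 1),
      (∀ s, |Vhat M.toKnownPart p o k l j s| ≤ H - (j : ℕ)) ∧ ∀ h : Fin H, h.succ = j →
        wnorm (design M.toKnownPart o k h) (M.psiOp h (Vhat M.toKnownPart p o k l j)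
          - psiHat M.toKnownPart o k h (Vhat M.toKnownPart p o k l j))
            ≤ p.βp H d (Fintype.card A) ∧
        ∀ s a, |Qhat M.toKnownPart p o k l h s a| ≤ H - (h : ℕ) := by
  have hH' : (1 : ℝ) ≤ H := by exact_mod_cast hH
  have hK' : (1 : ℝ) ≤ p.K := by exact_mod_cast hK
  have hb0 : 0 ≤ p.βb H d (Fintype.card A) := add_nonneg hβr hβp
  have hjH : ∀ j : Fin (H + 1), (H : ℝ) - (j : ℕ) ≤ H := fun j => by simp
  have hjH0 : ∀ j : Fin (H + 1), (0 : ℝ) ≤ H - (j : ℕ) := fun j => by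
    have : ((j : ℕ) : ℝ) ≤ H := by exact_mod_cast Nat.lt_succ_iff.1 j.isLt
    linarith
  have hy0 : 0 ≤ y := by
    refine le_trans ?_ hy
    have := hβw.le
    unfold coeffBound
    positivity
  -- All earlier episodes are needed, because the current policy is built from their Q-estimates and
  -- dual variables.
  induction k using Nat.strong_induction_on with
  | _ k ih =>
  have hstart := learner_start_le M.toKnownPart p o k
  have hYk : ∀ j ≤ k, (learner M.toKnownPart p o j).Y ≤ j * (p.η * H) := by
    intro j hj
    rcases hj.lt_or_eq with hj | rfl
    · exact (ih j hj (by omega)).1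
    · rcases Nat.eq_zero_or_pos j with rfl | hpos
      · rw [learner_zero]; simp [newEpoch]
      · obtain ⟨i, rfl⟩ : ∃ i, j = i + 1 := ⟨j - 1, by omega⟩
        obtain ⟨h1, h2⟩ := ih i (by omega) (by omega)
        refine (learner_Y_succ_le M p hα.1.le hη.1.le
          (((h2 .g 0).1 M.s₁).trans (hjH 0))).trans ?_
        push_cast
        linarith
  refine ⟨hYk k le_rfl, fun l => ?_⟩
  -- The true parameter matching the index: the adversary's loss of this episode, or the mean cost.
  set θ : Fin H → Fin d → ℝ := fun h => match l with
    | .f => o.θf k h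
    | .g => M.θg h with hθdef
  have hθ : ∀ h s a, M.φ s a ⬝ᵥ θ h ∈ Set.Icc (0 : ℝ) 1 := by
    intro h s a
    cases l with
    | f => exact hloss k hk h s a
    | g => exact hcost h s a
  have hθ' : ∀ h, wnorm (design M.toKnownPart o k h) (θ h - thetaHat M.toKnownPart o k h l)
      ≤ p.βr H d := by
    intro h
    cases l with
    | f => exact (hE1 k hk h).1
    | g => exact (hE1 k hk h).2
  have hQ : ∀ h : Fin H, (∀ s, |Vhat M.toKnownPart p o k l h.succ s| ≤ H - (h.succ : ℕ)) →
      wnorm (design M.toKnownPart o k h) (M.psiOp h (Vhat M.toKnownPart p o k l h.succ)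
        - psiHat M.toKnownPart o k h (Vhat M.toKnownPart p o k l h.succ))
          ≤ p.βp H d (Fintype.card A) →
      ∀ s a, |Qhat M.toKnownPart p o k l h s a| ≤ H - (h : ℕ) := by
    intro h hV hψ s a
    refine (abs_qStep_le M p hβr hβp hβw hlog hstart l h (hjH0 _) hV (hθ h) (hθ' h) hψ s a).trans ?_
    rw [Fin.val_succ]
    push_cast
    linarith
  intro j
  induction j using Fin.reverseInduction with
  | last =>
    have h0 : Vhat M.toKnownPart p o k l (Fin.last H) = 0 := vEst_last _ _ _ _ _ _
    have hV0 : ∀ s, |Vhat M.toKnownPart p o k l (Fin.last H) s| ≤ H - (Fin.last H : ℕ) := by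
      intro s; simp [h0]
    refine ⟨hV0, fun h hh => ?_⟩
    have hψ : wnorm (design M.toKnownPart o k h)
        (M.psiOp h (Vhat M.toKnownPart p o k l (Fin.last H))
          - psiHat M.toKnownPart o k h (Vhat M.toKnownPart p o k l (Fin.last H)))
            ≤ p.βp H d (Fintype.card A) := by
      rw [h0]
      simpa [LinearCMDP.psiOp, psiHat, wnorm_zero] using hβp
    exact ⟨hψ, hQ h (by rw [hh]; exact hV0) (by rw [hh]; exact hψ)⟩
  | cast j ihj =>
    obtain ⟨hV, hrest⟩ := ihj
    obtain ⟨-, hQj⟩ := hrest j rfl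
    have hVcast : ∀ s, Vhat M.toKnownPart p o k l j.castSucc s
        = ∑ a, (learner M.toKnownPart p o k).policy j s a * Qhat M.toKnownPart p o k l j s a :=
      fun s => vEst_castSucc _ _ _ _ _ _ _ _
    have hVj : ∀ s, |Vhat M.toKnownPart p o k l j.castSucc s| ≤ H - (j.castSucc : ℕ) := by
      intro s
      rw [hVcast]
      exact abs_sum_policy_mul_le (fun a => (learner_policy_pos _ p o hK k j s a).le)
        (learner_policy_sum _ p o hK k j s) (hQj s)
    refine ⟨hVj, fun h hh => ?_⟩
    have hψ : wnorm (design M.toKnownPart o k h) (M.psiOp h (Vhat M.toKnownPart p o k l j.castSucc)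
          - psiHat M.toKnownPart o k h (Vhat M.toKnownPart p o k l j.castSucc))
            ≤ p.βp H d (Fintype.card A) := by
      have hR0 : (0 : ℝ) ≤ p.K + p.K * H := by positivity
      have hqP : ∀ i < k, ∀ l t, |qParam M.toKnownPart p o i l j
          (Vhat M.toKnownPart p o i l j.succ) t| ≤ p.K + p.K * H := fun i hi l t =>
        abs_qParam_le M p (by omega) hH hb0 hβb hdK (fun τ hτ => hc τ (by omega) j)
          (hf i (by omega) j) (fun s => (((ih i hi (by omega)).2 l j.succ).1 s).trans (hjH _)) l t
      have hYle : ∀ i < k, (learner M.toKnownPart p o i).Y ≤ H * p.K := by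
        intro i hi
        refine (hYk i hi.le).trans ?_
        have h1 : (i : ℝ) ≤ p.K := by exact_mod_cast (by omega : i ≤ p.K)
        have h2 : p.η * (H : ℝ) ≤ H := mul_le_of_le_one_left (by linarith) hη.2
        have h3 : 0 ≤ p.η * (H : ℝ) := mul_nonneg hη.1.le (by linarith)
        calc _ ≤ (p.K : ℝ) * H := mul_le_mul h1 h2 h3 (by linarith)
          _ = _ := mul_comm _ _
      -- The policy of episode k uses data of strictly earlier episodes only, for which the
      -- induction hypothesis supplies the coefficient bounds.
      obtain ⟨n, ϑ, hpol, hn1, -, hϑ⟩ := exists_layerPolicy_eq M.toKnownPart p o hK hα.1.le hper j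
        hR0 k hqP hYle (by positivity)
      have hnm : n ≤ m := by
        have : n * p.period < (m + 1) * p.period := by rw [add_mul, one_mul]; omega
        exact Nat.lt_succ_iff.1 (Nat.lt_of_mul_lt_mul_right this)
      have hRc : (p.K : ℝ) + p.K * H ≤ coeffBound p H := by
        unfold coeffBound
        have : (1 : ℝ) ≤ 1 + H * p.K := by
          have : (0 : ℝ) ≤ H * p.K := by positivity
          linarith
        calc (p.K : ℝ) + p.K * H ≤ (1 + H * p.K) * (p.K + p.K * H) :=
              le_mul_of_one_le_left hR0 this
          _ ≤ _ := le_mul_of_one_le_left (by positivity) hK'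
      have hϑ' : ∀ i t, |ϑ i t| ≤ coeffBound p H := by
        intro i t
        refine (hϑ i t).trans ?_
        have h1 : ((k - (learner M.toKnownPart p o k).start : ℕ) : ℝ) ≤ p.K := by
          exact_mod_cast (by omega : k - (learner M.toKnownPart p o k).start ≤ p.K)
        have h2 : p.α * ((1 + H * p.K) * (p.K + p.K * H))
            ≤ (1 + H * p.K) * ((p.K : ℝ) + p.K * H) :=
          mul_le_of_le_one_left (by positivity) hα.2
        exact mul_le_mul h1 h2 (mul_nonneg hα.1.le (by positivity)) (by linarith)
      have hN1 : ∀ s a, wnorm (design M.toKnownPart o (learner M.toKnownPart p o k).start j)⁻¹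
          (M.φ s a) ≤ 1 := fun s a => (wnorm_gram_inv_le _ _ _).trans (M.φ_norm s a)
      have hQlin : ∀ s a, Qhat M.toKnownPart p o k l j s a
          = linQ M.toKnownPart p H
            (design M.toKnownPart o (learner M.toKnownPart p o k).start j)⁻¹
            (qParam M.toKnownPart p o k l j (Vhat M.toKnownPart p o k l j.succ)) s a :=
        fun s a => qStep_eq_linQ _ _ _ _ _ _ _ _ _ _
      obtain ⟨z, hz, hzV⟩ := exists_gridValue_near M.toKnownPart p hK M.φ_norm hβw.le hN1 hnm hε hL
        (fun i t => (abs_gram_inv_apply_le _ _ i t).trans (hK'.trans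
          ((le_add_of_nonneg_right (by positivity)).trans hRc))) hϑ'
        (θQ := qParam M.toKnownPart p o k l j (Vhat M.toKnownPart p o k l j.succ))
        (fun t => (abs_qParam_le M p hk.le hH hb0 hβb hdK (fun τ hτ => hc τ (by omega) j)
          (hf k hk j) (fun s => (hV s).trans (hjH _)) l t).trans hRc) hτ hy hy1
        (fun s a => by rw [← hQlin]; exact (hQj s a).trans (hjH j.castSucc))
      have hnear : ∀ s, |Vhat M.toKnownPart p o k l j.castSucc s
          - gridValue M.toKnownPart p H ε n z s| ≤ 4 * (2 ^ (m + 1) * y) * H + y := by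
        intro s
        rw [hVcast, hpol]
        simp only [hQlin]
        exact hzV s
      -- The total error splits into ridge bias, noise at the nearby net function, and
      -- discretisation error.
      refine (wnorm_psiOp_sub_psiHat_le M o k h _).trans (le_trans ?_ hBβ)
      refine add_le_add (l2norm_psiOp_le M h (by linarith) fun s => (hVj s).trans (hjH _)) ?_
      refine (wnorm_transitionNoise_le M o k h hnear).trans ?_
      refine add_le_add (hB k hk h n hnm z hz) ?_
      gcongr
    exact ⟨hψ, hQ h (by rw [hh]; exact hVj) (by rw [hh]; exact hψ)⟩

/-- The event `event2` holds as soon as the value estimates are bounded by the horizon. -/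
theorem mem_event2 (hH : 1 ≤ H) (hη : 0 ≤ p.η)
    (h : ∀ k < p.K, (learner M.toKnownPart p o k).Y ≤ k * (p.η * H) ∧ ∀ l, ∀ j : Fin (H + 1),
      (∀ s, |Vhat M.toKnownPart p o k l j s| ≤ H - (j : ℕ)) ∧ ∀ h : Fin H, h.succ = j →
        wnorm (design M.toKnownPart o k h) (M.psiOp h (Vhat M.toKnownPart p o k l j)
          - psiHat M.toKnownPart o k h (Vhat M.toKnownPart p o k l j))
            ≤ p.βp H d (Fintype.card A) ∧
        ∀ s a, |Qhat M.toKnownPart p o k l h s a| ≤ H - (h : ℕ)) : o ∈ event2 M p := by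
  intro k hk i l
  have hH' : (1 : ℝ) ≤ H := by exact_mod_cast hH
  obtain ⟨h1, h2⟩ := h k hk
  obtain ⟨h3, h4⟩ := (h2 l i.succ).2 i rfl
  refine ⟨h3, fun s a => (h4 s a).trans ?_, h1.trans ?_⟩
  · have : (0 : ℝ) ≤ (i : ℕ) := Nat.cast_nonneg _
    rw [βQ]; linarith
  · have hkK : (k : ℝ) ≤ p.K := by exact_mod_cast hk.le
    have h5 : (H : ℝ) ≤ 11 * H ^ 3 := by
      have := pow_le_pow_right₀ hH' (by norm_num : 1 ≤ 3)
      rw [pow_one] at this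
      linarith
    calc (k : ℝ) * (p.η * H) ≤ p.K * (p.η * (11 * H ^ 3)) := by gcongr
      _ = _ := by ring

end Bounded

/-! ### Probability bounds -/

theorem measureReal_biUnion_le_of_card {Ω ι : Type*} [MeasurableSpace Ω] {μ : Measure Ω}
    [IsProbabilityMeasure μ] (T : Finset ι) (A : ι → Set Ω) {δ : ℝ} (hδ : 0 < δ)
    (h : ∀ i ∈ T, μ.real (A i) ≤ δ / T.card) : μ.real (⋃ i ∈ T, A i) ≤ δ := by
  refine (measureReal_biUnion_finset_le T A).trans ((Finset.sum_le_sum h).trans ?_)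
  rw [Finset.sum_const, nsmul_eq_mul]
  rcases T.card.eq_zero_or_pos with h0 | h0
  · simp [h0, hδ.le]
  · have : (T.card : ℝ) ≠ 0 := by positivity
    exact (mul_div_cancel₀ δ this).le

theorem bonusW_mem {S A : Type*} [Fintype S] [Fintype A] {H d : ℕ} {M : LinearCMDP S A H d}
    {p : Params} (hβ : 0 ≤ p.βb H d (Fintype.card A)) (o : Observations S A H d) (k : ℕ)
    (h : Fin H) (x : S) (u : A) : bonusW M.toKnownPart p o k h x u ∈ Set.Icc 0
      (3 * p.βb H d (Fintype.card A) + 8 * βQ H * p.βw H d (Fintype.card A) ^ 2) := by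
  have h0 : 0 ≤ wnorm (design M.toKnownPart o k h)⁻¹ (M.φ x u) := wnorm_nonneg _ _
  have h1 : wnorm (design M.toKnownPart o k h)⁻¹ (M.φ x u) ≤ 1 :=
    (wnorm_gram_inv_le _ _ _).trans (M.φ_norm x u)
  have hQ : 0 ≤ βQ H := by unfold βQ; positivity
  have h2 : wnorm (design M.toKnownPart o k h)⁻¹ (M.φ x u) ^ 2 ≤ 1 := pow_le_one₀ h0 h1
  unfold bonusW
  refine ⟨by positivity, add_le_add ?_ ?_⟩
  · exact mul_le_of_le_one_right (by positivity) h1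
  · exact mul_le_of_le_one_right (by positivity) h2

namespace IsInteraction

variable {S A : Type*} [Fintype S] [Fintype A] [MeasurableSpace S] [DiscreteMeasurableSpace S]
  [MeasurableSpace A] [DiscreteMeasurableSpace A]
  {H d : ℕ} {Ω : Type*} [mΩ : MeasurableSpace Ω]
  {M : LinearCMDP S A H d} {p : Params} {μ : Measure Ω} [IsProbabilityMeasure μ]
  {𝓕 : Filtration ℕ mΩ} {s : ℕ → Fin (H + 1) → Ω → S} {a : ℕ → Fin H → Ω → A}
  {g : ℕ → Ω → Fin H → S → A → ℝ} {θf : ℕ → Fin H → Ω → Fin d → ℝ}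

/-- The noise is a difference of two numbers in [0,1], so the self-normalised bound applies with b =
1. Clipping makes this hold for every outcome, not just almost surely. -/
theorem measureReal_costNoise_le [Nonempty A] (hI : IsInteraction M p μ 𝓕 s a g θf) {k : ℕ}
    (hk : k < p.K) (h : Fin H) {δ : ℝ} (hδ : 0 < δ) :
    μ.real {ω | d * Real.log (1 + k) + 2 * Real.log δ⁻¹
      < wnorm (design M.toKnownPart (observe s a g θf ω) k h)⁻¹
        (∑ τ ∈ Finset.range k, (unitClip ((observe s a g θf ω).c τ h)
          - visited M.toKnownPart (observe s a g θf ω) τ h ⬝ᵥ M.θg h)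
            • visited M.toKnownPart (observe s a g θf ω) τ h) ^ 2} ≤ δ := by
  have hy : ∀ τ < p.K, Measurable[𝓕 (τ + 1)] fun ω => (s τ h.castSucc ω, a τ h ω) := fun τ hτ =>
    (hI.s_past τ hτ _).prodMk (hI.a_past τ hτ _)
  have hε : ∀ τ < p.K, Measurable[𝓕 (τ + 1)] fun ω =>
      unitClip (g τ ω h (s τ h.castSucc ω) (a τ h ω))
        - M.φ (s τ h.castSucc ω) (a τ h ω) ⬝ᵥ M.θg h := by
    intro τ hτ
    have h1 : Measurable[𝓕 (τ + 1)] fun ω => (observe s a g θf ω).c τ h :=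
      @ObsMeasurable.c _ _ _ _ _ _ _ (𝓕 (τ + 1)) _ _
        (hI.obsMeasurable (k := τ + 1) hτ) τ τ.lt_succ_self h
    have h2 : Measurable fun q : S × A => M.φ q.1 q.2 ⬝ᵥ M.θg h := Measurable.of_discrete
    exact (measurable_unitClip.comp h1).sub (h2.comp (hy τ hτ))
  have := measureReal_selfNormalized_le (φ := fun q : S × A => M.φ q.1 q.2) one_pos
    (fun q => M.φ_norm _ _) hy hε (fun τ hτ ω => ?_) (hI.isNoise_cost h) hk.le hδ
  · rw [one_pow, one_mul] at this
    exact this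
  · have h1 := cost_mean_mem M h (s τ h.castSucc ω) (a τ h ω)
    have h2 := unitClip_mem (g τ ω h (s τ h.castSucc ω) (a τ h ω))
    exact abs_le.2 ⟨by linarith [h1.2, h2.1], by linarith [h1.1, h2.2]⟩

theorem measureReal_transitionNoise_le (hI : IsInteraction M p μ 𝓕 s a g θf) {k : ℕ}
    (hk : k < p.K) (h : Fin H) {V : S → ℝ} {C : ℝ} (hC : 0 < C) (hV : ∀ x, |V x| ≤ C)
    {δ : ℝ} (hδ : 0 < δ) :
    μ.real {ω | (2 * C) ^ 2 * (d * Real.log (1 + k) + 2 * Real.log δ⁻¹)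
      < wnorm (design M.toKnownPart (observe s a g θf ω) k h)⁻¹
        (transitionNoise M (observe s a g θf ω) k h V) ^ 2} ≤ δ := by
  have hy : ∀ τ < p.K, Measurable[𝓕 (τ + 1)] fun ω => (s τ h.castSucc ω, a τ h ω) := fun τ hτ =>
    (hI.s_past τ hτ _).prodMk (hI.a_past τ hτ _)
  have hε : ∀ τ < p.K, Measurable[𝓕 (τ + 1)] fun ω => V (s τ h.succ ω)
      - ∑ x, M.P h (s τ h.castSucc ω) (a τ h ω) x * V x := by
    intro τ hτ
    have h1 : Measurable V := Measurable.of_discrete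
    have h2 : Measurable fun q : S × A => ∑ x, M.P h q.1 q.2 x * V x := Measurable.of_discrete
    exact (h1.comp (hI.s_past τ hτ _)).sub (h2.comp (hy τ hτ))
  exact measureReal_selfNormalized_le (φ := fun q : S × A => M.φ q.1 q.2) (by positivity)
    (fun q => M.φ_norm _ _) hy hε (fun τ _ ω => (abs_sub _ _).trans (by
      rw [two_mul]; exact add_le_add (hV _) (abs_transition_le M h hV _ _)))
    (hI.isNoise_transition h V) hk.le hδ

theorem measureReal_value_gt_le [Nonempty A] (hI : IsInteraction M p μ 𝓕 s a g θf) (hH : 1 ≤ H)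
    (hK : 0 < p.K) (hβ : 0 < p.βb H d (Fintype.card A)) {δ : ℝ} (hδ : 0 < δ) :
    μ.real {ω | 2 * ∑ k ∈ Finset.range p.K, Wsum M.toKnownPart p (observe s a g θf ω) k
        + 2 * (H * (3 * p.βb H d (Fintype.card A) + 8 * βQ H * p.βw H d (Fintype.card A) ^ 2))
          * Real.log δ⁻¹
      < ∑ k ∈ Finset.range p.K, M.value (learner M.toKnownPart p (observe s a g θf ω) k).policy
          (bonusW M.toKnownPart p (observe s a g θf ω) k) 0 M.s₁} ≤ δ := by
  have hH' : (0 : ℝ) < H := by exact_mod_cast hH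
  have hQ : 0 ≤ βQ H := by unfold βQ; positivity
  set C := 3 * p.βb H d (Fintype.card A) + 8 * βQ H * p.βw H d (Fintype.card A) ^ 2 with hC
  have hCpos : 0 < C := by positivity
  have hmem := fun (o : Observations S A H d) k h x u =>
    bonusW_mem (M := M) (p := p) hβ.le o k h x u
  have habs : ∀ (o : Observations S A H d) k h x u, |bonusW M.toKnownPart p o k h x u| ≤ C :=
    fun o k h x u => by rw [abs_of_nonneg (hmem o k h x u).1]; exact (hmem o k h x u).2
  refine measureReal_freedman_le (mul_pos hH' hCpos) (fun k hk => ?_) (fun k hk => ?_)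
    (fun k _ ω => ⟨Finset.sum_nonneg fun h _ => (hmem _ _ _ _ _).1, ?_⟩) (fun k _ ω => ⟨?_, ?_⟩)
    (fun k hk Z hZ hb => hI.integral_mul_Wsum hk (fun o h x u => habs o k h x u) hZ hb) hδ
  · refine Finset.measurable_sum _ fun h _ => ?_
    exact measurable_eval_discrete
      (F := fun (q : S × A) ω => bonusW M.toKnownPart p (observe s a g θf ω) k h q.1 q.2)
      (y := fun ω => (s k h.castSucc ω, a k h ω))
      (fun q => (hI.measurable_bonusW hk.le h q.1 q.2).mono (𝓕.mono k.le_succ) le_rfl)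
      ((hI.s_past k hk _).prodMk (hI.a_past k hk _))
  · exact measurable_value M (hI.measurable_policy hk.le)
      (fun h x u => hI.measurable_bonusW hk.le h x u) 0 M.s₁
  · refine (Finset.sum_le_sum fun h _ => (hmem _ _ _ _ _).2).trans_eq ?_
    rw [Finset.sum_const, Finset.card_univ, Fintype.card_fin, nsmul_eq_mul]
  · exact value_nonneg M (fun h x u => (learner_policy_pos _ p _ hK k h x u).le)
      (fun h x u => (hmem _ _ _ _ _).1) 0 M.s₁
  · refine (le_abs_self _).trans ((abs_value_le M
      (fun h x u => (learner_policy_pos _ p _ hK k h x u).le)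
      (fun h x => learner_policy_sum _ p _ hK k h x) (fun h x u => habs _ k h x u) 0
      M.s₁).trans_eq ?_)
    simp

end IsInteraction

/-! ### Numerical estimates -/

section Numerics

theorem period_eq (p : Params) {m : ℕ} (hm : p.K = m ^ 4) : p.period = m ^ 3 := by
  have : ((p.K : ℝ)) ^ (3 / 4 : ℝ) = ((m ^ 3 : ℕ) : ℝ) := by
    rw [hm, Nat.cast_pow, Nat.cast_pow, ← Real.rpow_natCast, ← Real.rpow_mul (Nat.cast_nonneg m),
      ← Real.rpow_natCast]
    norm_num
  rw [Params.period, this, Nat.floor_natCast]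

theorem betap_eq (p : Params) (H d nA : ℕ) {m : ℕ} (hm : p.K = m ^ 4) :
    p.βp H d nA = 50 * (m + 1) * d * H * √(Real.log (5 * H ^ 2 * p.K ^ 2 * nA / p.δ)) := by
  have : ((p.K : ℝ)) ^ (1 / 4 : ℝ) = m := by
    rw [hm, Nat.cast_pow, ← Real.rpow_natCast, ← Real.rpow_mul (Nat.cast_nonneg m)]
    norm_num
  rw [Params.βp, this]

theorem betar_nonneg (p : Params) (H d : ℕ) : 0 ≤ p.βr H d := by
  unfold Params.βr; positivity

theorem betap_nonneg (p : Params) (H d nA : ℕ) : 0 ≤ p.βp H d nA := by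
  unfold Params.βp; positivity

theorem betab_nonneg (p : Params) (H d nA : ℕ) : 0 ≤ p.βb H d nA :=
  add_nonneg (betar_nonneg p H d) (betap_nonneg p H d nA)

theorem one_le_log_of_three_le {x : ℝ} (hx : 3 ≤ x) : 1 ≤ Real.log x := by
  rw [Real.le_log_iff_exp_le (by linarith)]
  linarith [Real.exp_one_lt_d9]

variable {p : Params} {H d nA m : ℕ}

theorem two_mul_log_le (hH : 1 ≤ H) (hA : 1 ≤ nA) (hδ : p.δ ∈ Set.Ioo (0 : ℝ) 1) (hK : 0 < p.K) :
    2 * Real.log p.K ≤ Real.log (5 * H ^ 2 * p.K ^ 2 * nA / p.δ) := by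
  have hH' : (1 : ℝ) ≤ H := by exact_mod_cast hH
  have hA' : (1 : ℝ) ≤ nA := by exact_mod_cast hA
  have hK' : (1 : ℝ) ≤ p.K := by exact_mod_cast hK
  have h1 : 2 * Real.log p.K = Real.log ((p.K : ℝ) ^ 2) := by rw [Real.log_pow]; norm_num
  rw [h1]
  refine Real.log_le_log (by positivity) ?_
  rw [le_div_iff₀ hδ.1]
  have h2 : (1 : ℝ) ≤ H ^ 2 := one_le_pow₀ hH'
  calc (p.K : ℝ) ^ 2 * p.δ ≤ (p.K : ℝ) ^ 2 * 1 := by gcongr; exact hδ.2.le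
    _ = 1 * 1 * (p.K : ℝ) ^ 2 * 1 := by ring
    _ ≤ 5 * H ^ 2 * p.K ^ 2 * nA := by gcongr; norm_num

/-- Consequences of `1 ≤ β_w ≤ K`. -/
theorem params_bounds (hH : 1 ≤ H) (hA : 1 ≤ nA) (hm : p.K = m ^ 4)
    (hδ : p.δ ∈ Set.Ioo (0 : ℝ) 1) (h1 : 1 ≤ p.βw H d nA) (h2 : p.βw H d nA ≤ p.K) :
    2 ≤ m ∧ 1 ≤ d ∧ 1 ≤ Real.log p.K ∧ 0 < p.βb H d nA ∧ p.βb H d nA ≤ p.K ∧ d ≤ p.K ∧ H ≤ p.K := by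
  have hb := betab_nonneg p H d nA
  -- For K equal to 0 or 1 the logarithm vanishes, and with it β_w.
  have hm2 : 2 ≤ m := by
    by_contra hlt
    have : m = 0 ∨ m = 1 := by omega
    have h0 : Real.log p.K = 0 := by rcases this with rfl | rfl <;> simp [hm]
    rw [Params.βw, h0, mul_zero] at h1
    linarith
  have hK16 : 16 ≤ p.K := by rw [hm]; exact Nat.pow_le_pow_left hm2 4
  have hK16' : (16 : ℝ) ≤ p.K := by exact_mod_cast hK16
  have hlog : 1 ≤ Real.log p.K := one_le_log_of_three_le (by linarith)
  have hbpos : 0 < p.βb H d nA := by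
    refine hb.lt_of_ne fun e => ?_
    rw [Params.βw, ← e] at h1
    linarith
  have hd : 1 ≤ d := by
    rcases Nat.eq_zero_or_pos d with rfl | h
    · exact absurd hbpos (by simp [Params.βb, Params.βr, Params.βp])
    · exact h
  have hbK : p.βb H d nA ≤ p.K := by
    refine le_trans ?_ h2
    rw [Params.βw]
    have := mul_le_mul_of_nonneg_left hlog hb
    linarith
  have hd' : (1 : ℝ) ≤ d := by exact_mod_cast hd
  have hH' : (1 : ℝ) ≤ H := by exact_mod_cast hH
  have hl := two_mul_log_le hH hA hδ (by omega : 0 < p.K)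
  have hl1 : 1 ≤ √(Real.log (5 * H ^ 2 * p.K ^ 2 * nA / p.δ)) := by
    rw [Real.one_le_sqrt]; linarith
  have hdH : (d : ℝ) * H ≤ p.K := by
    refine le_trans ?_ (le_trans (le_add_of_nonneg_left (betar_nonneg p H d)) hbK)
    rw [betap_eq p H d nA hm]
    have hm0 : (0 : ℝ) ≤ m := Nat.cast_nonneg m
    calc (d : ℝ) * H = 1 * d * H * 1 := by ring
      _ ≤ _ := by gcongr; linarith
  refine ⟨hm2, hd, hlog, hbpos, hbK, ?_, ?_⟩
  · have : (d : ℝ) ≤ p.K := le_trans (le_mul_of_one_le_right (by linarith) hH') hdH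
    exact_mod_cast this
  · have : (H : ℝ) ≤ p.K := le_trans (le_mul_of_one_le_left (by linarith) hd') hdH
    exact_mod_cast this

/-- With u = d log(6KH/δ) the left side is at most √u + √(3u), and this is at most 2√(2u). The
rational approximations 7/4 and 11/8 of √3 and √2 fit exactly, since 1 + 7/4 = 2 · 11/8. -/
theorem cost_radius_le (hd : 1 ≤ d) (hH : 1 ≤ H) (hK : 1 ≤ p.K) (hδ : p.δ ∈ Set.Ioo (0 : ℝ) 1)
    {k : ℕ} (hk : k < p.K) :
    √d + √(d * Real.log (1 + k) + 2 * Real.log (3 * (p.K * H : ℕ) / p.δ)) ≤ p.βr H d := by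
  have hd' : (1 : ℝ) ≤ d := by exact_mod_cast hd
  have hH' : (1 : ℝ) ≤ H := by exact_mod_cast hH
  have hK' : (1 : ℝ) ≤ p.K := by exact_mod_cast hK
  have hk' : (1 : ℝ) + k ≤ p.K := by
    have : ((k + 1 : ℕ) : ℝ) ≤ p.K := by exact_mod_cast hk
    push_cast at this
    linarith
  have hδ0 := hδ.1
  set ℓ := Real.log (6 * p.K * H / p.δ) with hℓ
  have hx : (p.K : ℝ) * 6 ≤ 6 * p.K * H / p.δ := by
    rw [le_div_iff₀ hδ.1]
    calc (p.K : ℝ) * 6 * p.δ ≤ p.K * 6 * 1 := by gcongr; exact hδ.2.le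
      _ = 6 * p.K * 1 := by ring
      _ ≤ 6 * p.K * H := by gcongr
  have hℓ1 : 1 ≤ ℓ := one_le_log_of_three_le (by linarith)
  have e1 : Real.log (1 + k) ≤ ℓ := Real.log_le_log (by positivity) (by linarith)
  have e2 : Real.log (3 * (p.K * H : ℕ) / p.δ) ≤ ℓ := by
    refine Real.log_le_log (by push_cast; positivity) ?_
    push_cast
    gcongr ?_ / _
    have : 0 ≤ (p.K : ℝ) * H := by positivity
    linarith
  set u := (d : ℝ) * ℓ with hu
  have hu0 : 0 ≤ u := by positivity
  have e3 : (d : ℝ) * Real.log (1 + k) + 2 * Real.log (3 * (p.K * H : ℕ) / p.δ) ≤ 3 * u := by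
    have f1 : (d : ℝ) * Real.log (1 + k) ≤ u := mul_le_mul_of_nonneg_left e1 (by linarith)
    have f2 : ℓ ≤ u := le_mul_of_one_le_left (by linarith) hd'
    linarith
  have e4 : √d ≤ √u := Real.sqrt_le_sqrt (le_mul_of_one_le_right (by linarith) hℓ1)
  have e5 : √(3 * u) ≤ 7 / 4 * √u := by
    rw [Real.sqrt_le_left (by positivity), mul_pow, Real.sq_sqrt hu0]
    linarith
  have e6 : 11 / 8 * √u ≤ √(2 * u) := by
    refine Real.le_sqrt_of_sq_le ?_
    rw [mul_pow, Real.sq_sqrt hu0]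
    linarith
  have e7 : p.βr H d = 2 * √(2 * u) := by rw [Params.βr, hu, mul_assoc 2 (d : ℝ)]
  rw [e7]
  have := Real.sqrt_le_sqrt e3
  linarith

/-- Put w = (m+1)d and let ℓ be the logarithm in β_p. The logarithmic size of the net contributes
105 w²ℓ and everything else at most 4 w²ℓ. As 4 · 109 ≤ 21², the square root is at most 21 Hw√ℓ;
bias and discretisation add one unit of Hw√ℓ each, well below the 50 available. -/
theorem transition_radius_le (hd : 1 ≤ d) (hH : 1 ≤ H) (hA : 1 ≤ nA) (hm : p.K = m ^ 4)
    (hm2 : 2 ≤ m) (hlog : 1 ≤ Real.log p.K) (hδ : p.δ ∈ Set.Ioo (0 : ℝ) 1) {k : ℕ} (hk : k < p.K)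
    {N : ℕ} (hN0 : 0 < N)
    (hN : N ≤ p.K * H * p.K ^ (1 + (35 + m) * (d * d + (m + 1) * (d + 1)))) :
    H * √d + (√((2 * H) ^ 2 * (d * Real.log (1 + k) + 2 * Real.log (3 * N / p.δ))) + 1)
      ≤ p.βp H d nA := by
  have hd' : (1 : ℝ) ≤ d := by exact_mod_cast hd
  have hH' : (1 : ℝ) ≤ H := by exact_mod_cast hH
  have hA' : (1 : ℝ) ≤ nA := by exact_mod_cast hA
  have hm' : (2 : ℝ) ≤ m := by exact_mod_cast hm2
  have hKpos : 0 < p.K := by omega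
  have hK' : (1 : ℝ) ≤ p.K := by exact_mod_cast hKpos
  have hN0' : (0 : ℝ) < N := by exact_mod_cast hN0
  have hk' : (1 : ℝ) + k ≤ p.K := by
    have : ((k + 1 : ℕ) : ℝ) ≤ p.K := by exact_mod_cast hk
    push_cast at this
    linarith
  have hδ0 := hδ.1
  have hl := two_mul_log_le hH hA hδ hKpos
  rw [betap_eq p H d nA hm]
  set ℓ := Real.log (5 * H ^ 2 * p.K ^ 2 * nA / p.δ) with hℓ
  set D : ℝ := d * d + (m + 1) * (d + 1) with hD
  have e1 : Real.log (1 + k) ≤ ℓ / 2 :=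
    (Real.log_le_log (by positivity) hk').trans (by linarith)
  have e2 : Real.log (3 * N / p.δ) ≤ ℓ + (1 + (35 + m) * D) * (ℓ / 2) := by
    have f1 : (3 * N / p.δ : ℝ) ≤ (3 * (p.K * H) / p.δ)
        * (p.K : ℝ) ^ (1 + (35 + m) * (d * d + (m + 1) * (d + 1))) := by
      have : (N : ℝ) ≤ p.K * H * (p.K : ℝ) ^ (1 + (35 + m) * (d * d + (m + 1) * (d + 1))) := by
        exact_mod_cast hN
      rw [div_mul_eq_mul_div]
      gcongr ?_ / _
      linarith
    refine (Real.log_le_log (by positivity) f1).trans ?_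
    rw [Real.log_mul (by positivity) (by positivity), Real.log_pow]
    refine add_le_add (Real.log_le_log (by positivity) ?_) ?_
    · gcongr ?_ / _
      calc 3 * ((p.K : ℝ) * H) ≤ 5 * (p.K ^ 2 * H ^ 2) := by
            gcongr
            · norm_num
            · exact le_self_pow₀ hK' two_ne_zero
            · exact le_self_pow₀ hH' two_ne_zero
        _ = 5 * H ^ 2 * p.K ^ 2 * 1 := by ring
        _ ≤ _ := by gcongr
    · push_cast
      rw [← hD]
      gcongr
      linarith
  set w : ℝ := (m + 1) * d with hw
  have hw1 : 1 ≤ w := by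
    calc (1 : ℝ) = 1 * 1 := by norm_num
      _ ≤ w := by rw [hw]; gcongr; linarith
  have hdd : (d : ℝ) ≤ d * d := le_mul_of_one_le_left (by linarith) hd'
  have hD3 : D ≤ 3 * (m + 1) * (d * d) := by
    have f1 : (d : ℝ) * d ≤ (m + 1) * (d * d) := le_mul_of_one_le_left (by positivity) (by linarith)
    have f2 : ((m : ℝ) + 1) * (d + 1) ≤ (m + 1) * (2 * (d * d)) := by gcongr; linarith
    linarith
  have hDw : (35 + m) * D ≤ 105 * w ^ 2 := by
    calc (35 + m) * D ≤ (35 * (m + 1)) * (3 * (m + 1) * (d * d)) := by gcongr; linarith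
      _ = 105 * w ^ 2 := by rw [hw]; ring
  have hdw : (d : ℝ) ≤ w := le_mul_of_one_le_left (by linarith) (by linarith)
  have hw2 : w ≤ w ^ 2 := le_self_pow₀ hw1 two_ne_zero
  have hℓ0 : 2 ≤ ℓ := by linarith
  have hS : d * Real.log (1 + k) + 2 * Real.log (3 * N / p.δ) ≤ 109 * (w ^ 2 * ℓ) := by
    have f1 : (d : ℝ) * Real.log (1 + k) ≤ d * (ℓ / 2) := by gcongr
    have f2 : (d / 2 + 3 + (35 + m) * D) * ℓ ≤ (109 * w ^ 2) * ℓ := by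
      gcongr; linarith
    linarith
  have hsq : √((2 * H) ^ 2 * (d * Real.log (1 + k) + 2 * Real.log (3 * N / p.δ)))
      ≤ 21 * (H * w * √ℓ) := by
    rw [Real.sqrt_le_left (by positivity)]
    have f3 : (21 * (H * w * √ℓ)) ^ 2 = 441 * (H ^ 2 * (w ^ 2 * ℓ)) := by
      simp only [mul_pow]
      rw [Real.sq_sqrt (by linarith)]
      ring
    rw [f3]
    calc (2 * (H : ℝ)) ^ 2 * _ ≤ (2 * H) ^ 2 * (109 * (w ^ 2 * ℓ)) := by gcongr
      _ = 436 * (H ^ 2 * (w ^ 2 * ℓ)) := by ring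
      _ ≤ _ := by gcongr; norm_num
  have hsl : 1 ≤ √ℓ := by rw [Real.one_le_sqrt]; linarith
  have g1 : H * √d ≤ H * w * √ℓ := by
    have : √(d : ℝ) ≤ d := by
      rw [Real.sqrt_le_left (by linarith)]; exact le_self_pow₀ hd' two_ne_zero
    calc H * √d ≤ H * w * 1 := by rw [mul_one]; gcongr; linarith
      _ ≤ _ := by gcongr
  have g2 : 1 ≤ H * w * √ℓ := by
    calc (1 : ℝ) = 1 * 1 * 1 := by norm_num
      _ ≤ _ := by gcongr
  have g3 : 50 * (m + 1) * d * H * √ℓ = 50 * (H * w * √ℓ) := by rw [hw]; ring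
  rw [g3]
  linarith

theorem coeffBound_le (hHK : H ≤ p.K) (hK4 : 8 ≤ p.K) :
    coeffBound p H ≤ (p.K : ℝ) ^ 6 := by
  have hK' : (8 : ℝ) ≤ p.K := by exact_mod_cast hK4
  have hHK' : (H : ℝ) ≤ p.K := by exact_mod_cast hHK
  have hK2 : (p.K : ℝ) ≤ p.K ^ 2 := le_self_pow₀ (by linarith) two_ne_zero
  have h1 : 1 + (H : ℝ) * p.K ≤ 2 * p.K ^ 2 := by
    have : (H : ℝ) * p.K ≤ p.K * p.K := by gcongr
    nlinarith
  have h2 : (p.K : ℝ) + p.K * H ≤ 2 * p.K ^ 2 := by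
    have : (p.K : ℝ) * H ≤ p.K * p.K := by gcongr
    nlinarith
  unfold coeffBound
  calc (p.K : ℝ) * ((1 + H * p.K) * (p.K + p.K * H)) ≤ p.K * ((2 * p.K ^ 2) * (2 * p.K ^ 2)) := by
        gcongr
    _ = 4 * p.K ^ 5 := by ring
    _ ≤ p.K * p.K ^ 5 := by gcongr; linarith
    _ = _ := by ring

/-- Mesh width of the net is the square of this number. -/
def netScale (p : Params) (m : ℕ) : ℝ := ((p.K : ℝ) ^ 14 * 2 ^ m)⁻¹

theorem netScale_pos (hK : 8 ≤ p.K) (m : ℕ) : 0 < netScale p m := by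
  have hK' : (8 : ℝ) ≤ p.K := by exact_mod_cast hK
  unfold netScale
  positivity

/-- The squared scale is K^(-28) 4^(-m), so the number of grid steps is chosen to cover the
coefficient range K^6. -/
theorem coeffBound_le_mul (hHK : H ≤ p.K) (hK : 8 ≤ p.K) (m : ℕ) :
    coeffBound p H ≤ ((p.K ^ 34 * 4 ^ m : ℕ) : ℝ) * netScale p m ^ 2 := by
  have hK' : (8 : ℝ) ≤ p.K := by exact_mod_cast hK
  refine (coeffBound_le hHK hK).trans_eq ?_
  have h4 : (4 : ℝ) ^ m = 2 ^ m * 2 ^ m := by rw [← mul_pow]; norm_num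
  rw [netScale]
  push_cast
  rw [h4]
  field_simp

/-- Here y = K^10 times the scale, that is K^(-4) 2^(-m): the factor 2^(-m) pays for the doubling
over the layers and K^(-4) for all polynomial losses. -/
theorem netScale_le_one (hK : 8 ≤ p.K) (m : ℕ) : p.K ^ 10 * netScale p m ≤ ((p.K : ℝ) ^ 4)⁻¹ ∧
    2 ^ (m + 1) * (p.K ^ 10 * netScale p m) = 2 * ((p.K : ℝ) ^ 4)⁻¹ := by
  have hK' : (8 : ℝ) ≤ p.K := by exact_mod_cast hK
  have h1 : (1 : ℝ) ≤ 2 ^ m := one_le_pow₀ one_le_two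
  have h2 : p.K ^ 10 * netScale p m = ((p.K : ℝ) ^ 4)⁻¹ * (2 ^ m)⁻¹ := by
    rw [netScale]
    field_simp
  refine ⟨?_, ?_⟩
  · rw [h2]
    exact mul_le_of_le_one_right (by positivity) (inv_le_one_of_one_le₀ h1)
  · rw [h2, pow_succ]
    field_simp

theorem net_contraction_le (hK : 8 ≤ p.K) (hd : d ≤ p.K)
    (h2 : p.βw H d nA ≤ p.K) (m : ℕ) :
    (p.βw H d nA + 1) * (d * √(netScale p m ^ 2)) ≤ 2 * p.K ^ 2 * netScale p m := by
  have hK' : (8 : ℝ) ≤ p.K := by exact_mod_cast hK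
  have hd' : (d : ℝ) ≤ p.K := by exact_mod_cast hd
  have hr := (netScale_pos hK m).le
  rw [Real.sqrt_sq hr]
  calc _ ≤ (p.K + p.K) * ((p.K : ℝ) * netScale p m) := by gcongr; linarith
    _ = _ := by ring

/-- Coefficients cost K^6, the feature perturbation 2K² and the dimension 2K, which makes 4K^9 up to
a lower-order term; the remaining power of K absorbs the constants. -/
theorem net_step_le (hK : 8 ≤ p.K) (hd : d ≤ p.K) (hHK : H ≤ p.K) (h0 : 0 ≤ p.βw H d nA)
    (h2 : p.βw H d nA ≤ p.K) (m : ℕ) :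
    (d + 1) * (coeffBound p H * ((p.βw H d nA + 1) * (d * √(netScale p m ^ 2)))
      + netScale p m ^ 2 * 2) ≤ p.K ^ 10 * netScale p m := by
  have hK' : (8 : ℝ) ≤ p.K := by exact_mod_cast hK
  have hd' : (d : ℝ) ≤ p.K := by exact_mod_cast hd
  have hr := (netScale_pos hK m).le
  have hr1 : netScale p m ≤ 1 := by
    refine inv_le_one_of_one_le₀ (one_le_mul_of_one_le_of_one_le (one_le_pow₀ (by linarith))
      (one_le_pow₀ one_le_two))
  have e1 : netScale p m ^ 2 * 2 ≤ 2 * netScale p m := by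
    rw [pow_two]
    have := mul_le_of_le_one_left hr hr1
    linarith
  have e2 : coeffBound p H * ((p.βw H d nA + 1) * (d * √(netScale p m ^ 2)))
      ≤ p.K ^ 6 * (2 * p.K ^ 2 * netScale p m) :=
    mul_le_mul (coeffBound_le hHK hK) (net_contraction_le hK hd h2 m) (by positivity)
      (by positivity)
  calc _ ≤ (p.K + p.K) * ((p.K : ℝ) ^ 6 * (2 * p.K ^ 2 * netScale p m) + 2 * netScale p m) := by
        have : 0 ≤ coeffBound p H := by unfold coeffBound; positivity
        gcongr
        linarith
    _ = (4 * p.K ^ 9 + 4 * p.K) * netScale p m := by ring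
    _ ≤ p.K ^ 10 * netScale p m := by
        have f1 : (p.K : ℝ) ≤ p.K ^ 9 := le_self_pow₀ (by linarith) (by norm_num)
        have f2 : 8 * (p.K : ℝ) ^ 9 ≤ p.K * p.K ^ 9 := by gcongr
        have f3 : (p.K : ℝ) * p.K ^ 9 = p.K ^ 10 := by ring
        gcongr
        linarith

theorem net_error_le (hK : 8 ≤ p.K) (hHK : H ≤ p.K) (m : ℕ) :
    (p.K : ℝ) * (2 * (4 * (2 ^ (m + 1) * (p.K ^ 10 * netScale p m)) * H
      + p.K ^ 10 * netScale p m)) ≤ 1 := by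
  have hK' : (8 : ℝ) ≤ p.K := by exact_mod_cast hK
  have hHK' : (H : ℝ) ≤ p.K := by exact_mod_cast hHK
  obtain ⟨h1, h2⟩ := netScale_le_one hK m
  rw [h2]
  calc _ ≤ (p.K : ℝ) * (2 * (4 * (2 * ((p.K : ℝ) ^ 4)⁻¹) * p.K + ((p.K : ℝ) ^ 4)⁻¹)) := by gcongr
    _ = (16 * p.K ^ 2 + 2 * p.K) / (p.K : ℝ) ^ 4 := by field_simp; ring
    _ ≤ 1 := by
        rw [div_le_one (by positivity)]
        have f1 : 64 * (p.K : ℝ) ^ 2 ≤ p.K ^ 2 * p.K ^ 2 := by gcongr; nlinarith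
        have f2 : (p.K : ℝ) ≤ p.K ^ 2 := le_self_pow₀ (by linarith) two_ne_zero
        have f3 : (p.K : ℝ) ^ 2 * p.K ^ 2 = p.K ^ 4 := by ring
        have f4 : 0 ≤ (p.K : ℝ) ^ 2 := by positivity
        linarith

/-- Each coordinate takes 2L + 1 values, at most K^(35+m) because 4^m ≤ K^m; the extra factor K
accounts for the number of layers. -/
theorem card_net_le (hmK : m + 1 ≤ p.K) (hK : 8 ≤ p.K) :
    p.K * (H * ((m + 1) * (2 * (p.K ^ 34 * 4 ^ m) + 1) ^ (d * d + (m + 1) * (d + 1))))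
      ≤ p.K * H * p.K ^ (1 + (35 + m) * (d * d + (m + 1) * (d + 1))) := by
  have h1 : 2 * (p.K ^ 34 * 4 ^ m) + 1 ≤ p.K ^ (35 + m) := by
    have e0 : 1 ≤ p.K ^ 34 * 4 ^ m := Nat.one_le_iff_ne_zero.2 (by positivity)
    calc 2 * (p.K ^ 34 * 4 ^ m) + 1 ≤ 4 * (p.K ^ 34 * 4 ^ m) := by omega
      _ ≤ p.K * (p.K ^ 34 * p.K ^ m) := by gcongr <;> omega
      _ = _ := by ring
  calc _ ≤ p.K * (H * (p.K * (p.K ^ (35 + m)) ^ (d * d + (m + 1) * (d + 1)))) := by gcongr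
    _ = _ := by rw [← pow_mul, pow_add, pow_one]; ring

end Numerics

/-! ### The good event -/

section Membership

variable {S A : Type*} [Fintype S] {H d : ℕ} (M : LinearCMDP S A H d) {o : Observations S A H d}

theorem wnorm_costParam_le (k : ℕ) (h : Fin H)
    (hc : ∀ τ < k, o.c τ h ∈ Set.Icc (0 : ℝ) 1) :
    wnorm (design M.toKnownPart o k h) (M.θg h - thetaHat M.toKnownPart o k h .g)
      ≤ √d + wnorm (design M.toKnownPart o k h)⁻¹
        (∑ τ ∈ Finset.range k, (unitClip (o.c τ h) - visited M.toKnownPart o τ h ⬝ᵥ M.θg h)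
          • visited M.toKnownPart o τ h) := by
  have h1 := wnorm_sub_ridge_le (fun τ => visited M.toKnownPart o τ h) k (M.θg h)
    fun τ => o.c τ h
  have h2 : ∑ τ ∈ Finset.range k, (unitClip (o.c τ h) - visited M.toKnownPart o τ h ⬝ᵥ M.θg h)
      • visited M.toKnownPart o τ h
      = ∑ τ ∈ Finset.range k, (o.c τ h - visited M.toKnownPart o τ h ⬝ᵥ M.θg h)
        • visited M.toKnownPart o τ h :=
    Finset.sum_congr rfl fun τ hτ => by rw [unitClip_eq_self (hc τ (Finset.mem_range.1 hτ))]
  rw [h2]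
  exact h1.trans (add_le_add (M.θg_norm h) le_rfl)

theorem mem_event1 (p : Params) (hc : ∀ τ < p.K, ∀ h, o.c τ h ∈ Set.Icc (0 : ℝ) 1)
    (hB : ∀ k < p.K, ∀ h, √d + wnorm (design M.toKnownPart o k h)⁻¹
        (∑ τ ∈ Finset.range k, (unitClip (o.c τ h) - visited M.toKnownPart o τ h ⬝ᵥ M.θg h)
          • visited M.toKnownPart o τ h) ≤ p.βr H d) : o ∈ event1 M p := by
  refine fun k hk h => ⟨?_, (wnorm_costParam_le M k h fun τ hτ => hc τ (by omega) h).trans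
    (hB k hk h)⟩
  rw [thetaHat, sub_self, wnorm_zero]
  exact betar_nonneg p H d

end Membership

/-- The good event has probability at least `1 - δ`. -/
theorem one_sub_le_measureReal_goodEvent
    {S A : Type*} [Fintype S] [Fintype A]
    [MeasurableSpace S] [DiscreteMeasurableSpace S]
    [MeasurableSpace A] [DiscreteMeasurableSpace A]
    {H d : ℕ} (hH : 1 ≤ H) (M : LinearCMDP S A H d) (p : Params)
    (hK : ∃ m : ℕ, p.K = m ^ 4)
    (hδ : p.δ ∈ Set.Ioo (0 : ℝ) 1)
    (hα : p.α ∈ Set.Ioc (0 : ℝ) 1) (hη : p.η ∈ Set.Ioc (0 : ℝ) 1)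
    (hβw₁ : 1 ≤ p.βw H d (Fintype.card A))
    (hβwK : p.βw H d (Fintype.card A) ≤ p.K)
    {Ω : Type*} [mΩ : MeasurableSpace Ω] (μ : Measure Ω) [IsProbabilityMeasure μ]
    (𝓕 : Filtration ℕ mΩ)
    (s : ℕ → Fin (H + 1) → Ω → S) (a : ℕ → Fin H → Ω → A)
    (g : ℕ → Ω → Fin H → S → A → ℝ) (θf : ℕ → Fin H → Ω → Fin d → ℝ)
    (hI : IsInteraction M p μ 𝓕 s a g θf) :
    1 - p.δ ≤ μ.real {ω | observe s a g θf ω ∈ goodEvent M p} := by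
  obtain ⟨m, hm⟩ := hK
  obtain ⟨ω₀⟩ : Nonempty Ω := nonempty_of_isProbabilityMeasure μ
  have : Nonempty A := ⟨a 0 ⟨0, hH⟩ ω₀⟩
  have hA : 1 ≤ Fintype.card A := Fintype.card_pos
  obtain ⟨hm2, hd, hlog, hβpos, hβK, hdK, hHK⟩ := params_bounds hH hA hm hδ hβw₁ hβwK
  have hK16 : 16 ≤ p.K := by rw [hm]; exact Nat.pow_le_pow_left hm2 4
  have hK0 : 0 < p.K := by omega
  have hδ0 := hδ.1
  have hH' : (0 : ℝ) < H := by exact_mod_cast hH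
  let o : Ω → Observations S A H d := observe s a g θf
  have hper := period_eq p hm
  have hmK : m + 1 ≤ p.K := by
    rw [hm]
    calc m + 1 ≤ m * m := by nlinarith
      _ ≤ m * m * (m * m) := Nat.le_mul_of_pos_right _ (by positivity)
      _ = m ^ 4 := by ring
  set L := p.K ^ 34 * 4 ^ m with hL
  set G : Finset (ParamIdx d m → ℤ) :=
    Fintype.piFinset fun _ => Finset.Icc (-(L : ℤ)) L with hG
  set T₁ : Finset (ℕ × Fin H) := Finset.range p.K ×ˢ Finset.univ with hT₁
  set T₂ : Finset (ℕ × Fin H × ℕ × (ParamIdx d m → ℤ)) :=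
    Finset.range p.K ×ˢ Finset.univ ×ˢ Finset.range (m + 1) ×ˢ G with hT₂
  have hcard₁ : T₁.card = p.K * H := by simp [hT₁]
  have hcardG : G.card = (2 * L + 1) ^ (d * d + (m + 1) * (d + 1)) := by
    rw [hG, Fintype.card_piFinset, Finset.prod_const, Finset.card_univ, card_paramIdx, Int.card_Icc]
    congr 1
    omega
  have hcard₂ : T₂.card
      = p.K * (H * ((m + 1) * (2 * L + 1) ^ (d * d + (m + 1) * (d + 1)))) := by
    simp [hT₂, hcardG]
  have hpos₁ : 0 < T₁.card := by rw [hcard₁]; positivity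
  have hpos₂ : 0 < T₂.card := by rw [hcard₂]; positivity
  set A₁ : ℕ × Fin H → Set Ω := fun i => {ω | d * Real.log (1 + i.1)
      + 2 * Real.log (p.δ / 3 / T₁.card)⁻¹
    < wnorm (design M.toKnownPart (o ω) i.1 i.2)⁻¹
      (∑ τ ∈ Finset.range i.1, (unitClip ((o ω).c τ i.2)
        - visited M.toKnownPart (o ω) τ i.2 ⬝ᵥ M.θg i.2)
          • visited M.toKnownPart (o ω) τ i.2) ^ 2} with hA₁
  set A₂ : ℕ × Fin H × ℕ × (ParamIdx d m → ℤ) → Set Ω := fun i =>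
    {ω | (2 * (H : ℝ)) ^ 2 * (d * Real.log (1 + i.1) + 2 * Real.log (p.δ / 3 / T₂.card)⁻¹)
      < wnorm (design M.toKnownPart (o ω) i.1 i.2.1)⁻¹ (transitionNoise M (o ω) i.1 i.2.1
        (gridValue M.toKnownPart p H (netScale p m ^ 2) i.2.2.1 i.2.2.2)) ^ 2} with hA₂
  set C := 3 * p.βb H d (Fintype.card A) + 8 * βQ H * p.βw H d (Fintype.card A) ^ 2 with hC
  set A₃ : Set Ω := {ω | 2 * ∑ k ∈ Finset.range p.K, Wsum M.toKnownPart p (o ω) k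
      + 2 * (H * C) * Real.log (p.δ / 3)⁻¹
    < ∑ k ∈ Finset.range p.K, M.value (learner M.toKnownPart p (o ω) k).policy
        (bonusW M.toKnownPart p (o ω) k) 0 M.s₁} with hA₃
  -- Costs lie in [0,1] only almost surely. Outside this null set the clipped costs of the noise
  -- bounds agree with the observed ones.
  set N : Set Ω := {ω | ∀ k < p.K, ∀ h x u, g k ω h x u ∈ Set.Icc (0 : ℝ) 1}ᶜ with hN
  have b₁ : μ.real (⋃ i ∈ T₁, A₁ i) ≤ p.δ / 3 := by
    refine measureReal_biUnion_le_of_card T₁ A₁ (by positivity) fun i hi => ?_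
    have hi' := (Finset.mem_product.1 hi).1
    exact hI.measureReal_costNoise_le (Finset.mem_range.1 hi') i.2 (by positivity)
  have b₂ : μ.real (⋃ i ∈ T₂, A₂ i) ≤ p.δ / 3 := by
    refine measureReal_biUnion_le_of_card T₂ A₂ (by positivity) fun i hi => ?_
    have hi' := (Finset.mem_product.1 hi).1
    exact hI.measureReal_transitionNoise_le (Finset.mem_range.1 hi') i.2.1 hH'
      (abs_gridValue_le _ _ _ _ _) (by positivity)
  have b₃ : μ.real A₃ ≤ p.δ / 3 := hI.measureReal_value_gt_le hH hK0 hβpos (by positivity)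
  have b₄ : μ.real N = 0 := by
    rw [measureReal_def, mem_ae_iff.1 hI.ae_cost_mem, ENNReal.toReal_zero]
  have hgood : ∀ ω, ω ∉ (⋃ i ∈ T₁, A₁ i) → ω ∉ (⋃ i ∈ T₂, A₂ i) → ω ∉ A₃ → ω ∉ N →
      o ω ∈ goodEvent M p := by
    intro ω w₁ w₂ w₃ w₄
    have hc : ∀ τ < p.K, ∀ h, (o ω).c τ h ∈ Set.Icc (0 : ℝ) 1 := fun τ hτ h =>
      not_not.1 w₄ τ hτ h _ _
    have hE1 : o ω ∈ event1 M p := by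
      refine mem_event1 M p hc fun k hk h => ?_
      have hni : ω ∉ A₁ (k, h) := fun hmem => w₁ (Set.mem_biUnion
        (Finset.mem_coe.2 (Finset.mem_product.2 ⟨Finset.mem_range.2 hk, Finset.mem_univ h⟩)) hmem)
      refine le_trans ?_ (cost_radius_le hd hH hK0 hδ hk)
      refine add_le_add le_rfl (Real.le_sqrt_of_sq_le ?_)
      have e : (3 * (p.K * H : ℕ) / p.δ : ℝ) = (p.δ / 3 / T₁.card)⁻¹ := by
        rw [hcard₁]
        field_simp
      rw [e]
      exact not_lt.1 hni
    have hB : ∀ k < p.K, ∀ h : Fin H, ∀ n ≤ m, ∀ z ∈ G,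
        wnorm (design M.toKnownPart (o ω) k h)⁻¹ (transitionNoise M (o ω) k h
          (gridValue M.toKnownPart p H (netScale p m ^ 2) n z))
        ≤ p.βp H d (Fintype.card A) - 1 - H * √d := by
      intro k hk h n hn z hz
      have hni : ω ∉ A₂ (k, h, n, z) := fun hmem => w₂ (Set.mem_biUnion
        (Finset.mem_coe.2 (Finset.mem_product.2 ⟨Finset.mem_range.2 hk, Finset.mem_product.2
          ⟨Finset.mem_univ h, Finset.mem_product.2
            ⟨Finset.mem_range.2 (Nat.lt_succ_of_le hn), hz⟩⟩⟩)) hmem)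
      have h1 := transition_radius_le hd hH hA hm hm2 hlog hδ hk hpos₂
        (hcard₂.trans_le (card_net_le hmK (by omega)))
      have e : (3 * (T₂.card : ℝ) / p.δ : ℝ) = (p.δ / 3 / T₂.card)⁻¹ := by
        field_simp
      rw [e] at h1
      have h2 := Real.le_sqrt_of_sq_le (not_lt.1 hni)
      linarith
    have hdK' : √(d : ℝ) ≤ p.K := by
      have h1 : (1 : ℝ) ≤ d := by exact_mod_cast hd
      have h2 : (d : ℝ) ≤ p.K := by exact_mod_cast hdK
      refine le_trans ?_ h2
      rw [Real.sqrt_le_left (by linarith)]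
      exact le_self_pow₀ h1 two_ne_zero
    have hβw0 : 0 < p.βw H d (Fintype.card A) := by linarith
    have hK8 : 8 ≤ p.K := by omega
    obtain ⟨hs1, hs2⟩ := netScale_le_one hK8 m
    have hK1 : (16 : ℝ) ≤ p.K := by exact_mod_cast hK16
    have hr := netScale_pos hK8 m
    have hE2 : o ω ∈ event2 M p := by
      refine mem_event2 M p hH hη.1.le (estimates_bounded M p hH hK0 hα hη
        (by rw [hper]; positivity) (betar_nonneg p H d) (betap_nonneg p H d _) hβw0 hlog hβK hdK'
        (fun τ hτ h => by rw [abs_of_nonneg (hc τ hτ h).1]; exact (hc τ hτ h).2)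
        (fun k hk h => hI.θf_norm k hk h ω) (fun k hk h x u => hI.loss_mem k hk h ω x u)
        (cost_mean_mem M) hE1 (m := m) (L := L) (by rw [hper, hm]; exact (pow_succ' m 3).le)
        (pow_pos hr 2) (coeffBound_le_mul hHK hK8 m) ?_
        (net_step_le hK8 hdK hHK hβw0.le hβwK m) ?_ hB ?_)
      · refine (net_contraction_le hK8 hdK hβwK m).trans (le_trans ?_ (hs1.trans
          (inv_le_one_of_one_le₀ (one_le_pow₀ (by linarith)))))
        gcongr
        calc (2 : ℝ) * p.K ^ 2 ≤ p.K * p.K ^ 2 := by gcongr; linarith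
          _ = (p.K : ℝ) ^ 3 := by ring
          _ ≤ (p.K : ℝ) ^ 10 := pow_le_pow_right₀ (by linarith) (by norm_num)
      · rw [hs2]
        have : ((p.K : ℝ) ^ 4)⁻¹ ≤ 2⁻¹ := by
          gcongr
          calc (2 : ℝ) ≤ p.K := by linarith
            _ ≤ (p.K : ℝ) ^ 4 := le_self_pow₀ (by linarith) (by norm_num)
        linarith
      · have := net_error_le hK8 hHK m
        linarith
    refine ⟨⟨hE1, hE2⟩, ?_⟩
    rw [hA₃, Set.mem_ofPred_eq, not_lt] at w₃
    -- Freedman's bound leaves 2HC log(3/δ), which the stated 4HC log(6K/δ) exceeds.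
    refine w₃.trans (add_le_add le_rfl ?_)
    have hC0 : 0 ≤ C := by
      have : 0 ≤ βQ H := by unfold βQ; positivity
      positivity
    have h1 : Real.log (p.δ / 3)⁻¹ ≤ Real.log (6 * p.K / p.δ) := by
      refine Real.log_le_log (by positivity) ?_
      rw [inv_div]
      gcongr
      linarith
    have h2 : 0 ≤ Real.log (6 * p.K / p.δ) := by
      refine Real.log_nonneg ?_
      rw [le_div_iff₀ hδ0]
      linarith [hδ.2]
    have h3 : 0 ≤ H * C := by positivity
    have h4 := mul_le_mul_of_nonneg_left h1 h3
    have h5 := mul_nonneg h3 h2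
    linarith
  have hcover : (Set.univ : Set Ω) ⊆ ((⋃ i ∈ T₁, A₁ i) ∪ (⋃ i ∈ T₂, A₂ i) ∪ A₃ ∪ N)
      ∪ {ω | o ω ∈ goodEvent M p} := by
    intro ω _
    by_cases hω : ω ∈ (⋃ i ∈ T₁, A₁ i) ∪ (⋃ i ∈ T₂, A₂ i) ∪ A₃ ∪ N
    · exact Or.inl hω
    · simp only [Set.mem_union, not_or] at hω
      exact Or.inr (hgood ω hω.1.1.1 hω.1.1.2 hω.1.2 hω.2)
  have hone : (1 : ℝ) = μ.real Set.univ := by simp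
  have u0 := (measureReal_mono hcover (μ := μ)).trans (measureReal_union_le _ _)
  have u1 := measureReal_union_le (μ := μ) ((⋃ i ∈ T₁, A₁ i) ∪ (⋃ i ∈ T₂, A₂ i) ∪ A₃) N
  have u2 := measureReal_union_le (μ := μ) ((⋃ i ∈ T₁, A₁ i) ∪ (⋃ i ∈ T₂, A₂ i)) A₃
  have u3 := measureReal_union_le (μ := μ) (⋃ i ∈ T₁, A₁ i) (⋃ i ∈ T₂, A₂ i)
  change 1 - p.δ ≤ μ.real {ω | o ω ∈ goodEvent M p}
  linarith

end LinCMDP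

end

theorem mainTheorem4
    {S A : Type*} [Fintype S] [Fintype A]
    [MeasurableSpace S] [DiscreteMeasurableSpace S]
    [MeasurableSpace A] [DiscreteMeasurableSpace A]
    {H d : ℕ} (hH : 1 ≤ H) (M : LinCMDP.LinearCMDP S A H d) (p : LinCMDP.Params)
    (hK : ∃ m : ℕ, p.K = m ^ 4)
    (hδ : p.δ ∈ Set.Ioo (0 : ℝ) 1)
    (hα : p.α ∈ Set.Ioc (0 : ℝ) 1) (hη : p.η ∈ Set.Ioc (0 : ℝ) 1)
    (hαη : 4 * p.α * p.η * (H : ℝ) ^ 3 ≤ 1)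
    (hβw₁ : 1 ≤ p.βw H d (Fintype.card A))
    (hβwK : p.βw H d (Fintype.card A) ≤ p.K)
    {Ω : Type*} [mΩ : MeasurableSpace Ω] (μ : Measure Ω) [IsProbabilityMeasure μ]
    (𝓕 : Filtration ℕ mΩ)
    (s : ℕ → Fin (H + 1) → Ω → S) (a : ℕ → Fin H → Ω → A)
    (g : ℕ → Ω → Fin H → S → A → ℝ) (θf : ℕ → Fin H → Ω → Fin d → ℝ)
    (hI : LinCMDP.IsInteraction M p μ 𝓕 s a g θf) :
    1 - p.δ ≤ μ.real {ω | LinCMDP.observe s a g θf ω ∈ LinCMDP.goodEvent M p} := by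
  exact LinCMDP.one_sub_le_measureReal_goodEvent hH M p hK hδ hα hη hβw₁ hβwK μ 𝓕 s a g θf hI
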